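/- Let $d\ge 2$ and let $E\subset[1,2]$ be nonempty with upper Minkowski dimension $\beta=\limsup_{\delta\to0^+}\frac{\log N(E,\delta)}{\log(1/\delta)}$, where $N(E,\delta)$ is the minimal number of closed intervals of length $\delta$ needed to cover $E$. For a nonempty compact smooth (embedded) hypersurface $S\subset\mathbb{R}^{2d}=\mathbb{R}^d\times\mathbb{R}^d$ without boundary let $\mu_S$ be its normalized surface measure, and for Schwartz functions $f,g:\mathbb{R}^d\to\mathbb{C}$ put $$\mathcal{A}_{\hat\mu_S,E}(f,g)(x)=\sup_{t\in E}\left|\int_S f(x-ty)\,g(x-tz)\,d\mu_S(y,z)\right|,\qquad x\in\mathbb{R}^d.$$ Write $\mathcal{A}_E$ for this operator when $S$ is the unit sphere $S^{2d-1}$. Let $\tau_hf(x)=f(x-h)$, and for $s\ge0$ let $\|f\|_{H^{-s}}=\|(1+|\xi|^2)^{-s/2}\hat f(\xi)\|_{L^2}$. We say that an operator $\mathcal{A}$ satisfies the *continuity estimates at $(2,2,2)$* if there are $\gamma>0$ and $C<\infty$ such that for all Schwartz $f,g$ and all $|h|<1$ $$\|\mathcal{A}(f-\tau_hf,g)\|_{L^2}+\|\mathcal{A}(f,g-\tau_hg)\|_{L^2}\le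 C|h|^{\gamma}\|f\|_{L^2}\|g\|_{L^2},$$ and there are $\gamma_1,\gamma_2>0$ and $C<\infty$ such that for all Schwartz $f,g$ and all $|h_1|,|h_2|<1$ $$\|\mathcal{A}(f-\tau_{h_1}f,g-\tau_{h_2}g)\|_{L^2}\le C|h_1|^{\gamma_1}|h_2|^{\gamma_2}\|f\|_{L^2}\|g\|_{L^2}.$$ 1. If $d>1+\beta$ (which is always the case for $d\ge3$), then for all $s_1,s_2\ge0$ with $s_1+s_2<\frac{d-1-\beta}{2}$ there is $C<\infty$ such that for all Schwartz $f,g$ $$\|\mathcal{A}_E(f,g)\|_{L^2}\le C\|f\|_{H^{-s_1}}\|g\|_{H^{-s_2}}.$$ Moreover, $\mathcal{A}_E$ satisfies the continuity estimates at $(2,2,2)$ unless $(d,\beta)=(2,1)$. 2. Let $S$ be as above and suppose that at every point of $S$ at least $k$ of the $2d-1$ principal curvatures do not vanish, where $k>d+\beta$. Then for all $s_1,s_2\ge0$ with $s_1+s_2<\frac{k-d-\beta}{2}$ there is $C<\infty$ such that for all Schwartz $f,g$ $$\|\mathcal{A}_{\hat\mu_S,E}(f,g)\|_{L^2}\le C\|f\|_{H^{-s_1}}\|g\|_{H^{-s_2}}.$$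 Moreover, $\mathcal{A}_{\hat\mu_S,E}$ satisfies the continuity estimates at $(2,2,2)$. -/

import Mathlib

open MeasureTheory Filter Topology Set
open scoped ENNReal NNReal ContDiff FourierTransform SchwartzMap

noncomputable section

namespace BilinearSurface

/-! ### Hypersurfaces, principal curvatures and surface measure -/

section Hypersurface

variable {V : Type*} [NormedAddCommGroup V] [InnerProductSpace ℝ V] [CompleteSpace V]

/-- `ρ` is a smooth defining function of `S` on the open neighbourhood `U` of `p`: on `U`, the
set `S` is the zero set of `ρ`, and `dρ` does not vanish there. -/
structure IsDefiningFunction (S : Set V) (p : V) (U : Set V) (ρ : V → ℝ) : Prop where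
  isOpen : IsOpen U
  mem : p ∈ U
  smooth : ContDiffOn ℝ ∞ ρ U
  regular : ∀ q ∈ U, fderiv ℝ ρ q ≠ 0
  zeros : S ∩ U = {q ∈ U | ρ q = 0}

/-- A smooth embedded hypersurface without boundary: locally a regular level set. -/
def IsSmoothHypersurface (S : Set V) : Prop :=
  ∀ p ∈ S, ∃ U ρ, IsDefiningFunction S p U ρ

/-- The unit normal field `∇ρ / |∇ρ|` of the level sets of `ρ`. -/
def unitNormal (ρ : V → ℝ) (q : V) : V := ‖gradient ρ q‖⁻¹ • gradient ρ q

/-- The tangent space at `p` of the level set of `ρ` through `p`. -/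
abbrev tangent (ρ : V → ℝ) (p : V) : Submodule ℝ V := (Submodule.span ℝ {unitNormal ρ p})ᗮ

/-- The shape operator `u ↦ -dν_p(u)` of the level set of `ρ` through `p`, as an endomorphism of
the tangent space (`dν_p(u)` is tangent, so the projection only restricts the codomain). -/
def shapeOperator (ρ : V → ℝ) (p : V) : tangent ρ p →ₗ[ℝ] tangent ρ p :=
  ((tangent ρ p).orthogonalProjectionOnto ∘L (-fderiv ℝ (unitNormal ρ) p) ∘L
    (tangent ρ p).subtypeL).toLinearMap

variable [FiniteDimensional ℝ V]

/-- The principal curvatures: the eigenvalues of the shape operator, with multiplicity. -/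
def principalCurvatures (ρ : V → ℝ) (p : V) : Multiset ℝ := (shapeOperator ρ p).charpoly.roots

/-- At every point of `S`, at least `k` of the principal curvatures do not vanish.  (Another
defining function can only change the signs of all principal curvatures at the point.) -/
def HasNonvanishingCurvatures (S : Set V) (k : ℕ) : Prop :=
  ∀ p ∈ S, ∃ U ρ, IsDefiningFunction S p U ρ ∧
    k ≤ Multiset.card ((principalCurvatures ρ p).filter (· ≠ 0))

variable [MeasurableSpace V] [BorelSpace V]

/-- The normalized surface measure of a compact hypersurface `S`: Hausdorff measure of dimension
`dim V - 1` on `S`, divided by its total mass. -/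
def surfaceMeasure (S : Set V) : Measure V :=
  (Measure.hausdorffMeasure ((Module.finrank ℝ V : ℝ) - 1) S)⁻¹ •
    (Measure.hausdorffMeasure ((Module.finrank ℝ V : ℝ) - 1)).restrict S

end Hypersurface

/-! ### Minkowski dimension -/

/-- Minimal number of closed intervals of length `δ` that cover the (bounded) set `E ⊆ ℝ`. -/
def coveringCount (E : Set ℝ) (δ : ℝ) : ℕ :=
  sInf {n : ℕ | ∃ a : Fin n → ℝ, E ⊆ ⋃ i, Icc (a i) (a i + δ)}

/-- The upper Minkowski dimension of a nonempty bounded set `E ⊆ ℝ`. -/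
def upperMinkowskiDim (E : Set ℝ) : EReal :=
  limsup (fun δ : ℝ => ((Real.log (coveringCount E δ) / Real.log (1 / δ) : ℝ) : EReal)) (𝓝[>] 0)

/-! ### Bilinear averages and their maximal functions -/

/-- `ℝ^d`. -/
abbrev Sp (d : ℕ) : Type := EuclideanSpace ℝ (Fin d)

/-- `ℝ^{2d} = ℝ^d × ℝ^d`, with the Euclidean norm. -/
abbrev Sp2 (d : ℕ) : Type := WithLp 2 (Sp d × Sp d)

variable {d : ℕ}

/-- The bilinear average `∫ f(x - t y) g(x - t z) dμ(y, z)`. -/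
def average (μ : Measure (Sp2 d)) (t : ℝ) (f g : Sp d → ℂ) (x : Sp d) : ℂ :=
  ∫ p, f (x - t • p.fst) * g (x - t • p.snd) ∂μ

/-- The maximal function `sup_{t ∈ E} |∫ f(x - t y) g(x - t z) dμ(y, z)|`, valued in `[0, ∞]`. -/
def maximal (μ : Measure (Sp2 d)) (E : Set ℝ) (f g : Sp d → ℂ) (x : Sp d) : ℝ≥0∞ :=
  ⨆ t ∈ E, ‖average μ t f g x‖ₑ

/-- The `L²` norm of the maximal function. -/
def maximalL2 (μ : Measure (Sp2 d)) (E : Set ℝ) (f g : Sp d → ℂ) : ℝ≥0∞ :=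
  (∫⁻ x, maximal μ E f g x ^ 2) ^ (1 / 2 : ℝ)

/-- The norm `‖(1 + |ξ|²)^{-s/2} f̂(ξ)‖_{L²}` of the Sobolev space `H^{-s}`. -/
def sobolevNegNorm (s : ℝ) (f : Sp d → ℂ) : ℝ≥0∞ :=
  eLpNorm (fun ξ : Sp d => (((1 + ‖ξ‖ ^ 2) ^ (-s / 2) : ℝ) : ℂ) * 𝓕 f ξ) 2 volume

/-- The translate `τ_h f (x) = f (x - h)`. -/
def translate (h : Sp d) (f : Sp d → ℂ) : Sp d → ℂ := fun x => f (x - h)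

/-- `‖A_{μ,E}(f, g)‖_{L²} ≲ ‖f‖_{H^{-s₁}} ‖g‖_{H^{-s₂}}`. -/
def SobolevSmoothing (μ : Measure (Sp2 d)) (E : Set ℝ) (s₁ s₂ : ℝ) : Prop :=
  ∃ C : ℝ≥0, ∀ f g : 𝓢(Sp d, ℂ),
    maximalL2 μ E f g ≤ C * sobolevNegNorm s₁ f * sobolevNegNorm s₂ g

/-- The continuity estimate at `(2,2,2)` with a translation in one input. -/
def ContinuityOneInput (μ : Measure (Sp2 d)) (E : Set ℝ) : Prop :=
  ∃ γ : ℝ, 0 < γ ∧ ∃ C : ℝ≥0, ∀ h : Sp d, ‖h‖ < 1 → ∀ f g : 𝓢(Sp d, ℂ),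
    maximalL2 μ E (f - translate h f) g + maximalL2 μ E f (g - translate h g) ≤
      C * ENNReal.ofReal (‖h‖ ^ γ) * eLpNorm f 2 volume * eLpNorm g 2 volume

/-- The continuity estimate at `(2,2,2)` with translations in both inputs. -/
def ContinuityBothInputs (μ : Measure (Sp2 d)) (E : Set ℝ) : Prop :=
  ∃ γ₁ γ₂ : ℝ, 0 < γ₁ ∧ 0 < γ₂ ∧ ∃ C : ℝ≥0, ∀ h₁ h₂ : Sp d, ‖h₁‖ < 1 → ‖h₂‖ < 1 →
    ∀ f g : 𝓢(Sp d, ℂ),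
      maximalL2 μ E (f - translate h₁ f) (g - translate h₂ g) ≤
        C * ENNReal.ofReal (‖h₁‖ ^ γ₁ * ‖h₂‖ ^ γ₂) * eLpNorm f 2 volume * eLpNorm g 2 volume

/-- The normalized surface measure `σ_{2d-1}` on the unit sphere of `ℝ^{2d}`. -/
def sphereMeasure (d : ℕ) : Measure (Sp2 d) := surfaceMeasure (Metric.sphere (0 : Sp2 d) 1)

end BilinearSurface

end

open MeasureTheory Filter Topology Set
open scoped ENNReal NNReal ContDiff FourierTransform SchwartzMap

noncomputable section

namespace BilinearSurface

set_option linter.unusedSectionVars false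
/-! ### Oscillatory integrals -/

section Nonstationary

variable {P X : Type*} [NormedAddCommGroup P] [NormedSpace ℝ P] [NormedAddCommGroup X]
  [InnerProductSpace ℝ X] [FiniteDimensional ℝ X] [MeasurableSpace X] [BorelSpace X]

/-! By Fourier inversion the bilinear average is a bilinear multiplier operator with symbol `μ̂(t(ξ,
η))`, where `μ` is the surface measure. Two facts carry the theorem: the decay `|μ̂(ζ)| ≲ (1 +
|ζ|)^(-k/2)` for `k` nonvanishing curvatures (`surface_decay`), and an `L² × L² → L²` bound that
sees only the size of the symbol (`lintegral_extension_sq_le`). If a symbol is bounded by `A` and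
`ξ` stays in a ball of radius `2^j`, Cauchy–Schwarz on the fibre `ξ + η = ζ` and Plancherel in `ζ`
give the norm `≲ 2^(jd/2) A`.

On the shell `|(ξ, η)| ≈ 2^j` one has `A ≈ 2^(-jk/2)`. A derivative in `t` costs `2^j`, so the
supremum over an interval of length `2^(-j)` costs only a constant. Covering `E` takes at most about
`2^(jγ)` such intervals for each `γ > β`, which costs `2^(jγ/2)` in `L²`; the Sobolev weights cost
`2^(j(s₁ + s₂))`. The sum over `j` is geometric when `s₁ + s₂ < (k - d - β)/2`, with `γ` close to
`β` (`sobolevSmoothing_of_decay`). The sphere has `k = 2d - 1`. The continuity estimates follow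
because `|1 - e^(iθ)| ≤ 2|θ|^s` turns a gain of `s` derivatives into a factor `|h|^s`.

For the decay, the surface is written locally as a graph over a tangent space. The Hessian of the
graph function at the base point is the second fundamental form, and the area formula turns the
surface integral into an oscillatory integral with phase `⟪ξ, x⟫ + s φ(x)` (`oscillatory_decay`). If
the linear part dominates, nonstationary phase applies. Otherwise the directions in the kernel of
the Hessian are frozen, and the squared modulus of the integral over the complement `X` is written
as an integral of autocorrelations over shifts `u`. The difference of the phases at `x + u` and `x`
contains the linear part only as a constant, and its `x`-gradient has size about `|s| |u|`. Hence
the autocorrelation is `O((1 + |s||u|)^(-N))`, and integration in `u` yields `|s|^(-dim X)`. No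
Morse lemma is needed, and the argument is uniform in the frozen variables. Smooth amplitudes must
be allowed throughout, since differentiating the symbol in `t` inserts a linear factor. -/

/-- The derivative of a function on a product in a direction of the second factor. -/
def partialDeriv {F : Type*} [NormedAddCommGroup F] [NormedSpace ℝ F] (b : P × X → F) (v : X)
    (z : P × X) : F := fderiv ℝ b z (0, v)

theorem hasFDerivAt_slice {F : Type*} [NormedAddCommGroup F] [NormedSpace ℝ F] {b : P × X → F}
    {θ : P} {x : X} (hb : DifferentiableAt ℝ b (θ, x)) :
    HasFDerivAt (fun x => b (θ, x)) ((fderiv ℝ b (θ, x)).comp (ContinuousLinearMap.inr ℝ P X)) x :=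
  hb.hasFDerivAt.comp x (hasFDerivAt_prodMk_right θ x)

theorem contDiff_partialDeriv {F : Type*} [NormedAddCommGroup F] [NormedSpace ℝ F]
    {b : P × X → F} (hb : ContDiff ℝ ∞ b) (v : X) : ContDiff ℝ ∞ (partialDeriv b v) :=
  (hb.fderiv_right (m := ∞) (by simp)).clm_apply contDiff_const

theorem tsupport_partialDeriv_subset {F : Type*} [NormedAddCommGroup F] [NormedSpace ℝ F]
    (b : P × X → F) (v : X) : tsupport (partialDeriv b v) ⊆ tsupport b :=
  (closure_mono (fun z hz => by
    rw [Function.mem_support] at hz ⊢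
    intro h
    exact hz (by simp [partialDeriv, h]))).trans (tsupport_fderiv_subset ℝ (f := b))

theorem hasCompactSupport_slice {F : Type*} [NormedAddCommGroup F] {b : P × X → F}
    (hb : HasCompactSupport b) (θ : P) : HasCompactSupport fun x => b (θ, x) := by
  refine HasCompactSupport.intro (hb.isCompact.image continuous_snd) fun x hx => ?_
  by_contra h
  exact hx ⟨(θ, x), subset_tsupport _ h, rfl⟩

theorem exists_bound_integral_slice {b : P × X → ℂ} (hb : Continuous b)
    (hs : HasCompactSupport b) : ∃ C, 0 ≤ C ∧ ∀ θ, ∫ x, ‖b (θ, x)‖ ≤ C := by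
  obtain ⟨M, hM⟩ := hb.bounded_above_of_compact_support hs
  set K : Set X := Prod.snd '' tsupport b
  have hK : IsCompact K := hs.isCompact.image continuous_snd
  refine ⟨max M 0 * volume.real K, by positivity, fun θ => ?_⟩
  have h0 : ∀ x, x ∉ K → ‖b (θ, x)‖ = 0 := fun x hx => by
    by_contra h
    exact hx ⟨(θ, x), subset_tsupport _ (by simpa using h), rfl⟩
  rw [← setIntegral_eq_integral_of_forall_compl_eq_zero h0]
  have := norm_setIntegral_le_of_norm_le_const (μ := volume) (s := K)
    (f := fun x => ‖b (θ, x)‖) (C := max M 0) hK.measure_lt_top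
    (fun x _ => by simpa using Or.inl (hM (θ, x)))
  exact (le_abs_self _).trans this

variable {Ψ : P × X → ℝ}

/-- One integration by parts along the gradient of the phase. -/
theorem nonstationary_step (hΨ : ContDiff ℝ ∞ Ψ) {b : P × X → ℂ} (hb : ContDiff ℝ ∞ b)
    (hs : HasCompactSupport b) (h0 : ∀ z ∈ tsupport b, ∃ v : X, fderiv ℝ Ψ z (0, v) ≠ 0) :
    ∃ b' : P × X → ℂ, ContDiff ℝ ∞ b' ∧ HasCompactSupport b' ∧ tsupport b' ⊆ tsupport b ∧
      ∀ θ, ∀ r : ℝ, |r| * ‖∫ x, Complex.exp (Complex.I * (r * Ψ (θ, x) : ℝ)) * b (θ, x)‖ =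
        ‖∫ x, Complex.exp (Complex.I * (r * Ψ (θ, x) : ℝ)) * b' (θ, x)‖ := by
  set e := stdOrthonormalBasis ℝ X
  set q : P × X → ℝ := fun z => ∑ j, (partialDeriv Ψ (e j) z) ^ 2 with hq
  have hqs : ContDiff ℝ ∞ q := ContDiff.sum fun j _ => (contDiff_partialDeriv hΨ _).pow 2
  have hq0 : ∀ z ∈ tsupport b, q z ≠ 0 := by
    intro z hz hqz
    obtain ⟨v, hv⟩ := h0 z hz
    rw [hq] at hqz
    have h1 := (Finset.sum_eq_zero_iff_of_nonneg (fun j _ => sq_nonneg _)).1 hqz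
    apply hv
    have : (0, v) = ∑ j, (inner ℝ (e j) v) • ((0, e j) : P × X) := by
      ext
      · simp [Prod.fst_sum]
      · simp [Prod.snd_sum, e.sum_repr' v]
    rw [this, map_sum]
    refine Finset.sum_eq_zero fun j hj => ?_
    have := h1 j hj
    rw [map_smul]
    simp only [partialDeriv, ne_eq, OfNat.ofNat_ne_zero, not_false_eq_true, pow_eq_zero_iff] at this
    simp [this]
  -- This is the vector field `b ∇Ψ / |∇Ψ|²`, with the gradient taken in `x` only. Its inner product
  -- with `∇Ψ` is `b`, so the new amplitude is its divergence.
  set c : Fin (Module.finrank ℝ X) → P × X → ℂ :=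
    fun j z => b z * ((partialDeriv Ψ (e j) z / q z : ℝ) : ℂ) with hc
  have hcsupp : ∀ j, tsupport (c j) ⊆ tsupport b := fun j => tsupport_mul_subset_left
  have hcs : ∀ j, ContDiff ℝ ∞ (c j) := by
    intro j
    rw [contDiff_iff_contDiffAt]
    intro z
    by_cases hz : z ∈ tsupport b
    · exact hb.contDiffAt.mul (Complex.ofRealCLM.contDiff.contDiffAt.comp z
        ((contDiff_partialDeriv hΨ _).contDiffAt.div hqs.contDiffAt (hq0 z hz)))
    · have : c j =ᶠ[𝓝 z] fun _ => 0 := by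
        have := notMem_tsupport_iff_eventuallyEq.1 hz
        filter_upwards [this] with y hy
        simp [hc, hy]
      exact contDiffAt_const.congr_of_eventuallyEq this
  have hbc : ∀ z, b z = ∑ j, ((partialDeriv Ψ (e j) z : ℝ) : ℂ) * c j z := by
    intro z
    by_cases hz : z ∈ tsupport b
    · have h2 : (∑ j, ((partialDeriv Ψ (e j) z : ℝ) : ℂ) * c j z) =
          b z * ((∑ j, (partialDeriv Ψ (e j) z) ^ 2 : ℝ) / q z : ℝ) := by
        push_cast
        rw [Finset.sum_div, Finset.mul_sum]
        refine Finset.sum_congr rfl fun j _ => ?_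
        simp only [hc]
        push_cast
        ring
      rw [h2, show (∑ j, (partialDeriv Ψ (e j) z) ^ 2) = q z from rfl, div_self (hq0 z hz)]
      simp
    · have : b z = 0 := image_eq_zero_of_notMem_tsupport hz
      simp [hc, this]
  refine ⟨fun z => ∑ j, partialDeriv (c j) (e j) z,
    ContDiff.sum fun j _ => contDiff_partialDeriv (hcs j) _, ?_, ?_, ?_⟩
  · refine HasCompactSupport.of_support_subset_isCompact hs.isCompact fun z hz => ?_
    by_contra h
    refine hz (Finset.sum_eq_zero fun j _ => ?_)
    exact image_eq_zero_of_notMem_tsupport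
      fun h' => h (hcsupp j (tsupport_partialDeriv_subset _ _ h'))
  · refine closure_minimal (fun z hz => ?_) (isClosed_tsupport _)
    by_contra h
    refine hz (Finset.sum_eq_zero fun j _ => ?_)
    exact image_eq_zero_of_notMem_tsupport
      fun h' => h (hcsupp j (tsupport_partialDeriv_subset _ _ h'))
  intro θ r
  set E : X → ℂ := fun x => Complex.exp (Complex.I * (r * Ψ (θ, x) : ℝ)) with hE
  have hΨd : ∀ x, HasFDerivAt (fun x => Ψ (θ, x))
      ((fderiv ℝ Ψ (θ, x)).comp (ContinuousLinearMap.inr ℝ P X)) x := fun x =>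
    hasFDerivAt_slice (hΨ.differentiable (by simp) _)
  have hEd : ∀ x, HasFDerivAt E (E x • (Complex.I • Complex.ofRealCLM.comp
      (r • (fderiv ℝ Ψ (θ, x)).comp (ContinuousLinearMap.inr ℝ P X)))) x := by
    intro x
    exact ((Complex.ofRealCLM.hasFDerivAt.comp x ((hΨd x).const_mul r)).const_mul Complex.I).cexp
  have hEc : Continuous E := continuous_iff_continuousAt.2 fun x => (hEd x).continuousAt
  have hslice : ∀ {b : P × X → ℂ}, Continuous b → Continuous fun x => b (θ, x) :=
    fun h => h.comp (by fun_prop)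
  have hint : ∀ {b : P × X → ℂ}, Continuous b → HasCompactSupport b →
      Integrable fun x => E x * b (θ, x) := fun {b} h h' =>
    (hEc.mul (hslice h)).integrable_of_hasCompactSupport (hasCompactSupport_slice h' θ).mul_left
  have hcc : ∀ j, HasCompactSupport (c j) := fun j => hs.mul_right
  have hpc : ∀ j, HasCompactSupport (partialDeriv (c j) (e j)) := fun j =>
    HasCompactSupport.of_support_subset_isCompact (hcc j).isCompact
      (subset_closure.trans (tsupport_partialDeriv_subset _ _))
  have key : ∀ j, ∫ x, E x * partialDeriv (c j) (e j) (θ, x) =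
      -(Complex.I * r * ∫ x, E x * (partialDeriv Ψ (e j) (θ, x) * c j (θ, x))) := by
    intro j
    have hcd : ∀ x, HasFDerivAt (fun x => c j (θ, x))
        ((fderiv ℝ (c j) (θ, x)).comp (ContinuousLinearMap.inr ℝ P X)) x := fun x =>
      hasFDerivAt_slice ((hcs j).differentiable (by simp) _)
    have hE' : ∀ x, (E x • (Complex.I • Complex.ofRealCLM.comp
        (r • (fderiv ℝ Ψ (θ, x)).comp (ContinuousLinearMap.inr ℝ P X)))) (e j) * c j (θ, x) =
        Complex.I * r * (E x * (partialDeriv Ψ (e j) (θ, x) * c j (θ, x))) := by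
      intro x
      simp [partialDeriv]
      ring
    have := integral_bilinear_hasFDerivAt_right_eq_neg_left_of_integrable (μ := volume)
      (B := ContinuousLinearMap.mul ℝ ℂ) (f := E) (g := fun x => c j (θ, x)) (v := e j)
      (f' := fun x => E x • (Complex.I • Complex.ofRealCLM.comp
        (r • (fderiv ℝ Ψ (θ, x)).comp (ContinuousLinearMap.inr ℝ P X))))
      (g' := fun x => (fderiv ℝ (c j) (θ, x)).comp (ContinuousLinearMap.inr ℝ P X))
      (by
        simp only [ContinuousLinearMap.mul_apply']
        simp_rw [hE']
        refine Integrable.const_mul ?_ _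
        exact hint (b := fun z => ((partialDeriv Ψ (e j) z : ℝ) : ℂ) * c j z)
          ((Complex.continuous_ofReal.comp (contDiff_partialDeriv hΨ _).continuous).mul
            (hcs j).continuous) (hcc j).mul_left)
      (by
        simpa [partialDeriv] using hint (contDiff_partialDeriv (hcs j) (e j)).continuous (hpc j))
      (by simpa using hint (hcs j).continuous (hcc j))
      (fun x _ => hEd x) (fun x _ => hcd x)
    simp only [ContinuousLinearMap.mul_apply'] at this
    simp_rw [hE'] at this
    rw [integral_const_mul] at this
    simpa [partialDeriv] using this
  have h1 : ∫ x, E x * ∑ j, partialDeriv (c j) (e j) (θ, x) =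
      -(Complex.I * r * ∫ x, E x * b (θ, x)) := by
    simp_rw [Finset.mul_sum]
    rw [integral_finsetSum _ fun j _ =>
      hint (contDiff_partialDeriv (hcs j) (e j)).continuous (hpc j)]
    simp_rw [key]
    rw [Finset.sum_neg_distrib, ← Finset.mul_sum, ← integral_finsetSum]
    · congr 3
      ext x
      rw [hbc, Finset.mul_sum]
    · intro j _
      exact hint (b := fun z => ((partialDeriv Ψ (e j) z : ℝ) : ℂ) * c j z)
          ((Complex.continuous_ofReal.comp (contDiff_partialDeriv hΨ _).continuous).mul
            (hcs j).continuous) (hcc j).mul_left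
  rw [h1, norm_neg, norm_mul, norm_mul, Complex.norm_I, one_mul, Complex.norm_real,
    Real.norm_eq_abs]

/-- Nonstationary phase with smooth compactly supported dependence on a parameter. -/
theorem nonstationary_of_hasCompactSupport (hΨ : ContDiff ℝ ∞ Ψ) (N : ℕ) :
    ∀ {b : P × X → ℂ}, ContDiff ℝ ∞ b → HasCompactSupport b →
      (∀ z ∈ tsupport b, ∃ v : X, fderiv ℝ Ψ z (0, v) ≠ 0) →
      ∃ C, 0 ≤ C ∧ ∀ θ, ∀ r : ℝ,
        |r| ^ N * ‖∫ x, Complex.exp (Complex.I * (r * Ψ (θ, x) : ℝ)) * b (θ, x)‖ ≤ C := by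
  induction N with
  | zero =>
    intro b hb hs _
    obtain ⟨C, hC, h⟩ := exists_bound_integral_slice hb.continuous hs
    refine ⟨C, hC, fun θ r => ?_⟩
    rw [pow_zero, one_mul]
    refine (norm_integral_le_integral_norm _).trans (le_trans (le_of_eq ?_) (h θ))
    congr 1
    ext x
    rw [norm_mul, mul_comm Complex.I, Complex.norm_exp_ofReal_mul_I, one_mul]
  | succ N ih =>
    intro b hb hs h0
    obtain ⟨b', hb', hs', hsub, hstep⟩ := nonstationary_step hΨ hb hs h0
    obtain ⟨C, hC, h⟩ := ih hb' hs' fun z hz => h0 z (hsub hz)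
    refine ⟨C, hC, fun θ r => ?_⟩
    rw [pow_succ, mul_assoc, hstep θ r]
    exact h θ r

/-- Nonstationary phase, uniformly for parameters in a compact set. -/
theorem nonstationary [FiniteDimensional ℝ P] (hΨ : ContDiff ℝ ∞ Ψ) (N : ℕ) {b : P × X → ℂ}
    (hb : ContDiff ℝ ∞ b) {Θ : Set P} (hΘ : IsCompact Θ) {K : Set X} (hK : IsCompact K)
    (hbK : ∀ θ, ∀ x ∉ K, b (θ, x) = 0)
    (h0 : ∀ θ ∈ Θ, ∀ x ∈ K, ∃ v : X, fderiv ℝ Ψ (θ, x) (0, v) ≠ 0) :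
    ∃ C, 0 ≤ C ∧ ∀ θ ∈ Θ, ∀ r : ℝ,
      |r| ^ N * ‖∫ x, Complex.exp (Complex.I * (r * Ψ (θ, x) : ℝ)) * b (θ, x)‖ ≤ C := by
  have hopen : IsOpen {z : P × X | ∃ v : X, fderiv ℝ Ψ z (0, v) ≠ 0} := by
    have : {z : P × X | ∃ v : X, fderiv ℝ Ψ z (0, v) ≠ 0} =
        ⋃ v : X, {z | partialDeriv Ψ v z ≠ 0} := by
      ext z; simp [partialDeriv]
    rw [this]
    exact isOpen_iUnion fun v =>
      isOpen_ne_fun (contDiff_partialDeriv hΨ v).continuous continuous_const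
  -- The gradient is nonzero on a neighbourhood of `Θ × K`. A cutoff in the parameter, equal to 1 on
  -- `Θ`, makes the amplitude compactly supported in both variables without changing the integrals
  -- for `θ ∈ Θ`.
  obtain ⟨O, O', hO, -, hΘO, hKO, hOO⟩ := generalized_tube_lemma hΘ hK hopen
    (fun z hz => h0 z.1 hz.1 z.2 hz.2)
  obtain ⟨L, hL, hΘL, hLO⟩ := exists_compact_between hΘ hO hΘO
  obtain ⟨η, h1, hη0, -⟩ := exists_contMDiffMap_one_nhds_of_subset_interior (n := (⊤ : ℕ∞))
    (modelWithCornersSelf ℝ P) hΘ.isClosed hΘL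
  have hηs : ContDiff ℝ ∞ (η : P → ℝ) := η.contMDiff.contDiff
  set b' : P × X → ℂ := fun z => ((η z.1 : ℝ) : ℂ) * b z with hb'
  have hout : ∀ z, z ∉ L ×ˢ K → b' z = 0 := by
    intro z hz
    by_cases h1 : z.1 ∈ L
    · simp [hb', hbK z.1 z.2 fun h2 => hz ⟨h1, h2⟩]
    · simp [hb', hη0 z.1 h1]
  obtain ⟨C, hC, h⟩ := nonstationary_of_hasCompactSupport hΨ N (b := b')
    ((Complex.ofRealCLM.contDiff.comp (hηs.comp contDiff_fst)).mul hb)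
    (HasCompactSupport.intro (hL.prod hK) hout) (by
      intro z hz
      have : z ∈ L ×ˢ K := closure_minimal (s := Function.support b')
        (fun z hz => by_contra fun h => hz (hout z h))
        (hL.isClosed.prod hK.isClosed) hz
      exact hOO ⟨hLO this.1, hKO this.2⟩)
  refine ⟨C, hC, fun θ hθ r => ?_⟩
  have : η θ = 1 := h1.self_of_nhdsSet θ hθ
  simpa [hb', this] using h θ r

end Nonstationary

/-! ### Difference quotients of the phase -/

section Stationary

/-- The integral is the value at 0 of the convolution of the indicator of `(0, 1]` with `t ↦ F(q,
-t) χ(t)`, where the bump `χ` is 1 on `[-1, 1]`. Smoothness in `q` is thus that of a convolution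
with parameters. -/
theorem contDiff_intervalIntegral {Q : Type*} [NormedAddCommGroup Q] [NormedSpace ℝ Q]
    {F : Q × ℝ → ℝ} (hF : ContDiff ℝ ∞ F) : ContDiff ℝ ∞ fun q => ∫ s in (0 : ℝ)..1, F (q, s) := by
  let χ : ContDiffBump (0 : ℝ) := ⟨1, 2, one_pos, one_lt_two⟩
  have h := contDiffOn_convolution_right_with_param_comp (μ := volume) (n := (⊤ : ℕ∞))
    (ContinuousLinearMap.mul ℝ ℝ)
    (s := (univ : Set Q)) (v := fun _ => (0 : ℝ)) contDiffOn_const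
    (f := Set.indicator (Ioc (0 : ℝ) 1) 1) (g := fun q t => F (q, -t) * χ t)
    (k := Metric.closedBall 0 2) isOpen_univ (isCompact_closedBall _ _)
    (fun q t _ ht => by
      have : χ t = 0 := χ.zero_of_le_dist (by
        simp only [Metric.mem_closedBall, dist_zero_right, not_le] at ht
        simpa [χ] using ht.le)
      simp [this])
    (((integrable_indicator_iff measurableSet_Ioc).2 (integrableOn_const (C := (1 : ℝ))
      (by simp))).locallyIntegrable)
    (by
      apply ContDiff.contDiffOn
      exact (hF.comp (contDiff_fst.prodMk contDiff_snd.neg)).mul (χ.contDiff.comp contDiff_snd))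
  rw [contDiffOn_univ] at h
  convert! h using 2 with q
  rw [intervalIntegral.integral_of_le zero_le_one, convolution_def,
    ← integral_indicator measurableSet_Ioc]
  congr 1
  ext t
  by_cases ht : t ∈ Ioc (0 : ℝ) 1
  · have : χ (0 - t) = 1 := χ.one_of_mem_closedBall (by
      simp [χ, abs_of_pos ht.1, ht.2])
    simp only [indicator_of_mem ht, ContinuousLinearMap.mul_apply', Pi.one_apply, this]
    simp
  · simp [indicator_of_notMem ht]

variable {T X Y : Type*} [NormedAddCommGroup T] [InnerProductSpace ℝ T]
  [NormedAddCommGroup X] [InnerProductSpace ℝ X] [FiniteDimensional ℝ X] [MeasurableSpace X]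
  [BorelSpace X] [NormedAddCommGroup Y] [InnerProductSpace ℝ Y] [FiniteDimensional ℝ Y]

/-- The difference quotient `(φ(y + x + r e) - φ(y + x)) / r`, as a smooth function. -/
def phaseQuotient (ι : X →ₗᵢ[ℝ] T) (κ : Y →ₗᵢ[ℝ] T) (φ : T → ℝ) (z : (Y × ℝ × X) × X) : ℝ :=
  ∫ s in (0 : ℝ)..1, fderiv ℝ φ (κ z.1.1 + ι z.2 + (s * z.1.2.1) • ι z.1.2.2) (ι z.1.2.2)

theorem contDiff_phaseQuotient (ι : X →ₗᵢ[ℝ] T) (κ : Y →ₗᵢ[ℝ] T) {φ : T → ℝ}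
    (hφ : ContDiff ℝ ∞ φ) : ContDiff ℝ ∞ (phaseQuotient ι κ φ) := by
  apply contDiff_intervalIntegral (F := fun p : ((Y × ℝ × X) × X) × ℝ =>
    fderiv ℝ φ (κ p.1.1.1 + ι p.1.2 + (p.2 * p.1.1.2.1) • ι p.1.1.2.2) (ι p.1.1.2.2))
  have h1 : ContDiff ℝ ∞ (fderiv ℝ φ) := hφ.fderiv_right (m := ∞) (by simp)
  have hι : ContDiff ℝ ∞ ι := ι.contDiff
  have hκ : ContDiff ℝ ∞ κ := κ.contDiff
  refine (h1.comp ?_).clm_apply ?_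
  · fun_prop
  · fun_prop

theorem mul_phaseQuotient (ι : X →ₗᵢ[ℝ] T) (κ : Y →ₗᵢ[ℝ] T) {φ : T → ℝ}
    (hφ : ContDiff ℝ ∞ φ) (y : Y) (r : ℝ) (e x : X) :
    r * phaseQuotient ι κ φ ((y, r, e), x) = φ (κ y + ι x + r • ι e) - φ (κ y + ι x) := by
  have hd : ∀ s : ℝ, HasDerivAt (fun s : ℝ => φ (κ y + ι x + (s * r) • ι e))
      (r * fderiv ℝ φ (κ y + ι x + (s * r) • ι e) (ι e)) s := by
    intro s
    have h1 : HasDerivAt (fun s : ℝ => κ y + ι x + (s * r) • ι e) (r • ι e) s := by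
      simpa using (((hasDerivAt_id s).mul_const r).smul_const (ι e)).const_add (κ y + ι x)
    have := (hφ.differentiable (by simp) (κ y + ι x + (s * r) • ι e)).hasFDerivAt.comp_hasDerivAt s h1
    exact this.congr_deriv (by simp)
  have h1 : ContDiff ℝ ∞ (fderiv ℝ φ) := hφ.fderiv_right (m := ∞) (by simp)
  have hc : Continuous fun s : ℝ => r * fderiv ℝ φ (κ y + ι x + (s * r) • ι e) (ι e) := by
    have : Continuous fun s : ℝ => fderiv ℝ φ (κ y + ι x + (s * r) • ι e) :=
      h1.continuous.comp (by fun_prop)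
    fun_prop
  have := intervalIntegral.integral_eq_sub_of_hasDerivAt (a := 0) (b := 1) (fun s _ => hd s)
    (hc.intervalIntegrable _ _)
  rw [intervalIntegral.integral_const_mul] at this
  simpa [phaseQuotient] using this

/-- If `D²φ` is close to a nondegenerate form, the difference quotient has no critical points. -/
theorem exists_fderiv_phaseQuotient_ne_zero (ι : X →ₗᵢ[ℝ] T) (κ : Y →ₗᵢ[ℝ] T) {φ : T → ℝ}
    (hφ : ContDiff ℝ ∞ φ) {B : X →L[ℝ] X →L[ℝ] ℝ} {c R : ℝ} (hc : 0 < c)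
    (hB : ∀ e, 2 * c * ‖e‖ ≤ ‖B e‖)
    (hφB : ∀ z, ‖z‖ ≤ 4 * R → ∀ v w : X,
      |fderiv ℝ (fderiv ℝ φ) z (ι v) (ι w) - B v w| ≤ c * ‖v‖ * ‖w‖)
    {y : Y} (hy : ‖y‖ ≤ R) {r : ℝ} (hr0 : 0 ≤ r) (hr : r ≤ 2 * R) {e : X} (he : ‖e‖ = 1) {x : X}
    (hx : ‖x‖ ≤ R) :
    ∃ v : X, fderiv ℝ (phaseQuotient ι κ φ) ((y, r, e), x) (0, v) ≠ 0 := by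
  have h1 : ContDiff ℝ ∞ (fderiv ℝ φ) := hφ.fderiv_right (m := ∞) (by simp)
  -- The functional `B e` has norm at least `2c`, so it exceeds `c` in some direction `v`; the error
  -- `c` in `hφB` cannot cancel it.
  obtain ⟨v, hv⟩ : ∃ v, c * ‖v‖ < ‖B e v‖ := by
    by_contra! h
    have := (B e).opNorm_le_bound hc.le h
    have := hB e
    rw [he] at this
    linarith
  refine ⟨v, fun h0 => ?_⟩
  have hz : ∀ τ, 0 ≤ τ → τ ≤ r → ‖κ y + ι x + τ • ι e‖ ≤ 4 * R := by
    intro τ h0 h1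
    calc ‖κ y + ι x + τ • ι e‖ ≤ ‖κ y‖ + ‖ι x‖ + ‖τ • ι e‖ := norm_add₃_le
      _ = ‖y‖ + ‖x‖ + τ := by simp [norm_smul, he, abs_of_nonneg h0]
      _ ≤ 4 * R := by linarith
  have hslice := hasFDerivAt_slice (θ := (y, r, e)) (x := x)
    ((contDiff_phaseQuotient ι κ hφ).differentiable (by simp) ((y, r, e), x))
  have hfd : ∀ u : T, HasFDerivAt (fun x : X => φ (κ y + ι x + u))
      ((fderiv ℝ φ (κ y + ι x + u)).comp ι.toContinuousLinearMap) x := by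
    intro u
    have h2 : HasFDerivAt (fun x : X => κ y + ι x + u) ι.toContinuousLinearMap x :=
      (ι.toContinuousLinearMap.hasFDerivAt.const_add (κ y)).add_const u
    exact (hφ.differentiable (by simp) _).hasFDerivAt.comp x h2
  rcases hr0.eq_or_lt with rfl | hrpos
  -- At `r = 0` the quotient is the directional derivative of `φ` along `e`, and its derivative
  -- along `v` is an entry of the Hessian.
  · have heq : (fun x => phaseQuotient ι κ φ ((y, 0, e), x)) =
        fun x => fderiv ℝ φ (κ y + ι x) (ι e) := by
      ext x
      simp [phaseQuotient]
    rw [heq] at hslice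
    have h2 : HasFDerivAt (fun x : X => κ y + ι x) ι.toContinuousLinearMap x :=
      ι.toContinuousLinearMap.hasFDerivAt.const_add (κ y)
    have h3 := ((h1.differentiable (by simp) (κ y + ι x)).hasFDerivAt.comp x h2).clm_apply
      (hasFDerivAt_const (ι e) x)
    have h4 := hslice.unique h3
    have h5 := congrArg (fun L => L v) h4
    simp [h0] at h5
    have hsymm : fderiv ℝ (fderiv ℝ φ) (κ y + ι x) (ι v) (ι e) =
        fderiv ℝ (fderiv ℝ φ) (κ y + ι x) (ι e) (ι v) :=
      (hφ.contDiffAt.isSymmSndFDerivAt (by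
        simp only [minSmoothness_of_isRCLikeNormedField]
        exact WithTop.coe_le_coe.2 le_top)) _ _
    have h6 := hφB (κ y + ι x) (by simpa using hz 0 le_rfl le_rfl) e v
    rw [← hsymm, ← h5, he, mul_one, zero_sub, abs_neg] at h6
    exact absurd hv (not_lt.2 h6)
  · have heq : (fun x => r * phaseQuotient ι κ φ ((y, r, e), x)) =
        fun x => φ (κ y + ι x + r • ι e) - φ (κ y + ι x + 0) := by
      ext x
      rw [mul_phaseQuotient ι κ hφ, add_zero]
    have h2 := hslice.const_mul r
    rw [heq] at h2
    have h4 := h2.unique ((hfd (r • ι e)).sub (hfd 0))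
    have h5 := congrArg (fun L => L v) h4
    simp [h0] at h5
    -- Along the segment from `x` to `x + r e` the derivative of `φ` in direction `v` grows like `τ
    -- B(e, v)`, up to `τ c |v|`. If the quotient were critical along `v`, the total growth would
    -- vanish, forcing `|B(e, v)| ≤ c |v|`.
    have h6 := norm_image_sub_le_of_norm_deriv_le_segment' (a := 0) (b := r)
      (f := fun τ : ℝ => fderiv ℝ φ (κ y + ι x + τ • ι e) (ι v) - τ * B e v)
      (f' := fun τ : ℝ => fderiv ℝ (fderiv ℝ φ) (κ y + ι x + τ • ι e) (ι e) (ι v) - B e v)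
      (C := c * ‖v‖) (fun τ hτ => ?_) (fun τ hτ => ?_) r ⟨hr0, le_rfl⟩
    · simp only [zero_smul, add_zero, zero_mul, sub_zero] at h6
      have h7 : fderiv ℝ φ (κ y + ι x + r • ι e) (ι v) - r * B e v - fderiv ℝ φ (κ y + ι x) (ι v) =
        -(r * B e v) := by linarith
      rw [h7, norm_neg, norm_mul, Real.norm_of_nonneg hr0] at h6
      nlinarith
    · apply HasDerivAt.hasDerivWithinAt
      have h7 : HasDerivAt (fun τ : ℝ => κ y + ι x + τ • ι e) (ι e) τ := by
        simpa using ((hasDerivAt_id τ).smul_const (ι e)).const_add (κ y + ι x)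
      have h8 := (h1.differentiable (by simp)
        (κ y + ι x + τ • ι e)).hasFDerivAt.comp_hasDerivAt τ h7
      have h9 := h8.clm_apply (hasDerivAt_const τ (ι v))
      exact (h9.sub ((hasDerivAt_id τ).mul_const (B e v))).congr_deriv (by simp)
    · have := hφB _ (hz τ hτ.1 hτ.2.le) e v
      rwa [he, mul_one] at this

end Stationary

/-! ### Decay by autocorrelation -/

section Stationary

variable {T X Y : Type*} [NormedAddCommGroup T] [InnerProductSpace ℝ T]
  [NormedAddCommGroup X] [InnerProductSpace ℝ X] [FiniteDimensional ℝ X] [MeasurableSpace X]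
  [BorelSpace X] [NormedAddCommGroup Y] [InnerProductSpace ℝ Y] [FiniteDimensional ℝ Y]

/-- Expand `|∫ G|²` as a double integral and substitute the difference `u` of the two variables. -/
theorem integral_mul_conj_integral {G : X → ℂ} (hG : Continuous G) (hs : HasCompactSupport G) :
    (‖∫ x, G x‖ ^ 2 : ℝ) ≤ ∫ u, ‖∫ x, G (x + u) * (starRingEnd ℂ) (G x)‖ := by
  have h1 : (∫ x, G x) * (starRingEnd ℂ) (∫ x, G x) =
      ∫ u, ∫ x, G (x + u) * (starRingEnd ℂ) (G x) := by
    rw [integral_integral_swap, ← integral_conj, ← integral_const_mul]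
    · congr 1
      ext x
      rw [integral_mul_const, integral_add_left_eq_self]
    · apply Continuous.integrable_of_hasCompactSupport
      · unfold Function.uncurry
        fun_prop
      · refine HasCompactSupport.intro (K := (fun p : X × X => (p.1 - p.2, p.2)) ''
          (tsupport G ×ˢ tsupport G)) ((hs.isCompact.prod hs.isCompact).image (by fun_prop))
          fun p hp => ?_
        by_contra h
        refine hp ⟨(p.2 + p.1, p.2), ⟨subset_tsupport _ ?_, subset_tsupport _ ?_⟩, by simp⟩
        · exact left_ne_zero_of_mul h
        · simpa using right_ne_zero_of_mul h
  calc ‖∫ x, G x‖ ^ 2 = ‖(∫ x, G x) * (starRingEnd ℂ) (∫ x, G x)‖ := by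
        rw [norm_mul, RCLike.norm_conj, sq]
    _ ≤ _ := by
        rw [h1]
        exact norm_integral_le_integral_norm _

/-- The decay of oscillatory integrals whose phase has a nondegenerate Hessian along `X`,
uniformly in the transversal variable and in the linear part of the phase. -/
theorem oscillatory_slice (ι : X →ₗᵢ[ℝ] T) (κ : Y →ₗᵢ[ℝ] T)
    (horth : ∀ x y, inner ℝ (κ y) (ι x) = 0) {φ : T → ℝ}
    (hφ : ContDiff ℝ ∞ φ) {B : X →L[ℝ] X →L[ℝ] ℝ} {c R : ℝ} (hc : 0 < c)
    (hB : ∀ e, 2 * c * ‖e‖ ≤ ‖B e‖)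
    (hφB : ∀ z, ‖z‖ ≤ 4 * R → ∀ v w : X,
      |fderiv ℝ (fderiv ℝ φ) z (ι v) (ι w) - B v w| ≤ c * ‖v‖ * ‖w‖)
    {a : T → ℂ} (ha : ContDiff ℝ ∞ a) (haR : ∀ z, R < ‖z‖ → a z = 0) :
    ∃ C, 0 ≤ C ∧ ∀ (y : Y) (s : ℝ) (ξ : X →L[ℝ] ℝ), s ≠ 0 →
      |s| ^ (Module.finrank ℝ X) *
        ‖∫ x, Complex.exp (Complex.I * (ξ x + s * φ (κ y + ι x) : ℝ)) * a (κ y + ι x)‖ ^ 2 ≤ C := by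
  -- One power more than the dimension makes `(1 + |v|)^(-N)` integrable over `X`.
  set N := Module.finrank ℝ X + 1 with hN
  have hnorm : ∀ y x, ‖x‖ ≤ ‖κ y + ι x‖ ∧ ‖y‖ ≤ ‖κ y + ι x‖ := by
    intro y x
    have h := norm_add_sq_eq_norm_sq_add_norm_sq_real (horth x y)
    rw [κ.norm_map, ι.norm_map] at h
    constructor <;> nlinarith [norm_nonneg y, norm_nonneg x, norm_nonneg (κ y + ι x)]
  have hax : ∀ y x, R < ‖x‖ → a (κ y + ι x) = 0 := fun y x h => haR _ (h.trans_le (hnorm y x).1)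
  have hay : ∀ y x, R < ‖y‖ → a (κ y + ι x) = 0 := fun y x h => haR _ (h.trans_le (hnorm y x).2)
  have hι : ContDiff ℝ ∞ ι := ι.contDiff
  have hκ : ContDiff ℝ ∞ κ := κ.contDiff
  set b : (Y × ℝ × X) × X → ℂ := fun z =>
    a (κ z.1.1 + ι z.2 + z.1.2.1 • ι z.1.2.2) * (starRingEnd ℂ) (a (κ z.1.1 + ι z.2)) with hb
  have hbs : ContDiff ℝ ∞ b := by
    refine (ha.comp ?_).mul (Complex.conjCLE.contDiff.comp (ha.comp ?_))
    · fun_prop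
    · fun_prop
  obtain ⟨CN, hCN, hJN⟩ := nonstationary (contDiff_phaseQuotient ι κ hφ) N hbs
    -- The parameters are the frozen variable `y`, the length `r` and the direction `e` of the
    -- shift. The length is at most `2R`, since `x` and `x + u` both lie in the ball of radius `R`.
    (Θ := Metric.closedBall 0 R ×ˢ Icc 0 (2 * R) ×ˢ Metric.sphere 0 1)
    ((isCompact_closedBall _ _).prod (isCompact_Icc.prod (isCompact_sphere _ _)))
    (K := Metric.closedBall 0 R) (isCompact_closedBall _ _)
    (fun θ x hx => by
      have : a (κ θ.1 + ι x) = 0 := hax _ _ (by simpa using hx)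
      simp [hb, this])
    (fun ⟨y, r, e⟩ hθ x hx => exists_fderiv_phaseQuotient_ne_zero ι κ hφ hc hB hφB
      (by simpa using hθ.1) hθ.2.1.1 hθ.2.1.2 (by simpa using hθ.2.2) (by simpa using hx))
  set K : Set X := Metric.closedBall 0 R with hK
  have hKc : IsCompact K := isCompact_closedBall _ _
  obtain ⟨M, hM⟩ : ∃ M, ∀ y x, ‖a (κ y + ι x)‖ ≤ M := by
    have h1 : Continuous fun p : Y × X => a (κ p.1 + ι p.2) := ha.continuous.comp (by fun_prop)
    have h2 : HasCompactSupport fun p : Y × X => a (κ p.1 + ι p.2) :=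
      HasCompactSupport.intro ((isCompact_closedBall (0 : Y) R).prod (isCompact_closedBall (0 : X) R))
        fun p hp => by
          by_cases hy : ‖p.1‖ ≤ R
          · exact hax _ _ (not_le.1 fun h => hp ⟨by simpa using hy, by simpa using h⟩)
          · exact hay _ _ (not_le.1 hy)
    obtain ⟨M, hM⟩ := h1.bounded_above_of_compact_support h2
    exact ⟨M, fun y x => hM (y, x)⟩
  set C0 := M * M * volume.real K with hC0
  have hM0 : 0 ≤ M := (norm_nonneg _).trans (hM 0 0)
  set C1 := 2 ^ (N - 1) * (C0 + CN) with hC1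
  set W : X → ℝ := fun v => (1 + ‖v‖) ^ (-(N : ℝ)) with hW
  have hWi : Integrable W := integrable_one_add_norm (by rw [hN]; push_cast; linarith)
  refine ⟨C1 * ∫ v, W v, mul_nonneg (by positivity) (integral_nonneg fun v => by positivity), ?_⟩
  intro y s ξ hs
  set G : X → ℂ := fun x =>
    Complex.exp (Complex.I * (ξ x + s * φ (κ y + ι x) : ℝ)) * a (κ y + ι x) with hG
  have hφc := hφ.continuous
  have hac := ha.continuous
  have hGc : Continuous G := by
    have h1 : Continuous fun x => φ (κ y + ι x) := hφc.comp (by fun_prop)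
    have h2 : Continuous fun x => a (κ y + ι x) := hac.comp (by fun_prop)
    fun_prop
  have hG0 : ∀ x, R < ‖x‖ → G x = 0 := fun x hx => by simp [hG, hax y x hx]
  have hGn : ∀ x, ‖G x‖ ≤ M := fun x => by
    rw [hG]
    simp only
    rw [norm_mul, mul_comm Complex.I, Complex.norm_exp_ofReal_mul_I, one_mul]
    exact hM y x
  have hGs : HasCompactSupport G :=
    HasCompactSupport.intro hKc fun x hx => hG0 x (by simpa [hK] using hx)
  have hJ0 : ∀ u, ‖∫ x, G (x + u) * (starRingEnd ℂ) (G x)‖ ≤ C0 := by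
    intro u
    rw [← setIntegral_eq_integral_of_forall_compl_eq_zero (s := K)
      (fun x hx => by rw [hG0 x (by simpa [hK] using hx)]; simp)]
    refine norm_setIntegral_le_of_norm_le_const hKc.measure_lt_top fun x _ => ?_
    rw [norm_mul, RCLike.norm_conj]
    exact mul_le_mul (hGn _) (hGn _) (norm_nonneg _) hM0
  have hJ1 : ∀ u, (|s| * ‖u‖) ^ N * ‖∫ x, G (x + u) * (starRingEnd ℂ) (G x)‖ ≤ CN := by
    intro u
    rcases eq_or_ne u 0 with rfl | hu
    · simp [hN, hCN]
    by_cases hy : ‖y‖ ≤ R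
    swap
    · have : ∀ x, G x = 0 := fun x => by simp [hG, hay y x (not_le.1 hy)]
      simp [this, hCN]
    by_cases hu2 : ‖u‖ ≤ 2 * R
    swap
    · have : ∀ x, G (x + u) * (starRingEnd ℂ) (G x) = 0 := fun x => by
        by_cases hx : ‖x‖ ≤ R
        · rw [hG0 (x + u), zero_mul]
          have := norm_sub_le (x + u) x
          rw [add_sub_cancel_left] at this
          linarith
        · simp [hG0 x (not_le.1 hx)]
      simp [this, hCN]
    have hr : ‖u‖ ≠ 0 := norm_ne_zero_iff.2 hu
    set e := ‖u‖⁻¹ • u with he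
    have hue : u = ‖u‖ • e := by rw [he, smul_smul, mul_inv_cancel₀ hr, one_smul]
    have h := hJN (y, ‖u‖, e) ⟨by simpa using hy, ⟨norm_nonneg _, hu2⟩,
      by simp [he, norm_smul, hr]⟩ (s * ‖u‖)
    -- In the autocorrelation the linear phase leaves only the unimodular constant `e^(iξ(u))`,
    -- whence the uniformity in `ξ`. What remains oscillates with frequency `s|u|` and phase the
    -- difference quotient.
    have heq : ∀ x, G (x + u) * (starRingEnd ℂ) (G x) = Complex.exp (Complex.I * (ξ u : ℝ)) *
        (Complex.exp (Complex.I * (s * ‖u‖ * phaseQuotient ι κ φ ((y, ‖u‖, e), x) : ℝ)) *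
          b ((y, ‖u‖, e), x)) := by
      intro x
      rw [mul_assoc s, mul_phaseQuotient ι κ hφ]
      have h3 : κ y + ι (x + u) = κ y + ι x + ‖u‖ • ι e := by
        rw [← map_smul, ← hue, map_add, add_assoc]
      simp only [hG, hb, h3, map_mul, ← Complex.exp_conj, Complex.conj_ofReal, Complex.conj_I]
      have h4 : ∀ p q m n : ℂ, Complex.exp (Complex.I * p) * m * (Complex.exp (-Complex.I * q) * n)
          = Complex.exp (Complex.I * p + -Complex.I * q) * (m * n) := by
        intro p q m n
        rw [Complex.exp_add]
        ring
      rw [h4, ← mul_assoc (Complex.exp (Complex.I * ((ξ u : ℝ) : ℂ))), ← Complex.exp_add]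
      congr 2
      push_cast [map_add]
      ring
    simp_rw [heq]
    rw [integral_const_mul, norm_mul, mul_comm Complex.I, Complex.norm_exp_ofReal_mul_I, one_mul]
    rwa [abs_mul, abs_of_nonneg (norm_nonneg u)] at h
  -- The trivial bound `C0` and the decay bound `CN` combine through `(1 + a)^N ≤ 2^(N-1)(1 + a^N)`.
  have hJ : ∀ u, ‖∫ x, G (x + u) * (starRingEnd ℂ) (G x)‖ ≤ C1 * W (s • u) := by
    intro u
    have h1 := add_pow_le (zero_le_one' ℝ) (by positivity : 0 ≤ |s| * ‖u‖) N
    have h2 : W (s • u) = ((1 + |s| * ‖u‖) ^ N)⁻¹ := by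
      rw [hW]
      simp only
      rw [norm_smul, Real.norm_eq_abs, Real.rpow_neg (by positivity), Real.rpow_natCast]
    rw [h2, ← div_eq_mul_inv, le_div_iff₀ (by positivity)]
    calc _ ≤ ‖∫ x, G (x + u) * (starRingEnd ℂ) (G x)‖ *
          (2 ^ (N - 1) * (1 ^ N + (|s| * ‖u‖) ^ N)) := by gcongr
      _ = 2 ^ (N - 1) * (‖∫ x, G (x + u) * (starRingEnd ℂ) (G x)‖ +
          (|s| * ‖u‖) ^ N * ‖∫ x, G (x + u) * (starRingEnd ℂ) (G x)‖) := by ring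
      _ ≤ C1 := by
          rw [hC1]
          gcongr
          exacts [hJ0 u, hJ1 u]
  have hfin : ∫ u, ‖∫ x, G (x + u) * (starRingEnd ℂ) (G x)‖ ≤ ∫ u, C1 * W (s • u) :=
    integral_mono_of_nonneg (ae_of_all _ fun _ => norm_nonneg _)
      ((hWi.comp_smul hs).const_mul C1) (ae_of_all _ hJ)
  rw [integral_const_mul, Measure.integral_comp_smul] at hfin
  have h5 := (integral_mul_conj_integral hGc hGs).trans hfin
  rw [abs_inv, abs_pow, smul_eq_mul] at h5
  have hsp : 0 < |s| ^ Module.finrank ℝ X := pow_pos (abs_pos.2 hs) _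
  calc _ ≤ |s| ^ Module.finrank ℝ X * (C1 * ((|s| ^ Module.finrank ℝ X)⁻¹ * ∫ v, W v)) := by gcongr
    _ = C1 * ∫ v, W v := by field_simp

end Stationary

/-! ### Oscillatory integrals with a Hessian of rank at least `k` -/

section Decay

variable {T : Type*} [NormedAddCommGroup T] [InnerProductSpace ℝ T] [FiniteDimensional ℝ T]
  [MeasurableSpace T] [BorelSpace T]

/-- Uniqueness of Haar measure gives Fubini along `Xᗮ × X` up to a constant, whose value is
irrelevant for decay estimates. -/
theorem exists_integral_eq_integral_orthogonal (X : Submodule ℝ T) :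
    ∃ c : ℝ, 0 ≤ c ∧ ∀ F : T → ℂ, Continuous F → HasCompactSupport F →
      ∫ z, F z = c • ∫ y : Xᗮ, ∫ x : X, F ((y : T) + x) := by
  let e : (Xᗮ × X) ≃L[ℝ] T :=
    (Submodule.prodEquivOfIsCompl Xᗮ X X.isCompl_orthogonal.symm).toContinuousLinearEquiv
  have he : ∀ p, e p = (p.1 : T) + p.2 := fun p => rfl
  set μ : Measure (Xᗮ × X) := (volume : Measure Xᗮ).prod volume
  have : (Measure.map e μ).IsAddHaarMeasure := e.isAddHaarMeasure_map _
  obtain ⟨c, h⟩ : ∃ c : ℝ≥0, (volume : Measure T) = c • Measure.map e μ :=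
    ⟨_, Measure.isAddLeftInvariant_eq_smul (volume : Measure T) (Measure.map e μ)⟩
  refine ⟨c, c.2, fun F hF hs => ?_⟩
  rw [h, integral_smul_nnreal_measure,
    show Measure.map e μ = Measure.map e.toHomeomorph μ from rfl,
    e.toHomeomorph.measurableEmbedding.integral_map]
  have hi : Integrable (fun p => F (e p)) μ :=
    (hF.comp e.continuous).integrable_of_hasCompactSupport (hs.comp_homeomorph e.toHomeomorph)
  exact congrArg (c • ·) (integral_prod _ hi)

theorem exists_pos_mul_norm_le_of_injective {W : Type*} [NormedAddCommGroup W]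
    [InnerProductSpace ℝ W] [FiniteDimensional ℝ W] (B : W →L[ℝ] W →L[ℝ] ℝ)
    (hB : ∀ e, B e = 0 → e = 0) : ∃ c, 0 < c ∧ ∀ e, 2 * c * ‖e‖ ≤ ‖B e‖ := by
  obtain ⟨L, hL0, hL⟩ := LinearMap.exists_antilipschitzWith B.toLinearMap
    (LinearMap.ker_eq_bot'.2 hB)
  have hL0' : (0 : ℝ) < L := hL0
  refine ⟨(2 * L)⁻¹, by positivity, fun e => ?_⟩
  have h3 := hL.le_mul_dist e 0
  rw [map_zero, dist_zero_right, dist_zero_right] at h3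
  have h4 : 2 * (2 * (L : ℝ))⁻¹ * ‖e‖ = ‖e‖ / L := by field_simp
  rw [h4, div_le_iff₀ hL0', mul_comm]
  exact h3

/-- A symmetric form is nondegenerate on any complement of its radical `Z`: a vector of `Zᗮ` paired
to zero with `Zᗮ` is, by symmetry, also paired to zero with `Z`, so it lies in `Z ∩ Zᗮ`. -/
theorem exists_nondegenerate_on_orthogonal {A : T →L[ℝ] T →L[ℝ] ℝ}
    (hsymm : ∀ v w, A v w = A w v) (Z : Submodule ℝ T) (hZ : ∀ v, v ∈ Z ↔ A v = 0) :
    ∃ c, 0 < c ∧ ∃ B : Zᗮ →L[ℝ] Zᗮ →L[ℝ] ℝ, (∀ v w, B v w = A v w) ∧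
      ∀ e, 2 * c * ‖e‖ ≤ ‖B e‖ := by
  let B : Zᗮ →L[ℝ] Zᗮ →L[ℝ] ℝ :=
    ((ContinuousLinearMap.compL ℝ Zᗮ T ℝ).flip Zᗮ.subtypeL).comp (A.comp Zᗮ.subtypeL)
  have hBA : ∀ v w, B v w = A v w := fun v w => rfl
  have hBker : ∀ e, B e = 0 → e = 0 := by
    intro e he
    have h5 : ∀ x : Zᗮ, A e x = 0 := fun x => by
      rw [← hBA]
      exact congrArg (fun L : Zᗮ →L[ℝ] ℝ => L x) he
    have h3 : A e = 0 := by
      ext z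
      obtain ⟨y, hy, x, hx, rfl⟩ := Z.exists_add_mem_mem_orthogonal z
      have h4 : A y = 0 := (hZ y).1 hy
      rw [map_add, hsymm e y, h4, h5 ⟨x, hx⟩]
      simp
    have h5 := (Submodule.mem_orthogonal _ _).1 e.2 e ((hZ _).2 h3)
    exact Subtype.ext (inner_self_eq_zero.1 h5)
  obtain ⟨c, hc, h⟩ := exists_pos_mul_norm_le_of_injective B hBker
  exact ⟨c, hc, B, hBA, h⟩

/-- Rapid decay in the range where the linear part of the phase dominates. -/
theorem oscillatory_linear_dominant {φ : T → ℝ} (hφ : ContDiff ℝ ∞ φ) {R : ℝ}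
    (hd₂ : ∀ x, ‖x‖ ≤ R → ‖fderiv ℝ φ x‖ ≤ 1 / 2) (k : ℕ) {a : T → ℂ} (ha : ContDiff ℝ ∞ a)
    (haR : ∀ z, R < ‖z‖ → a z = 0) :
    ∃ C, 0 ≤ C ∧ ∀ (ξ : T) (s : ℝ), |s| < ‖ξ‖ →
      (‖ξ‖ + |s|) ^ k *
        ‖∫ x, Complex.exp (Complex.I * (inner ℝ ξ x + s * φ x : ℝ)) * a x‖ ^ 2 ≤ C := by
  obtain ⟨C₂, hC₂, hns⟩ := nonstationary (P := T × ℝ) (X := T)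
    (Ψ := fun z => inner ℝ z.1.1 z.2 + z.1.2 * φ z.2)
    (((contDiff_fst.comp contDiff_fst).inner ℝ contDiff_snd).add
      ((contDiff_snd.comp contDiff_fst).mul (hφ.comp contDiff_snd))) k
    (b := fun z => a z.2) (ha.comp contDiff_snd)
    (Θ := Metric.sphere 0 1 ×ˢ Icc (-1) 1) ((isCompact_sphere _ _).prod isCompact_Icc)
    (K := Metric.closedBall 0 R) (isCompact_closedBall _ _)
    (fun θ x hx => haR x (by simpa using hx))
    -- After division by `‖ξ‖` the phase is `⟪e, x⟫ + τ φ(x)` with `|e| = 1` and `|τ| ≤ 1`. Its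
    -- derivative along `e` is at least `1 - 1/2`.
    (fun ⟨e, τ⟩ hθ x hx => by
      refine ⟨e, fun h0 => ?_⟩
      have hsl := hasFDerivAt_slice (P := T × ℝ) (X := T)
        (b := fun z : (T × ℝ) × T => inner ℝ z.1.1 z.2 + z.1.2 * φ z.2) (θ := (e, τ)) (x := x)
        (((((contDiff_fst.comp contDiff_fst).inner ℝ contDiff_snd).add
      ((contDiff_snd.comp contDiff_fst).mul (hφ.comp contDiff_snd))).differentiable
        (n := ∞) (by simp)) ((e, τ), x))
      have h3 : HasFDerivAt (fun x => inner ℝ e x + τ * φ x)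
          (innerSL ℝ e + τ • fderiv ℝ φ x) x :=
        (innerSL ℝ e).hasFDerivAt.add (((hφ.differentiable (by simp)) x).hasFDerivAt.const_mul τ)
      have h4 := congrArg (fun L => L e) (hsl.unique h3)
      have he : ‖e‖ = 1 := by simpa using hθ.1
      simp only [ContinuousLinearMap.comp_apply, ContinuousLinearMap.inr_apply, h0,
        add_apply, innerSL_apply_apply, real_inner_self_eq_norm_sq, he,
        smul_apply, smul_eq_mul] at h4
      have h5 := hd₂ x (by simpa using hx)
      have h6 := (fderiv ℝ φ x).le_opNorm e
      rw [he, mul_one] at h6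
      have h7 : |τ * fderiv ℝ φ x e| ≤ 1 * (1 / 2) := by
        rw [abs_mul]
        exact mul_le_mul (abs_le.2 hθ.2) (h6.trans h5) (abs_nonneg _) zero_le_one
      have := (abs_le.1 h7).1
      linarith)
  set C₀ := ∫ x, ‖a x‖ with hC₀
  have hC₀0 : 0 ≤ C₀ := integral_nonneg fun _ => norm_nonneg _
  refine ⟨2 ^ k * (C₂ * C₀), by positivity, fun ξ s hcase => ?_⟩
  set G : T → ℂ := fun x => Complex.exp (Complex.I * (inner ℝ ξ x + s * φ x : ℝ)) * a x with hG
  have hξ : ‖ξ‖ ≠ 0 := ((abs_nonneg s).trans_lt hcase).ne'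
  have h3 := hns (‖ξ‖⁻¹ • ξ, ‖ξ‖⁻¹ * s) ⟨by simp [norm_smul, hξ], by
    have : |‖ξ‖⁻¹ * s| ≤ 1 := by
      rw [abs_mul, abs_inv, abs_norm, inv_mul_le_iff₀ (by positivity), mul_one]
      exact hcase.le
    exact abs_le.1 this⟩ ‖ξ‖
  have h4 : ∀ x, ‖ξ‖ * (inner ℝ (‖ξ‖⁻¹ • ξ) x + ‖ξ‖⁻¹ * s * φ x) = inner ℝ ξ x + s * φ x := by
    intro x
    rw [inner_smul_left]
    simp
    field_simp
  simp only [h4, abs_norm] at h3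
  have h5 : ‖∫ x, G x‖ ≤ C₀ := by
    refine (norm_integral_le_integral_norm _).trans (le_of_eq ?_)
    rw [hC₀]
    congr 1
    ext x
    rw [hG]
    simp only
    rw [norm_mul, mul_comm Complex.I, Complex.norm_exp_ofReal_mul_I, one_mul]
  calc (‖ξ‖ + |s|) ^ k * ‖∫ x, G x‖ ^ 2 ≤ (2 * ‖ξ‖) ^ k * ‖∫ x, G x‖ ^ 2 := by
        gcongr
        linarith
    _ = 2 ^ k * ((‖ξ‖ ^ k * ‖∫ x, G x‖) * ‖∫ x, G x‖) := by rw [mul_pow]; ring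
    _ ≤ 2 ^ k * (C₂ * C₀) := by gcongr

/-- Decay of oscillatory integrals with phase `⟪ξ, x⟫ + s φ(x)`, where `φ` has a critical point at
the origin and the Hessian there has rank at least `k`. -/
theorem oscillatory_decay {φ : T → ℝ} (hφ : ContDiff ℝ ∞ φ) (hφ0 : fderiv ℝ φ 0 = 0) {k : ℕ}
    (hk : k + Module.finrank ℝ (LinearMap.ker (fderiv ℝ (fderiv ℝ φ) 0).toLinearMap) ≤
      Module.finrank ℝ T) :
    ∃ ε, 0 < ε ∧ ∀ a : T → ℂ, ContDiff ℝ ∞ a → (∀ z, ε < ‖z‖ → a z = 0) →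
      ∃ C, 0 ≤ C ∧ ∀ (ξ : T) (s : ℝ), 1 ≤ ‖ξ‖ + |s| →
        (‖ξ‖ + |s|) ^ k *
          ‖∫ x, Complex.exp (Complex.I * (inner ℝ ξ x + s * φ x : ℝ)) * a x‖ ^ 2 ≤ C := by
  have h1 : ContDiff ℝ ∞ (fderiv ℝ φ) := hφ.fderiv_right (m := ∞) (by simp)
  have h2 : ContDiff ℝ ∞ (fderiv ℝ (fderiv ℝ φ)) := h1.fderiv_right (m := ∞) (by simp)
  set A : T →L[ℝ] T →L[ℝ] ℝ := fderiv ℝ (fderiv ℝ φ) 0 with hA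
  have hsymm : ∀ v w, A v w = A w v := fun v w =>
    (hφ.contDiffAt.isSymmSndFDerivAt (by
        simp only [minSmoothness_of_isRCLikeNormedField]
        exact WithTop.coe_le_coe.2 le_top)) v w
  set Z : Submodule ℝ T := LinearMap.ker A.toLinearMap with hZ
  obtain ⟨c, hc0, B, hBA, hB⟩ := exists_nondegenerate_on_orthogonal hsymm Z fun v => Iff.rfl
  set X : Submodule ℝ T := Zᗮ with hX
  set ι : X →ₗᵢ[ℝ] T := X.subtypeₗᵢ with hι
  set κ : Xᗮ →ₗᵢ[ℝ] T := Xᗮ.subtypeₗᵢ with hκ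
  obtain ⟨δ₁, hδ₁, hd₁⟩ := Metric.continuousAt_iff.1 (h2.continuous.continuousAt (x := 0)) c hc0
  obtain ⟨δ₂, hδ₂, hd₂⟩ := Metric.continuousAt_iff.1 (h1.continuous.continuousAt (x := 0)) (1 / 2)
    (by norm_num)
  -- The ball of radius `4R` is where the Hessian stays within `c` of its value at the origin; on
  -- the ball of radius `R` the gradient is at most `1/2`.
  set R := min (δ₁ / 8) (δ₂ / 2) with hR
  have hR0 : 0 < R := by positivity
  have hR1 : 4 * R < δ₁ := by
    have := min_le_left (δ₁ / 8) (δ₂ / 2)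
    linarith
  have hR2 : R < δ₂ := by
    have := min_le_right (δ₁ / 8) (δ₂ / 2)
    linarith
  have hR3 : ∀ x, ‖x‖ ≤ R → ‖fderiv ℝ φ x‖ ≤ 1 / 2 := by
    intro x hx
    have h5 := hd₂ (x := x) (by simpa using hx.trans_lt hR2)
    rw [hφ0, dist_zero_right] at h5
    exact h5.le
  refine ⟨R, hR0, fun a ha haR => ?_⟩
  have has : HasCompactSupport a := HasCompactSupport.intro (isCompact_closedBall (0 : T) R)
    fun x hx => haR x (by simpa using hx)
  obtain ⟨C₁, hC₁, hst⟩ := oscillatory_slice ι κ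
    (fun x y => Submodule.inner_left_of_mem_orthogonal x.2 y.2) hφ hc0 hB
    (fun z hz v w => by
      have h3 := hd₁ (x := z) (by simpa using hz.trans_lt hR1)
      rw [dist_eq_norm] at h3
      have h4 := (fderiv ℝ (fderiv ℝ φ) z - A).le_opNorm₂ v w
      simp only [sub_apply, Real.norm_eq_abs] at h4
      rw [hBA]
      refine h4.trans ?_
      rw [Submodule.norm_coe, Submodule.norm_coe]
      gcongr) ha haR
  obtain ⟨C₂, hC₂, hns⟩ := oscillatory_linear_dominant hφ hR3 k ha haR
  obtain ⟨m, hm, hF⟩ := exists_integral_eq_integral_orthogonal X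
  set k' := Module.finrank ℝ X with hk'
  have hkk : k ≤ k' := by
    have : Module.finrank ℝ Z + k' = Module.finrank ℝ T := Submodule.finrank_add_finrank_orthogonal Z
    omega
  set v := volume.real (Metric.closedBall (0 : Xᗮ) R) with hv
  refine ⟨max C₂ (2 ^ k' * (m * v) ^ 2 * C₁), le_max_of_le_left hC₂,
    fun ξ s h1s => ?_⟩
  set G : T → ℂ := fun x => Complex.exp (Complex.I * (inner ℝ ξ x + s * φ x : ℝ)) * a x with hG
  have hGc : Continuous G := by
    have := hφ.continuous
    have := ha.continuous
    fun_prop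
  rcases lt_or_ge |s| ‖ξ‖ with hcase | hcase
  · exact le_max_of_le_left (hns ξ s hcase)
  · refine le_max_of_le_right ?_
    -- Since `2|s| ≥ 1`, the exponent `k` may be raised to `k'`, the rank of the Hessian, which is
    -- the decay obtained on the slices.
    have hs : 1 ≤ 2 * |s| := by linarith
    have hs0 : s ≠ 0 := by
      rintro rfl
      simp at hs
      linarith
    have hsp : 0 < |s| ^ k' := pow_pos (abs_pos.2 hs0) _
    set D := Real.sqrt (C₁ / |s| ^ k') with hD
    have h3 : ∀ y : Xᗮ, ‖∫ x : X, G ((y : T) + x)‖ ≤ D := by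
      intro y
      have h4 := hst y s ((innerSL ℝ ξ).comp X.subtypeL) hs0
      apply Real.le_sqrt_of_sq_le
      rw [le_div_iff₀ hsp, mul_comm]
      convert! h4 using 3
      have h5 : ∀ x : X, G ((y : T) + x) = Complex.exp (Complex.I * (inner ℝ ξ (y : T) : ℝ)) *
          (Complex.exp (Complex.I * (((innerSL ℝ ξ).comp X.subtypeL) x + s * φ (κ y + ι x) : ℝ)) *
            a (κ y + ι x)) := by
        intro x
        rw [← mul_assoc, ← Complex.exp_add, hG]
        simp only [inner_add_right]
        congr 2
        push_cast
        simp [hκ, hι]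
        ring
      simp_rw [h5]
      rw [integral_const_mul, norm_mul, mul_comm Complex.I, Complex.norm_exp_ofReal_mul_I, one_mul]
    have h4 : ‖∫ z, G z‖ ≤ m * (D * v) := by
      rw [hF G hGc has.mul_left, norm_smul, Real.norm_of_nonneg hm]
      gcongr
      rw [← setIntegral_eq_integral_of_forall_compl_eq_zero (s := Metric.closedBall (0 : Xᗮ) R)]
      · exact norm_setIntegral_le_of_norm_le_const (isCompact_closedBall _ _).measure_lt_top
          fun y _ => h3 y
      · intro y hy
        have : ∀ x : X, G ((y : T) + x) = 0 := by
          intro x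
          have h5 : a ((y : T) + x) = 0 := by
            apply haR
            have h6 := norm_add_sq_eq_norm_sq_add_norm_sq_real
              (Submodule.inner_left_of_mem_orthogonal x.2 y.2)
            have h7 : R < ‖(y : T)‖ := by simpa using hy
            nlinarith [norm_nonneg (y : T), norm_nonneg (x : T), norm_nonneg ((y : T) + x)]
          simp [hG, h5]
        simp [this]
    calc (‖ξ‖ + |s|) ^ k * ‖∫ x, G x‖ ^ 2 ≤ (2 * |s|) ^ k * (m * (D * v)) ^ 2 := by
          gcongr
          linarith
      _ ≤ (2 * |s|) ^ k' * (m * (D * v)) ^ 2 := by gcongr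
      _ = 2 ^ k' * (m * v) ^ 2 * (|s| ^ k' * D ^ 2) := by rw [mul_pow]; ring
      _ = 2 ^ k' * (m * v) ^ 2 * C₁ := by
          rw [hD, Real.sq_sqrt (by positivity)]
          field_simp

end Decay

/-! ### The area formula for graphs -/

section Area

variable {T V : Type*} [NormedAddCommGroup T] [InnerProductSpace ℝ T] [FiniteDimensional ℝ T]
  [MeasurableSpace T] [BorelSpace T] [NormedAddCommGroup V] [InnerProductSpace ℝ V]
  [MeasurableSpace V] [BorelSpace V]

open scoped MeasureTheory

/-- On `g '' A` the map `f ∘ g⁻¹` is `K`-Lipschitz. Points of `A` identified by `g` are also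
identified by `f`, so any choice of preimages gives all of `f '' A`. -/
theorem hausdorffMeasure_image_le_of_dist_le {f g : T → V} {A : Set T} {K : ℝ≥0}
    (h : ∀ x ∈ A, ∀ y ∈ A, dist (f x) (f y) ≤ K * dist (g x) (g y)) {d : ℝ} (hd : 0 ≤ d) :
    μH[d] (f '' A) ≤ (K : ℝ≥0∞) ^ d * μH[d] (g '' A) := by
  rcases A.eq_empty_or_nonempty with rfl | ⟨x₀, -⟩
  · simp
  have : Nonempty T := ⟨x₀⟩
  set i := Function.invFunOn g A
  have hi : ∀ x ∈ A, i (g x) ∈ A ∧ g (i (g x)) = g x := fun x hx =>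
    ⟨Function.invFunOn_mem ⟨x, hx, rfl⟩, Function.invFunOn_eq ⟨x, hx, rfl⟩⟩
  have hL : LipschitzOnWith K (f ∘ i) (g '' A) := by
    apply LipschitzOnWith.of_dist_le_mul
    rintro _ ⟨x, hx, rfl⟩ _ ⟨y, hy, rfl⟩
    have := h _ (hi x hx).1 _ (hi y hy).1
    rwa [(hi x hx).2, (hi y hy).2] at this
  have himg : (f ∘ i) '' (g '' A) = f '' A := by
    rw [image_image]
    refine image_congr fun x hx => ?_
    have := h _ (hi x hx).1 _ hx
    rw [(hi x hx).2, dist_self, mul_zero] at this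
    exact dist_le_zero.1 this
  rw [← himg]
  exact hL.hausdorffMeasure_image_le hd

/-- The linear map `v ↦ v + ⟪a, v⟫ ν` onto the graph of `⟪a, ·⟫`. -/
def graphMap (ι : T →ₗᵢ[ℝ] V) (ν : V) (a : T →L[ℝ] ℝ) : T →L[ℝ] V :=
  ι.toContinuousLinearMap + a.smulRight ν

variable {ι : T →ₗᵢ[ℝ] V} {ν : V}

theorem norm_graphMap_sq (hν : ‖ν‖ = 1) (hι : ∀ x, inner ℝ (ι x) ν = 0) (a : T →L[ℝ] ℝ) (v : T) :
    ‖graphMap ι ν a v‖ ^ 2 = ‖v‖ ^ 2 + a v ^ 2 := by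
  have h : graphMap ι ν a v = ι v + a v • ν := rfl
  rw [h, norm_add_sq_real, inner_smul_right, hι, ι.norm_map, norm_smul, hν]
  simp

/-- Polar decomposition: the positive root of `1 + b ⊗ b` is `S = 1 + c b ⊗ b`, and `|S v| =
|graphMap v|`. So the graph map is an isometry after `S`, and it scales measure by `det S = √(1 +
|b|²)`. -/
theorem hausdorffMeasure_graphMap_image (hν : ‖ν‖ = 1) (hι : ∀ x, inner ℝ (ι x) ν = 0)
    (a : T →L[ℝ] ℝ) (A : Set T) :
    μH[Module.finrank ℝ T] (graphMap ι ν a '' A) =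
      ENNReal.ofReal (Real.sqrt (1 + ‖a‖ ^ 2)) * μH[Module.finrank ℝ T] A := by
  obtain ⟨b, rfl⟩ := (InnerProductSpace.toDual ℝ T).surjective a
  rw [LinearIsometryEquiv.norm_map]
  set w := Real.sqrt (1 + ‖b‖ ^ 2) with hw
  have hw2 : w ^ 2 = 1 + ‖b‖ ^ 2 := Real.sq_sqrt (by positivity)
  have hw0 : 0 ≤ w := Real.sqrt_nonneg _
  -- Chosen so that the eigenvalue `1 + c|b|²` of `S` on `b` is `w`. For `b = 0` division by zero
  -- gives `c = 0`, and `hcb` still holds because `w = 1`.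
  set c := (w - 1) / ‖b‖ ^ 2 with hc
  have hcb : c * ‖b‖ ^ 2 = w - 1 := by
    rcases eq_or_ne b 0 with hb | hb
    · have : w = 1 := by rw [hw, hb]; simp
      simp [hb, this]
    · have := norm_ne_zero_iff.2 hb
      rw [hc]; field_simp
  clear_value c w
  set S : T →ₗ[ℝ] T := LinearMap.transvection (InnerProductSpace.toDual ℝ T b).toLinearMap (c • b)
    with hS
  have hSv : ∀ v, S v = v + inner ℝ b v • c • b := fun v => rfl
  have hSn : ∀ v, ‖S v‖ = ‖graphMap ι ν (InnerProductSpace.toDual ℝ T b) v‖ := by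
    intro v
    have hcomm : inner ℝ v b = inner ℝ b v := real_inner_comm _ _
    rw [← sq_eq_sq₀ (norm_nonneg _) (norm_nonneg _), norm_graphMap_sq hν hι, hSv,
      norm_add_sq_real, inner_smul_right, inner_smul_right, norm_smul, norm_smul,
      InnerProductSpace.toDual_apply_apply, hcomm, mul_pow, mul_pow, Real.norm_eq_abs,
      Real.norm_eq_abs, sq_abs, sq_abs]
    have h2 : 2 * c + c * (c * ‖b‖ ^ 2) = 1 ∨ b = 0 := by
      rcases eq_or_ne b 0 with hb | hb
      · exact Or.inr hb
      · left
        have := norm_ne_zero_iff.2 hb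
        have h3 : (2 * c + c * (c * ‖b‖ ^ 2)) * ‖b‖ ^ 2 = 1 * ‖b‖ ^ 2 := by
          linear_combination (2 + c * ‖b‖ ^ 2 + (w - 1)) * hcb + hw2
        exact mul_right_cancel₀ (pow_ne_zero 2 this) h3
    rcases h2 with h2 | h2
    · linear_combination (inner ℝ b v) ^ 2 * h2
    · simp [h2]
  have hSinj : Function.Injective S := by
    rw [injective_iff_map_eq_zero]
    intro v hv
    have h1 := hSn v
    rw [hv, norm_zero] at h1
    have h2 := norm_graphMap_sq hν hι (InnerProductSpace.toDual ℝ T b) v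
    rw [← h1] at h2
    have : ‖v‖ = 0 := by nlinarith [norm_nonneg v, sq_nonneg (InnerProductSpace.toDual ℝ T b v)]
    exact norm_eq_zero.1 this
  have hdet : LinearMap.det S = w := by
    rw [hS, LinearMap.transvection.det]
    have : (InnerProductSpace.toDual ℝ T b).toLinearMap (c • b) = c * ‖b‖ ^ 2 := by
      change inner ℝ b (c • b) = _
      rw [inner_smul_right, real_inner_self_eq_norm_sq]
    rw [this, hcb]
    ring
  let Se : T ≃ₗ[ℝ] T := LinearEquiv.ofInjectiveEndo S hSinj
  have hSe : ∀ v, Se.symm (S v) = v := fun v => Se.symm_apply_apply v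
  let I : T →ₗᵢ[ℝ] V :=
    ⟨(graphMap ι ν (InnerProductSpace.toDual ℝ T b)).toLinearMap ∘ₗ Se.symm.toLinearMap, by
      intro v
      obtain ⟨u, rfl⟩ := Se.surjective v
      have h1 : Se.symm (Se u) = u := Se.symm_apply_apply u
      simp only [LinearMap.comp_apply, LinearEquiv.coe_coe, h1]
      exact (hSn u).symm⟩
  have himg : graphMap ι ν (InnerProductSpace.toDual ℝ T b) '' A = I '' (S '' A) := by
    rw [image_image]
    refine image_congr fun x _ => ?_
    have : I (S x) = graphMap ι ν (InnerProductSpace.toDual ℝ T b) (Se.symm (S x)) := rfl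
    rw [this, hSe]
  rw [himg, I.isometry.hausdorffMeasure_image (Or.inl (Nat.cast_nonneg _)),
    Measure.addHaar_image_linearMap, hdet, abs_of_nonneg hw0]

/-- Countably many of the neighbourhoods cover the space. Making them disjoint cuts `A` into pieces
on which the local comparison can be summed. -/
theorem measure_le_smul_of_locally {ν κ : Measure T} {c : ℝ≥0∞}
    (h : ∀ x, ∃ U ∈ 𝓝 x, ∀ A ⊆ U, MeasurableSet A → ν A ≤ c * κ A) (A : Set T)
    (hA : MeasurableSet A) : ν A ≤ c * κ A := by
  choose U hU hUA using h
  obtain ⟨s, hs, hcov⟩ := TopologicalSpace.countable_cover_nhds fun x => interior_mem_nhds.2 (hU x)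
  rcases s.eq_empty_or_nonempty with rfl | hne
  · have : A = ∅ := by
      rw [eq_empty_iff_forall_notMem]
      intro x
      have : x ∈ (univ : Set T) := mem_univ x
      simp [← hcov] at this
    simp [this]
  obtain ⟨f, hf⟩ := hs.exists_eq_range hne
  set D : ℕ → Set T := disjointed fun n => interior (U (f n)) with hD
  have hDm : ∀ n, MeasurableSet (D n) := MeasurableSet.disjointed fun n =>
    isOpen_interior.measurableSet
  have hAeq : A = ⋃ n, A ∩ D n := by
    rw [← inter_iUnion, hD, iUnion_disjointed]
    have : (⋃ n, interior (U (f n))) = univ := by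
      rw [← hcov, hf]
      simp
    rw [this, inter_univ]
  have hdis : Pairwise (Function.onFun Disjoint fun n => A ∩ D n) := fun i j hij =>
    (disjoint_disjointed _ hij).mono inter_subset_right inter_subset_right
  have hm : ∀ n, MeasurableSet (A ∩ D n) := fun n => hA.inter (hDm n)
  rw [hAeq, measure_iUnion hdis hm, measure_iUnion hdis hm, ← ENNReal.tsum_mul_left]
  exact ENNReal.tsum_le_tsum fun n => hUA (f n) _
    (inter_subset_right.trans ((disjointed_subset _ n).trans interior_subset)) (hm n)

theorem le_of_forall_one_lt_pow_mul_le {a b : ℝ≥0∞} (n : ℕ)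
    (h : ∀ K : ℝ≥0, 1 < K → a ≤ (K : ℝ≥0∞) ^ n * b) : a ≤ b := by
  have h1 : Tendsto (fun K : ℝ≥0 => (K : ℝ≥0∞) ^ n * b) (𝓝[>] 1) (𝓝 (1 * b)) := by
    apply ENNReal.Tendsto.mul_const _ (Or.inl one_ne_zero)
    have : Continuous fun K : ℝ≥0 => (K : ℝ≥0∞) ^ n := by fun_prop
    have h2 := (this.tendsto 1).mono_left (nhdsWithin_le_nhds (s := Ioi 1))
    simpa using h2
  rw [one_mul] at h1
  exact ge_of_tendsto h1 (eventually_nhdsWithin_of_forall fun K hK => h K hK)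

/-- The area formula for graphs over a hyperplane. -/
theorem hausdorffMeasure_graph_image (hν : ‖ν‖ = 1) (hι : ∀ x, inner ℝ (ι x) ν = 0) (p : V)
    {φ : T → ℝ} (hφ : ContDiff ℝ 1 φ) {A : Set T} (hA : MeasurableSet A) :
    μH[Module.finrank ℝ T] ((fun x => p + ι x + φ x • ν) '' A) =
      ∫⁻ x in A, ENNReal.ofReal (Real.sqrt (1 + ‖fderiv ℝ φ x‖ ^ 2)) ∂μH[Module.finrank ℝ T] := by
  set m := Module.finrank ℝ T
  set G : T → V := fun x => p + ι x + φ x • ν with hG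
  set J : T → ℝ≥0∞ := fun x => ENNReal.ofReal (Real.sqrt (1 + ‖fderiv ℝ φ x‖ ^ 2)) with hJ
  have hφc := hφ.continuous
  have hGc : Continuous G := by fun_prop
  have hGinj : Function.Injective G := by
    intro x y h
    have h1 : ∀ z, ‖G z - G y‖ ^ 2 = ‖z - y‖ ^ 2 + (φ z - φ y) ^ 2 := by
      intro z
      have : G z - G y = ι (z - y) + (φ z - φ y) • ν := by
        simp only [hG, map_sub, sub_smul]
        abel
      rw [this, norm_add_sq_real, inner_smul_right, hι, ι.norm_map, norm_smul, hν]
      simp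
    have h2 := h1 x
    rw [h, sub_self, norm_zero] at h2
    have : ‖x - y‖ = 0 := by nlinarith [norm_nonneg (x - y), sq_nonneg (φ x - φ y)]
    exact sub_eq_zero.1 (norm_eq_zero.1 this)
  have hGe : MeasurableEmbedding G := hGc.measurableEmbedding hGinj
  set κ₁ : Measure T := Measure.comap G μH[m] with hκ₁
  set κ₂ : Measure T := (μH[m] : Measure T).withDensity J with hκ₂
  have hκ₁A : ∀ A, κ₁ A = μH[m] (G '' A) := fun A => hGe.comap_apply _ _
  have hfc : Continuous (fderiv ℝ φ) := hφ.continuous_fderiv one_ne_zero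
  have hJc : Continuous fun x => Real.sqrt (1 + ‖fderiv ℝ φ x‖ ^ 2) := by fun_prop
  -- Near `x₀` the map `G` distorts distances relative to its derivative by at most `K`, and the
  -- density differs from its value at `x₀` by at most a factor `K`. For the linear map the formula
  -- is exact, so the two measures agree up to `K^(m+1)`; then `K → 1`.
  have hlocal : ∀ K : ℝ≥0, 1 < K → ∀ x₀, ∃ U ∈ 𝓝 x₀, ∀ A ⊆ U, MeasurableSet A →
      κ₁ A ≤ (K : ℝ≥0∞) ^ (m + 1) * κ₂ A ∧ κ₂ A ≤ (K : ℝ≥0∞) ^ (m + 1) * κ₁ A := by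
    intro K hK x₀
    have hK1 : (1 : ℝ) < K := by exact_mod_cast hK
    have hK0 : (0 : ℝ) < K := by linarith
    set L := graphMap ι ν (fderiv ℝ φ x₀) with hL
    have hstr : HasStrictFDerivAt G L x₀ := by
      have h1 : HasStrictFDerivAt φ (fderiv ℝ φ x₀) x₀ :=
        hφ.contDiffAt.hasStrictFDerivAt one_ne_zero
      exact (ι.toContinuousLinearMap.hasStrictFDerivAt.const_add p).add (h1.smul_const ν)
    -- With this error `1 + η ≤ K` and `1/(1 - η) = K`, so the distortion is at most `K` in both
    -- directions.
    set η : ℝ≥0 := ⟨(K - 1) / K, div_nonneg (by linarith) hK0.le⟩ with hη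
    have hη0 : 0 < η := by
      rw [← NNReal.coe_pos]
      exact div_pos (by linarith) hK0
    obtain ⟨U₁, hU₁, happ⟩ := hstr.approximates_deriv_on_nhds (Or.inr hη0)
    set w := fun x => Real.sqrt (1 + ‖fderiv ℝ φ x‖ ^ 2) with hw
    have hw0 : ∀ x, 0 < w x := fun x => Real.sqrt_pos.2 (by positivity)
    have hU₂ : {x | w x < K * w x₀ ∧ w x₀ < K * w x} ∈ 𝓝 x₀ := by
      apply IsOpen.mem_nhds
      · exact (isOpen_lt hJc continuous_const).inter
          (isOpen_lt continuous_const (continuous_const.mul hJc))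
      · constructor <;> nlinarith [hw0 x₀]
    refine ⟨_, inter_mem hU₁ hU₂, fun A hAU hAm => ?_⟩
    have hLn : ∀ v, ‖v‖ ≤ ‖L v‖ := by
      intro v
      have := norm_graphMap_sq hν hι (fderiv ℝ φ x₀) v
      rw [← hL] at this
      exact le_of_sq_le_sq (by nlinarith [sq_nonneg (fderiv ℝ φ x₀ v)]) (norm_nonneg _)
    have hηv : (η : ℝ) = (K - 1) / K := rfl
    have hd : ∀ x ∈ A, ∀ y ∈ A, dist (G x) (G y) ≤ K * dist (L x) (L y) ∧
        dist (L x) (L y) ≤ K * dist (G x) (G y) := by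
      intro x hx y hy
      have h1 := happ x (hAU hx).1 y (hAU hy).1
      have h2 := hLn (x - y)
      rw [dist_eq_norm, dist_eq_norm, ← map_sub]
      have h3 : ‖G x - G y - L (x - y)‖ ≤ η * ‖L (x - y)‖ := h1.trans (by gcongr)
      have h4 := norm_sub_norm_le (G x - G y) (L (x - y))
      have h5 := norm_sub_norm_le (L (x - y)) (G x - G y)
      rw [norm_sub_rev (L (x - y)) (G x - G y)] at h5
      have h6 : (η : ℝ) ≤ K - 1 := by
        rw [hηv]
        exact div_le_self (by linarith) hK1.le
      have h7 : (K : ℝ) * η = K - 1 := by rw [hηv]; field_simp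
      constructor
      · nlinarith [norm_nonneg (L (x - y))]
      · have h8 : ‖L (x - y)‖ ≤ ‖G x - G y‖ + η * ‖L (x - y)‖ := by linarith
        have h9 := mul_le_mul_of_nonneg_left h8 hK0.le
        have h10 : (K : ℝ) * (‖G x - G y‖ + η * ‖L (x - y)‖) =
            K * ‖G x - G y‖ + K * η * ‖L (x - y)‖ := by ring
        rw [h10, h7] at h9
        linarith
    have hm0 : (0 : ℝ) ≤ (m : ℝ) := Nat.cast_nonneg _
    have hi1 := hausdorffMeasure_image_le_of_dist_le (fun x hx y hy => (hd x hx y hy).1) hm0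
    have hi2 := hausdorffMeasure_image_le_of_dist_le (fun x hx y hy => (hd x hx y hy).2) hm0
    rw [hausdorffMeasure_graphMap_image hν hι, ENNReal.rpow_natCast, ← hκ₁A] at hi1 hi2
    have hκ₂A : κ₂ A = ∫⁻ x in A, J x ∂μH[m] := withDensity_apply _ hAm
    have hmulK : ∀ r : ℝ, ENNReal.ofReal (K * r) = K * ENNReal.ofReal r := fun r => by
      rw [ENNReal.ofReal_mul hK0.le, ENNReal.ofReal_coe_nnreal]
    have hJ1 : ENNReal.ofReal (w x₀) * μH[m] A ≤ K * κ₂ A := by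
      rw [hκ₂A, ← setLIntegral_const, ← lintegral_const_mul' _ _ ENNReal.coe_ne_top]
      refine setLIntegral_mono' hAm fun x hx => ?_
      rw [hJ, ← hmulK]
      exact ENNReal.ofReal_le_ofReal (hAU hx).2.2.le
    have hJ2 : κ₂ A ≤ K * (ENNReal.ofReal (w x₀) * μH[m] A) := by
      rw [hκ₂A, ← mul_assoc, ← hmulK, ← setLIntegral_const]
      refine setLIntegral_mono' hAm fun x hx => ?_
      exact ENNReal.ofReal_le_ofReal (hAU hx).2.1.le
    constructor
    · calc κ₁ A ≤ (K : ℝ≥0∞) ^ m * (ENNReal.ofReal (w x₀) * μH[m] A) := hi1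
        _ ≤ (K : ℝ≥0∞) ^ m * (K * κ₂ A) := by gcongr
        _ = _ := by rw [pow_succ, mul_assoc]
    · calc κ₂ A ≤ K * (ENNReal.ofReal (w x₀) * μH[m] A) := hJ2
        _ ≤ K * ((K : ℝ≥0∞) ^ m * κ₁ A) := by gcongr
        _ = _ := by rw [pow_succ', mul_assoc]
  have hfin : κ₁ A = κ₂ A := by
    apply le_antisymm
    · refine le_of_forall_one_lt_pow_mul_le (m + 1) fun K hK => ?_
      refine measure_le_smul_of_locally (fun x => ?_) A hA
      obtain ⟨U, hU, h⟩ := hlocal K hK x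
      exact ⟨U, hU, fun A hAU hAm => (h A hAU hAm).1⟩
    · refine le_of_forall_one_lt_pow_mul_le (m + 1) fun K hK => ?_
      refine measure_le_smul_of_locally (fun x => ?_) A hA
      obtain ⟨U, hU, h⟩ := hlocal K hK x
      exact ⟨U, hU, fun A hAU hAm => (h A hAU hAm).2⟩
  rw [← hκ₁A, hfin, hκ₂, withDensity_apply _ hA]

end Area

/-! ### Hypersurfaces as graphs -/

section LocalGraph

variable {V : Type*} [NormedAddCommGroup V] [InnerProductSpace ℝ V] [FiniteDimensional ℝ V]
  {S U : Set V} {ρ : V → ℝ} {p : V}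

theorem inner_gradient (ρ : V → ℝ) (q u : V) : inner ℝ (gradient ρ q) u = fderiv ℝ ρ q u := by
  rw [gradient, ← InnerProductSpace.toDual_apply_apply, LinearIsometryEquiv.apply_symm_apply]

theorem IsDefiningFunction.contDiffAt (h : IsDefiningFunction S p U ρ) {q : V} (hq : q ∈ U) :
    ContDiffAt ℝ ∞ ρ q :=
  h.smooth.contDiffAt (h.isOpen.mem_nhds hq)

theorem IsDefiningFunction.gradient_ne_zero (h : IsDefiningFunction S p U ρ) {q : V} (hq : q ∈ U) :
    gradient ρ q ≠ 0 := by
  intro h0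
  apply h.regular q hq
  ext u
  rw [← inner_gradient, h0, inner_zero_left]
  rfl

theorem IsDefiningFunction.norm_unitNormal (h : IsDefiningFunction S p U ρ) {q : V} (hq : q ∈ U) :
    ‖unitNormal ρ q‖ = 1 := by
  rw [unitNormal, norm_smul, norm_inv, norm_norm, inv_mul_cancel₀]
  exact norm_ne_zero_iff.2 (h.gradient_ne_zero hq)

theorem inner_unitNormal (ρ : V → ℝ) (q u : V) :
    inner ℝ (unitNormal ρ q) u = ‖gradient ρ q‖⁻¹ * fderiv ℝ ρ q u := by
  rw [unitNormal, inner_smul_left, inner_gradient]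
  rfl

theorem IsDefiningFunction.differentiableAt_unitNormal (h : IsDefiningFunction S p U ρ) {q : V}
    (hq : q ∈ U) : DifferentiableAt ℝ (unitNormal ρ) q := by
  have h1 : DifferentiableAt ℝ (fderiv ℝ ρ) q :=
    ((h.contDiffAt hq).fderiv_right (m := ∞) (by simp)).differentiableAt (by simp)
  have h2 : DifferentiableAt ℝ (gradient ρ) q :=
    (InnerProductSpace.toDual ℝ V).symm.toContinuousLinearEquiv.differentiableAt.comp q h1
  have h3 := h.gradient_ne_zero hq
  exact ((h2.norm ℝ h3).inv (norm_ne_zero_iff.2 h3)).smul h2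

theorem inner_tangent_unitNormal (x : tangent ρ p) : inner ℝ (x : V) (unitNormal ρ p) = 0 :=
  (Submodule.mem_orthogonal_singleton_iff_inner_left).1 x.2

theorem eq_tangent_add (hν : ‖unitNormal ρ p‖ = 1) (u : V) :
    u = ((tangent ρ p).orthogonalProjectionOnto u : V) +
      inner ℝ (unitNormal ρ p) u • unitNormal ρ p := by
  have h1 : ((tangent ρ p).orthogonalProjectionOnto u : V) =
      u - inner ℝ (unitNormal ρ p) u • unitNormal ρ p := by
    rw [← Submodule.starProjection_apply, Submodule.starProjection_orthogonal_val,
      Submodule.starProjection_unit_singleton ℝ hν]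
  rw [h1, sub_add_cancel]

theorem orthogonalProjectionOnto_tangent_add (x : tangent ρ p) (s : ℝ) :
    (tangent ρ p).orthogonalProjectionOnto ((x : V) + s • unitNormal ρ p) = x := by
  rw [map_add, map_smul, Submodule.orthogonalProjectionOnto_mem_subspace_eq_self]
  have : (tangent ρ p).orthogonalProjectionOnto (unitNormal ρ p) = 0 :=
    Submodule.orthogonalProjectionOnto_orthogonal_apply_eq_zero
      (Submodule.mem_span_singleton_self _)
  rw [this, smul_zero, add_zero]

/-- The parametrization of the graph of `φ` over the tangent space. -/
def graphParam (ρ : V → ℝ) (p : V) (φ : tangent ρ p → ℝ) (x : tangent ρ p) : V :=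
  p + (tangent ρ p).subtypeₗᵢ x + φ x • unitNormal ρ p

theorem projection_graphParam (φ : tangent ρ p → ℝ) (x : tangent ρ p) :
    (tangent ρ p).orthogonalProjectionOnto (graphParam ρ p φ x - p) = x := by
  have : graphParam ρ p φ x - p = (x : V) + φ x • unitNormal ρ p := by
    have h1 : graphParam ρ p φ x = p + (x : V) + φ x • unitNormal ρ p := rfl
    rw [h1]
    abel
  rw [this, orthogonalProjectionOnto_tangent_add]

theorem contDiff_graphParam {φ : tangent ρ p → ℝ} {n : WithTop ℕ∞} (hφ : ContDiff ℝ n φ) :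
    ContDiff ℝ n (graphParam ρ p φ) :=
  (contDiff_const.add (tangent ρ p).subtypeₗᵢ.contDiff).add (hφ.smul contDiff_const)

/-- The straightening map `q ↦ (P_T (q - p), ρ q)` has invertible derivative. -/
theorem IsDefiningFunction.exists_equiv (h : IsDefiningFunction S p U ρ) :
    ∃ F' : V ≃L[ℝ] tangent ρ p × ℝ,
      HasFDerivAt (fun q => ((tangent ρ p).orthogonalProjectionOnto (q - p), ρ q))
        (F' : V →L[ℝ] tangent ρ p × ℝ) p := by
  set ν := unitNormal ρ p with hνdef
  have hν : ‖ν‖ = 1 := h.norm_unitNormal h.mem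
  set g := ‖gradient ρ p‖ with hg
  have hg0 : g ≠ 0 := norm_ne_zero_iff.2 (h.gradient_ne_zero h.mem)
  have hρν : ∀ u, fderiv ℝ ρ p u = g * inner ℝ ν u := by
    intro u
    rw [inner_unitNormal, ← hg, ← mul_assoc, mul_inv_cancel₀ hg0, one_mul]
  have hρT : ∀ x : tangent ρ p, fderiv ℝ ρ p x = 0 := fun x => by
    rw [hρν, real_inner_comm, inner_tangent_unitNormal, mul_zero]
  let f₁ : V →L[ℝ] tangent ρ p × ℝ :=
    (tangent ρ p).orthogonalProjectionOnto.prod (fderiv ℝ ρ p)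
  let f₂ : tangent ρ p × ℝ →L[ℝ] V :=
    (tangent ρ p).subtypeL.comp (ContinuousLinearMap.fst ℝ _ _) +
      (ContinuousLinearMap.snd ℝ _ _).smulRight (g⁻¹ • ν)
  have hf₁ : ∀ u, f₁ u = ((tangent ρ p).orthogonalProjectionOnto u, fderiv ℝ ρ p u) := fun u => rfl
  have hf₂ : ∀ z, f₂ z = (z.1 : V) + z.2 • g⁻¹ • ν := fun z => rfl
  refine ⟨ContinuousLinearEquiv.equivOfInverse f₁ f₂ (fun u => ?_) (fun z => ?_), ?_⟩
  · rw [hf₁, hf₂, hρν, smul_smul, mul_comm g, mul_assoc, mul_inv_cancel₀ hg0, mul_one]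
    exact (eq_tangent_add hν u).symm
  · rw [hf₂, hf₁, smul_smul, orthogonalProjectionOnto_tangent_add, map_add, hρT, map_smul, hρν,
      real_inner_self_eq_norm_sq, hν]
    ext
    · rfl
    · simp
      field_simp
  · have h1 : HasFDerivAt (fun q => (tangent ρ p).orthogonalProjectionOnto (q - p))
        (tangent ρ p).orthogonalProjectionOnto p :=
      (tangent ρ p).orthogonalProjectionOnto.hasFDerivAt.comp p ((hasFDerivAt_id p).sub_const p)
    exact h1.prodMk ((h.contDiffAt h.mem).differentiableAt (by simp)).hasFDerivAt

/-- A hypersurface is locally a smooth graph over its tangent space. -/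
theorem IsDefiningFunction.exists_graph (h : IsDefiningFunction S p U ρ) (hpS : p ∈ S) :
    ∃ φ : tangent ρ p → ℝ, ContDiff ℝ ∞ φ ∧ φ 0 = 0 ∧
      (∀ᶠ x in 𝓝 0, ρ (graphParam ρ p φ x) = 0) ∧
      ∃ O : Set V, IsOpen O ∧ p ∈ O ∧ S ∩ O = range (graphParam ρ p φ) ∩ O := by
  set ν := unitNormal ρ p with hνdef
  have hν : ‖ν‖ = 1 := h.norm_unitNormal h.mem
  obtain ⟨F', hF'⟩ := h.exists_equiv
  set F : V → tangent ρ p × ℝ :=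
    fun q => ((tangent ρ p).orthogonalProjectionOnto (q - p), ρ q) with hF
  have hFs : ∀ q ∈ U, ContDiffAt ℝ ∞ F q := fun q hq =>
    ((tangent ρ p).orthogonalProjectionOnto.contDiff.contDiffAt.comp q
      (contDiffAt_id.sub contDiffAt_const)).prodMk (h.contDiffAt hq)
  have hρp : ρ p = 0 := by
    have : p ∈ S ∩ U := ⟨hpS, h.mem⟩
    rw [h.zeros] at this
    exact this.2
  set e := (hFs p h.mem).toOpenPartialHomeomorph F hF' (by simp) with he
  have hecoe : ∀ q, e q = F q := fun q => rfl
  have hpe : p ∈ e.source := (hFs p h.mem).mem_toOpenPartialHomeomorph_source hF' (by simp)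
  have hFp : F p = (0, 0) := by simp [hF, hρp]
  have hep : e.symm (0, 0) = p := by rw [← hFp, ← hecoe, e.left_inv hpe]
  have h0t : ((0, 0) : tangent ρ p × ℝ) ∈ e.target := by
    rw [← hFp, ← hecoe]; exact e.map_source hpe
  -- The derivative stays invertible near `p`, because invertible operators form an open set. This
  -- makes the local inverse smooth on a whole neighbourhood rather than only at the image of `p`.
  have hinv : ∀ᶠ q in 𝓝 p, ∃ E : V ≃L[ℝ] tangent ρ p × ℝ, HasFDerivAt F (E : V →L[ℝ] _) q := by
    have h1 : ContinuousAt (fderiv ℝ F) p :=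
      ((hFs p h.mem).fderiv_right (m := ∞) (by simp)).continuousAt
    have h2 : range ((↑) : (V ≃L[ℝ] tangent ρ p × ℝ) → V →L[ℝ] tangent ρ p × ℝ) ∈
        𝓝 (fderiv ℝ F p) := by
      rw [hF'.fderiv]
      exact ContinuousLinearEquiv.nhds F'
    filter_upwards [h1.preimage_mem_nhds h2, h.isOpen.mem_nhds h.mem] with q ⟨E, hE⟩ hq
    refine ⟨E, ?_⟩
    rw [hE]
    exact ((hFs q hq).differentiableAt (by simp)).hasFDerivAt
  have hsymm : ∀ᶠ z in 𝓝 ((0, 0) : tangent ρ p × ℝ), z ∈ e.target ∧ ContDiffAt ℝ ∞ e.symm z := by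
    have h1 : Tendsto e.symm (𝓝 (0, 0)) (𝓝 p) := by
      have := e.continuousAt_symm h0t
      rwa [ContinuousAt, hep] at this
    filter_upwards [h1.eventually hinv, h1.eventually (h.isOpen.mem_nhds h.mem),
      e.open_target.mem_nhds h0t] with z ⟨E, hE⟩ hzU hzt
    exact ⟨hzt, e.contDiffAt_symm hzt hE (hFs _ hzU)⟩
  -- The height over the tangent space of the point of the level set `ρ = 0` above `x`; the cutoff
  -- `χ` below extends it to a globally smooth function.
  set ψ : tangent ρ p → ℝ := fun x => inner ℝ ν (e.symm (x, 0) - p) with hψ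
  have hx : ∀ᶠ x in 𝓝 (0 : tangent ρ p), ((x, 0) : tangent ρ p × ℝ) ∈ e.target ∧
      ContDiffAt ℝ ∞ ψ x := by
    have h1 : Tendsto (fun x : tangent ρ p => ((x, 0) : tangent ρ p × ℝ)) (𝓝 0) (𝓝 (0, 0)) := by
      have : Continuous fun x : tangent ρ p => ((x, 0) : tangent ρ p × ℝ) := by fun_prop
      exact this.tendsto 0
    filter_upwards [h1.eventually hsymm] with x hx
    have h2 : ContDiffAt ℝ ∞ (fun x : tangent ρ p => e.symm (x, 0)) x :=
      hx.2.comp x (contDiffAt_id.prodMk contDiffAt_const)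
    exact ⟨hx.1, contDiffAt_const.inner ℝ (h2.sub contDiffAt_const)⟩
  obtain ⟨r, hr, hball⟩ := Metric.eventually_nhds_iff.1 hx
  let χ : ContDiffBump (0 : tangent ρ p) := ⟨r / 3, r / 2, by positivity, by linarith⟩
  set φ : tangent ρ p → ℝ := fun x => χ x * ψ x with hφ
  have hφs : ContDiff ℝ ∞ φ := by
    rw [contDiff_iff_contDiffAt]
    intro x
    by_cases hxr : dist x 0 < r
    · exact χ.contDiff.contDiffAt.mul (hball hxr).2
    · have hxt : x ∉ tsupport χ := by
        rw [χ.tsupport_eq, Metric.mem_closedBall]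
        have : χ.rOut = r / 2 := rfl
        linarith
      have : φ =ᶠ[𝓝 x] fun _ => 0 := by
        filter_upwards [notMem_tsupport_iff_eventuallyEq.1 hxt] with y hy
        simp [hφ, hy]
      exact contDiffAt_const.congr_of_eventuallyEq this
  have hparam : ∀ x : tangent ρ p, ‖x‖ < r / 3 →
      graphParam ρ p φ x = e.symm (x, 0) ∧ ((x, 0) : tangent ρ p × ℝ) ∈ e.target := by
    intro x hx
    have hxt := (hball (y := x) (by rw [dist_zero_right]; linarith)).1
    refine ⟨?_, hxt⟩
    have h1 : χ x = 1 := χ.one_of_mem_closedBall (by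
      rw [Metric.mem_closedBall, dist_zero_right]; exact hx.le)
    have h2 := e.right_inv hxt
    rw [hecoe] at h2
    have h3 : (tangent ρ p).orthogonalProjectionOnto (e.symm (x, 0) - p) = x :=
      congrArg Prod.fst h2
    have h4 := eq_tangent_add hν (e.symm (x, 0) - p)
    rw [h3] at h4
    have h5 : e.symm (x, 0) = p + (e.symm (x, 0) - p) := by abel
    rw [h5, h4, graphParam, hφ]
    simp only [h1, one_mul]
    rw [add_assoc]
    rfl
  have hzero : ∀ x : tangent ρ p, ‖x‖ < r / 3 → ρ (graphParam ρ p φ x) = 0 := by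
    intro x hx
    obtain ⟨h1, hxt⟩ := hparam x hx
    have h2 := e.right_inv hxt
    rw [hecoe] at h2
    rw [h1]
    exact congrArg Prod.snd h2
  -- On this set the straightening map is invertible, `S` is the zero set of `ρ`, and the projection
  -- lies where `χ = 1`, so that the surface and the cut-off graph coincide.
  refine ⟨φ, hφs, ?_, ?_, e.source ∩ U ∩
    {q | ‖(tangent ρ p).orthogonalProjectionOnto (q - p)‖ < r / 3}, ?_, ?_, ?_⟩
  · simp [hφ, hψ, hep]
  · filter_upwards [Metric.ball_mem_nhds (0 : tangent ρ p) (by positivity : 0 < r / 3)] with x hx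
    exact hzero x (by simpa using hx)
  · refine (e.open_source.inter h.isOpen).inter (isOpen_lt ?_ continuous_const)
    fun_prop
  · exact ⟨⟨hpe, h.mem⟩, by simpa using hr⟩
  · ext q
    constructor
    · rintro ⟨hqS, ⟨hqe, hqU⟩, hqr⟩
      refine ⟨⟨(tangent ρ p).orthogonalProjectionOnto (q - p), ?_⟩, ⟨hqe, hqU⟩, hqr⟩
      rw [(hparam _ hqr).1]
      have : q ∈ S ∩ U := ⟨hqS, hqU⟩
      rw [h.zeros] at this
      have h2 : F q = ((tangent ρ p).orthogonalProjectionOnto (q - p), 0) := by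
        rw [hF]; simp [this.2]
      rw [← h2, ← hecoe, e.left_inv hqe]
    · rintro ⟨⟨x, rfl⟩, ⟨hqe, hqU⟩, hqr⟩
      refine ⟨?_, ⟨hqe, hqU⟩, hqr⟩
      rw [mem_ofPred_eq, projection_graphParam] at hqr
      have : graphParam ρ p φ x ∈ {q ∈ U | ρ q = 0} := ⟨hqU, hzero x hqr⟩
      rw [← h.zeros] at this
      exact this.1

/-- The Hessian of the local graph function is the second fundamental form. -/
theorem IsDefiningFunction.fderiv_graph (h : IsDefiningFunction S p U ρ) {φ : tangent ρ p → ℝ}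
    (hφ : ContDiff ℝ ∞ φ) (hφ0 : φ 0 = 0) (hz : ∀ᶠ x in 𝓝 0, ρ (graphParam ρ p φ x) = 0) :
    fderiv ℝ φ 0 = 0 ∧ ∀ w u : tangent ρ p,
      fderiv ℝ (fderiv ℝ φ) 0 w u = inner ℝ (shapeOperator ρ p w) u := by
  set ν := unitNormal ρ p with hνdef
  have hν : ‖ν‖ = 1 := h.norm_unitNormal h.mem
  set Φ := graphParam ρ p φ with hΦ
  have hΦ0 : Φ 0 = p := by simp [hΦ, graphParam, hφ0]
  have hφd : ∀ x, HasFDerivAt φ (fderiv ℝ φ x) x := fun x =>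
    (hφ.differentiable (by simp) x).hasFDerivAt
  have hΦd : ∀ x, HasFDerivAt Φ ((tangent ρ p).subtypeₗᵢ.toContinuousLinearMap +
      (fderiv ℝ φ x).smulRight ν) x := fun x =>
    ((tangent ρ p).subtypeₗᵢ.toContinuousLinearMap.hasFDerivAt.const_add p).add
      ((hφd x).smul_const ν)
  have hΦU : ∀ᶠ x in 𝓝 0, Φ x ∈ U := by
    have := (hΦd 0).continuousAt
    rw [ContinuousAt, hΦ0] at this
    exact this.eventually (h.isOpen.mem_nhds h.mem)
  -- The normal is orthogonal to the tangent vector `u + ∂_u φ ν` of the graph. At `x = 0` this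
  -- gives `∂_u φ = 0`. Differentiating once more along `w` gives `⟪dν(w), u⟫ + D²φ(w, u) = 0`, as
  -- the other terms carry a factor `∂_u φ(0)`.
  have hN : ∀ u : tangent ρ p, ∀ᶠ x in 𝓝 (0 : tangent ρ p),
      inner ℝ (unitNormal ρ (Φ x)) (u : V) +
        fderiv ℝ φ x u * inner ℝ (unitNormal ρ (Φ x)) ν = 0 := by
    intro u
    filter_upwards [hz.eventually_nhds, hΦU] with x hx hxU
    have h1 := ((h.contDiffAt hxU).differentiableAt (by simp)).hasFDerivAt.comp x (hΦd x)
    have h2 : HasFDerivAt (ρ ∘ Φ) (0 : tangent ρ p →L[ℝ] ℝ) x :=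
      (hasFDerivAt_const (0 : ℝ) x).congr_of_eventuallyEq hx
    have h3 : fderiv ℝ ρ (Φ x) ((u : V) + fderiv ℝ φ x u • ν) = 0 :=
      congrArg (fun L : tangent ρ p →L[ℝ] ℝ => L u) (h1.unique h2)
    have h4 := inner_unitNormal ρ (Φ x) ((u : V) + fderiv ℝ φ x u • ν)
    rw [h3, mul_zero, inner_add_right, inner_smul_right] at h4
    exact h4
  have hφ'0 : fderiv ℝ φ 0 = 0 := by
    ext u
    have h1 := (hN u).self_of_nhds
    rw [hΦ0, ← hνdef, real_inner_comm, inner_tangent_unitNormal, real_inner_self_eq_norm_sq,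
      hν] at h1
    simpa using h1
  refine ⟨hφ'0, fun w u => ?_⟩
  have hNd : HasFDerivAt (unitNormal ρ ∘ Φ) ((fderiv ℝ (unitNormal ρ) p).comp
      ((tangent ρ p).subtypeₗᵢ.toContinuousLinearMap + (fderiv ℝ φ 0).smulRight ν)) 0 := by
    refine HasFDerivAt.comp 0 ?_ (hΦd 0)
    rw [hΦ0]
    exact (h.differentiableAt_unitNormal h.mem).hasFDerivAt
  have hφ2 : HasFDerivAt (fderiv ℝ φ) (fderiv ℝ (fderiv ℝ φ) 0) 0 :=
    ((hφ.fderiv_right (m := ∞) (by simp)).differentiable (by simp) 0).hasFDerivAt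
  have h1 := (hNd.inner ℝ (hasFDerivAt_const (u : V) 0)).add
    ((hφ2.clm_apply (hasFDerivAt_const u 0)).mul (hNd.inner ℝ (hasFDerivAt_const ν 0)))
  have h2 := h1.unique ((hasFDerivAt_const (0 : ℝ) 0).congr_of_eventuallyEq (hN u))
  have h3 := congrArg (fun L : tangent ρ p →L[ℝ] ℝ => L w) h2
  simp only [hφ'0, hΦ0, Function.comp_apply, add_apply, smul_apply,
    ContinuousLinearMap.comp_apply, ContinuousLinearMap.prod_apply, fderivInnerCLM_apply,
    zero_apply, inner_zero_right, ContinuousLinearMap.flip_apply,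
    ← hνdef, real_inner_self_eq_norm_sq, hν, smul_eq_mul, zero_mul, zero_add, one_pow, one_mul] at h3
  have h4 : inner ℝ (shapeOperator ρ p w) u =
      -inner ℝ (fderiv ℝ (unitNormal ρ) p w) (u : V) := by
    rw [shapeOperator]
    simp only [ContinuousLinearMap.coe_coe, ContinuousLinearMap.comp_apply]
    rw [Submodule.inner_orthogonalProjectionOnto_eq_of_mem_right]
    simp [inner_neg_left]
  have h5 : (tangent ρ p).subtypeₗᵢ.toContinuousLinearMap w +
      (ContinuousLinearMap.smulRight (0 : tangent ρ p →L[ℝ] ℝ) ν) w = (w : V) := by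
    change (w : V) + (0 : ℝ) • ν = w
    rw [zero_smul, add_zero]
  rw [h5] at h3
  rw [h4]
  linarith

/-- The geometric multiplicity of the eigenvalue 0 is at most its algebraic multiplicity, and the
degree of the characteristic polynomial bounds the number of its roots. Self-adjointness plays no
role. -/
theorem card_nonzero_roots_add_finrank_ker_le {W : Type*} [AddCommGroup W] [Module ℝ W]
    [FiniteDimensional ℝ W] (A : W →ₗ[ℝ] W) :
    Multiset.card (A.charpoly.roots.filter (· ≠ 0)) + Module.finrank ℝ (LinearMap.ker A) ≤
      Module.finrank ℝ W := by
  have h1 : Module.finrank ℝ (LinearMap.ker A) ≤ A.charpoly.roots.count 0 := by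
    have h2 : LinearMap.ker A ≤ Module.End.maxGenEigenspace A 0 := by
      rw [← Module.End.eigenspace_zero]
      exact Module.End.genEigenspace_le_maximal _ _ _
    have h3 := Submodule.finrank_mono h2
    rw [LinearMap.finrank_maxGenEigenspace_zero_eq] at h3
    rwa [Polynomial.count_roots, Polynomial.rootMultiplicity_eq_natTrailingDegree']
  have h2 := Polynomial.card_roots' A.charpoly
  rw [LinearMap.charpoly_natDegree] at h2
  have h3 := congrArg Multiset.card (Multiset.filter_add_not (· ≠ (0 : ℝ)) A.charpoly.roots)
  rw [Multiset.card_add] at h3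
  have h4 : Multiset.card (A.charpoly.roots.filter fun a => ¬ a ≠ 0) = A.charpoly.roots.count 0 := by
    rw [Multiset.count, Multiset.countP_eq_card_filter]
    congr 1
    refine Multiset.filter_congr fun x _ => ?_
    simp [eq_comm]
  omega

end LocalGraph

/-! ### Fourier decay of surface measures -/

section SurfaceDecay

variable {V : Type*} [NormedAddCommGroup V] [InnerProductSpace ℝ V] [FiniteDimensional ℝ V]
  [MeasurableSpace V] [BorelSpace V] {S U : Set V} {ρ : V → ℝ} {p : V}

open scoped MeasureTheory

/-- The Fourier character `q ↦ exp(-2πi ⟪q, ξ⟫)`. -/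
def waveChar (ξ q : V) : ℂ := Complex.exp (Complex.I * (-(2 * Real.pi) * inner ℝ q ξ : ℝ))

theorem norm_waveChar (ξ q : V) : ‖waveChar ξ q‖ = 1 := by
  rw [waveChar, mul_comm, Complex.norm_exp_ofReal_mul_I]

theorem continuous_waveChar (ξ : V) : Continuous (waveChar ξ) := by
  unfold waveChar
  fun_prop

/-- The density of the surface measure of the graph of `φ`. -/
def graphDensity {T : Type*} [NormedAddCommGroup T] [InnerProductSpace ℝ T] (φ : T → ℝ) (x : T) :
    ℝ≥0 := ⟨Real.sqrt (1 + ‖fderiv ℝ φ x‖ ^ 2), Real.sqrt_nonneg _⟩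

theorem contDiff_graphDensity {T : Type*} [NormedAddCommGroup T] [InnerProductSpace ℝ T]
    [FiniteDimensional ℝ T] {φ : T → ℝ} (hφ : ContDiff ℝ ∞ φ) :
    ContDiff ℝ ∞ fun x => (graphDensity φ x : ℝ) := by
  have h1 : ContDiff ℝ ∞ fun x => (InnerProductSpace.toDual ℝ T).symm (fderiv ℝ φ x) :=
    (InnerProductSpace.toDual ℝ T).symm.toContinuousLinearEquiv.contDiff.comp
      (hφ.fderiv_right (m := ∞) (by simp))
  have h2 : ∀ x, (graphDensity φ x : ℝ) =
      Real.sqrt (1 + ‖(InnerProductSpace.toDual ℝ T).symm (fderiv ℝ φ x)‖ ^ 2) := fun x => by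
    rw [LinearIsometryEquiv.norm_map]
    rfl
  simp_rw [h2]
  exact (contDiff_const.add (h1.norm_sq ℝ)).sqrt fun x => by positivity

/-- The surface measure of a graph is the image of a smooth density on the tangent space. -/
theorem restrict_hausdorffMeasure_range_graphParam (hν : ‖unitNormal ρ p‖ = 1)
    {φ : tangent ρ p → ℝ} (hφ : ContDiff ℝ ∞ φ) :
    (μH[Module.finrank ℝ (tangent ρ p)] : Measure V).restrict (range (graphParam ρ p φ)) =
      Measure.map (graphParam ρ p φ) ((μH[Module.finrank ℝ (tangent ρ p)] :
        Measure (tangent ρ p)).withDensity fun x => graphDensity φ x) := by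
  have hm : Measurable (graphParam ρ p φ) := (contDiff_graphParam hφ).continuous.measurable
  ext B hB
  rw [Measure.restrict_apply hB, Measure.map_apply hm hB, withDensity_apply _ (hm hB),
    ← image_preimage_eq_inter_range]
  refine (hausdorffMeasure_graph_image (ι := (tangent ρ p).subtypeₗᵢ) hν
    (fun x => inner_tangent_unitNormal x) p (hφ.of_le (by simp)) (hm hB)).trans ?_
  refine lintegral_congr fun x => ?_
  rw [ENNReal.ofReal]
  congr 1
  exact Real.toNNReal_of_nonneg (Real.sqrt_nonneg _)

/-- Local structure of a hypersurface near a point, in the form used for Fourier decay. -/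
theorem IsDefiningFunction.exists_local_decay (h : IsDefiningFunction S p U ρ) (hpS : p ∈ S)
    (hS : MeasurableSet S) {k : ℕ}
    (hk : k ≤ Multiset.card ((principalCurvatures ρ p).filter (· ≠ 0))) :
    ∃ O : Set V, IsOpen O ∧ p ∈ O ∧
      (μH[(Module.finrank ℝ V : ℝ) - 1] : Measure V) (S ∩ O) < ⊤ ∧
      ∀ a : V → ℂ, ContDiff ℝ ∞ a → HasCompactSupport a → tsupport a ⊆ O →
        ∃ C, 0 ≤ C ∧ ∀ ξ, 1 ≤ ‖ξ‖ →
          ‖ξ‖ ^ k * ‖∫ q in S, waveChar ξ q * a q ∂μH[(Module.finrank ℝ V : ℝ) - 1]‖ ^ 2 ≤ C := by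
  have hν : ‖unitNormal ρ p‖ = 1 := h.norm_unitNormal h.mem
  have hν0 : unitNormal ρ p ≠ 0 := norm_ne_zero_iff.1 (by rw [hν]; exact one_ne_zero)
  have hdim : (Module.finrank ℝ V : ℝ) - 1 = Module.finrank ℝ (tangent ρ p) := by
    have h1 := Submodule.finrank_add_finrank_orthogonal (Submodule.span ℝ {unitNormal ρ p})
    rw [finrank_span_singleton hν0] at h1
    rw [← h1]
    push_cast
    ring
  rw [hdim]
  obtain ⟨φ, hφ, hφ0, hz, O, hO, hpO, hSO⟩ := h.exists_graph hpS
  obtain ⟨hφ'0, hHess⟩ := h.fderiv_graph hφ hφ0 hz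
  set m := Module.finrank ℝ (tangent ρ p) with hm
  set Φ := graphParam ρ p φ with hΦ
  have hΦs : ContDiff ℝ ∞ Φ := contDiff_graphParam hφ
  have hΦ0 : Φ 0 = p := by simp [hΦ, graphParam, hφ0]
  have hker : LinearMap.ker (fderiv ℝ (fderiv ℝ φ) 0).toLinearMap =
      LinearMap.ker (shapeOperator ρ p) := by
    ext w
    rw [LinearMap.mem_ker, LinearMap.mem_ker]
    constructor
    · intro hw
      apply ext_inner_right ℝ
      intro u
      rw [← hHess, inner_zero_left]
      exact congrArg (fun L : tangent ρ p →L[ℝ] ℝ => L u) hw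
    · intro hw
      ext u
      have := hHess w u
      rw [hw, inner_zero_left] at this
      exact this
  obtain ⟨ε, hε, hdecay⟩ := oscillatory_decay hφ hφ'0 (k := k) (by
    rw [hker]
    have := card_nonzero_roots_add_finrank_ker_le (shapeOperator ρ p)
    have h2 : (principalCurvatures ρ p) = (shapeOperator ρ p).charpoly.roots := rfl
    rw [h2] at hk
    omega)
  have hproj : Continuous fun q => (tangent ρ p).orthogonalProjectionOnto (q - p) := by fun_prop
  -- An amplitude supported here pulls back to one supported in the ball of radius `ε` where
  -- `oscillatory_decay` applies.
  set O' := O ∩ {q | ‖(tangent ρ p).orthogonalProjectionOnto (q - p)‖ < ε} with hO'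
  have hSO' : S ∩ O' = range Φ ∩ O' := by
    rw [hO', ← inter_assoc, hSO, inter_assoc]
  have hO'o : IsOpen O' := hO.inter (isOpen_lt hproj.norm continuous_const)
  have hrestr := restrict_hausdorffMeasure_range_graphParam hν hφ
  rw [← hm, ← hΦ] at hrestr
  have hdens : Measurable (graphDensity φ) :=
    (contDiff_graphDensity hφ).continuous.measurable.subtype_mk
  have hrange : MeasurableSet (range Φ) := by
    have hinj : Function.Injective Φ := fun x y hxy => by
      rw [← projection_graphParam (p := p) φ x, ← projection_graphParam (p := p) φ y, ← hΦ, hxy]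
    exact (hΦs.continuous.measurableEmbedding hinj).measurableSet_range
  refine ⟨O', hO'o, ⟨hpO, by simpa using hε⟩, ?_, fun a ha has haO => ?_⟩
  · have h1 : (μH[m] : Measure V) (S ∩ O') = (μH[m] : Measure V).restrict (range Φ) O' := by
      rw [hSO', Measure.restrict_apply hO'o.measurableSet, inter_comm]
    have hpre : Φ ⁻¹' O' ⊆ Metric.closedBall 0 ε := by
      intro x hx
      have := hx.2
      rw [mem_ofPred_eq, hΦ, projection_graphParam] at this
      simpa using this.le
    rw [h1, hrestr, Measure.map_apply hΦs.continuous.measurable hO'o.measurableSet,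
      withDensity_apply _ (hΦs.continuous.measurable hO'o.measurableSet)]
    refine (lintegral_mono_set hpre).trans_lt ?_
    have hc : ContinuousOn (fun x => graphDensity φ x) (Metric.closedBall 0 ε) := by
      have := (contDiff_graphDensity hφ).continuous
      exact (this.subtype_mk _).continuousOn
    obtain ⟨B, hB⟩ := (isCompact_closedBall (0 : tangent ρ p) ε).bddAbove_image hc
    calc ∫⁻ x in Metric.closedBall 0 ε, (graphDensity φ x : ℝ≥0∞) ∂μH[m]
        ≤ ∫⁻ x in Metric.closedBall 0 ε, (B : ℝ≥0∞) ∂μH[m] :=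
          setLIntegral_mono' Metric.isClosed_closedBall.measurableSet fun x hx =>
            ENNReal.coe_le_coe.2 (hB ⟨x, hx, rfl⟩)
      _ < ⊤ := by
          rw [setLIntegral_const]
          exact ENNReal.mul_lt_top ENNReal.coe_lt_top (isCompact_closedBall _ _).measure_lt_top
  · obtain ⟨c, hc⟩ : ∃ c : ℝ≥0, (μH[m] : Measure (tangent ρ p)) = c • volume :=
      ⟨_, Measure.isAddLeftInvariant_eq_smul _ _⟩
    set b : tangent ρ p → ℂ := fun x => ((graphDensity φ x : ℝ) : ℂ) * a (Φ x) with hb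
    have hbs : ContDiff ℝ ∞ b :=
      (Complex.ofRealCLM.contDiff.comp (contDiff_graphDensity hφ)).mul (ha.comp hΦs)
    have hb0 : ∀ x, ε < ‖x‖ → b x = 0 := by
      intro x hx
      have : a (Φ x) = 0 := by
        by_contra hne
        have h1 := (haO (subset_tsupport _ hne)).2
        rw [mem_ofPred_eq, hΦ, projection_graphParam] at h1
        exact absurd h1 hx.not_gt
      rw [hb]
      simp [this]
    obtain ⟨C, hC, hCb⟩ := hdecay b hbs hb0
    refine ⟨c ^ 2 * C, by positivity, fun ξ hξ => ?_⟩
    set f : V → ℂ := fun q => waveChar ξ q * a q with hf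
    have hfO : ∀ q, q ∉ O' → f q = 0 := fun q hq => by
      rw [hf]
      simp [image_eq_zero_of_notMem_tsupport fun h => hq (haO h)]
    have hfm : AEStronglyMeasurable f (Measure.map Φ ((μH[m] : Measure (tangent ρ p)).withDensity
        fun x => graphDensity φ x)) :=
      ((continuous_waveChar ξ).mul ha.continuous).aestronglyMeasurable
    have h1 : ∫ q in S, f q ∂μH[m] = ∫ q in range Φ, f q ∂μH[m] := by
      have e1 := setIntegral_eq_of_subset_of_forall_sdiff_eq_zero (μ := μH[m]) (f := f) hS
        (inter_subset_left (t := O')) fun q hq => hfO q fun h => hq.2 ⟨hq.1, h⟩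
      have e2 := setIntegral_eq_of_subset_of_forall_sdiff_eq_zero (μ := μH[m]) (f := f) hrange
        (inter_subset_left (t := O')) fun q hq => hfO q fun h => hq.2 ⟨hq.1, h⟩
      rw [e1, hSO', e2]
    -- The tangential part of `ξ` becomes the linear phase, the normal part the coefficient of `φ`.
    -- Together they control `‖ξ‖`, the factor `2π` being at least 1.
    set ξ' : tangent ρ p := (-(2 * Real.pi)) • (tangent ρ p).orthogonalProjectionOnto ξ with hξ'
    set s : ℝ := -(2 * Real.pi) * inner ℝ (unitNormal ρ p) ξ with hs
    have hphase : ∀ x, graphDensity φ x • f (Φ x) = waveChar ξ p *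
        (Complex.exp (Complex.I * (inner ℝ ξ' x + s * φ x : ℝ)) * b x) := by
      intro x
      have h2 : inner ℝ (Φ x) ξ = inner ℝ p ξ +
          inner ℝ ((tangent ρ p).orthogonalProjectionOnto ξ) x +
            φ x * inner ℝ (unitNormal ρ p) ξ := by
        have h3 : Φ x = p + (x : V) + φ x • unitNormal ρ p := rfl
        rw [h3, inner_add_left, inner_add_left, inner_smul_left,
          Submodule.inner_orthogonalProjectionOnto_eq_of_mem_right, conj_trivial,
          real_inner_comm ξ (x : V)]
      rw [hf, hb]
      simp only [waveChar]
      rw [← mul_assoc (Complex.exp _) (Complex.exp _), ← Complex.exp_add, NNReal.smul_def,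
        Complex.real_smul, h2, hξ', hs, inner_smul_left]
      have : ∀ (u v : ℂ) (r w : ℂ), u = v → r * (Complex.exp u * w) = Complex.exp v * (r * w) := by
        rintro u v r w rfl
        ring
      apply this
      simp only [conj_trivial]
      push_cast
      ring
    have h2 : ∫ q in range Φ, f q ∂μH[m] = c • (waveChar ξ p *
        ∫ x, Complex.exp (Complex.I * (inner ℝ ξ' x + s * φ x : ℝ)) * b x) := by
      rw [hrestr, integral_map hΦs.continuous.measurable.aemeasurable hfm,
        integral_withDensity_eq_integral_smul hdens]
      simp_rw [hphase]
      rw [hc, integral_smul_nnreal_measure, integral_const_mul]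
    have h3 : ‖ξ‖ ≤ ‖ξ'‖ + |s| := by
      have h4 := eq_tangent_add hν ξ
      have h5 : ‖ξ‖ ≤ ‖(tangent ρ p).orthogonalProjectionOnto ξ‖ +
          |inner ℝ (unitNormal ρ p) ξ| := by
        conv_lhs => rw [h4]
        refine (norm_add_le _ _).trans ?_
        rw [norm_smul, hν, mul_one]
        rfl
      have h6 : (1 : ℝ) ≤ 2 * Real.pi := by linarith [Real.pi_gt_three]
      rw [hξ', hs, norm_smul, norm_neg, abs_mul, abs_neg, Real.norm_eq_abs,
        abs_of_pos (by positivity : 0 < 2 * Real.pi), ← mul_add]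
      nlinarith [norm_nonneg ξ]
    have h4 := hCb ξ' s (hξ.trans h3)
    calc ‖ξ‖ ^ k * ‖∫ q in S, f q ∂μH[m]‖ ^ 2
        = c ^ 2 * (‖ξ‖ ^ k * ‖∫ x, Complex.exp (Complex.I * (inner ℝ ξ' x + s * φ x : ℝ)) *
          b x‖ ^ 2) := by
          rw [h1, h2, NNReal.smul_def, norm_smul, norm_mul, norm_waveChar, one_mul,
            Real.norm_of_nonneg (NNReal.coe_nonneg c)]
          ring
      _ ≤ c ^ 2 * ((‖ξ'‖ + |s|) ^ k * ‖∫ x, Complex.exp (Complex.I *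
          (inner ℝ ξ' x + s * φ x : ℝ)) * b x‖ ^ 2) := by gcongr
      _ ≤ c ^ 2 * C := by gcongr

open scoped Manifold in
/-- Fourier decay of the surface measure of a compact hypersurface with `k` nonvanishing principal
curvatures, with an arbitrary smooth amplitude. -/
theorem surface_decay (hS : IsCompact S) {k : ℕ} (hk : HasNonvanishingCurvatures S k) :
    (μH[(Module.finrank ℝ V : ℝ) - 1] : Measure V) S < ⊤ ∧
      ∀ a : V → ℂ, ContDiff ℝ ∞ a → ∃ C, 0 ≤ C ∧ ∀ ξ,
        ‖∫ q in S, waveChar ξ q * a q ∂μH[(Module.finrank ℝ V : ℝ) - 1]‖ ≤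
          C * (1 + ‖ξ‖) ^ (-(k : ℝ) / 2) := by
  set μ : Measure V := μH[(Module.finrank ℝ V : ℝ) - 1] with hμ
  have hloc : ∀ p : S, ∃ O : Set V, IsOpen O ∧ (p : V) ∈ O ∧ μ (S ∩ O) < ⊤ ∧
      ∀ a : V → ℂ, ContDiff ℝ ∞ a → HasCompactSupport a → tsupport a ⊆ O →
        ∃ C, 0 ≤ C ∧ ∀ ξ, 1 ≤ ‖ξ‖ → ‖ξ‖ ^ k * ‖∫ q in S, waveChar ξ q * a q ∂μ‖ ^ 2 ≤ C := by
    intro p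
    obtain ⟨U, ρ, hdef, hcard⟩ := hk p p.2
    exact hdef.exists_local_decay p.2 hS.isClosed.measurableSet hcard
  choose O hO hpO hfin hdec using hloc
  -- The unit balls make the pieces of the partition of unity compactly supported.
  obtain ⟨t, ht⟩ := hS.elim_finite_subcover (fun p : S => O p ∩ Metric.ball (p : V) 1)
    (fun p => (hO p).inter Metric.isOpen_ball)
    fun p hp => mem_iUnion.2 ⟨⟨p, hp⟩, hpO _, Metric.mem_ball_self one_pos⟩
  have hSfin : μ S < ⊤ := by
    have h1 : S ⊆ ⋃ p ∈ t, S ∩ O p := by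
      intro q hq
      obtain ⟨p, hp, hqp⟩ := mem_iUnion₂.1 (ht hq)
      exact mem_iUnion₂.2 ⟨p, hp, hq, hqp.1⟩
    exact (measure_mono h1).trans_lt ((measure_biUnion_finset_le _ _).trans_lt
      (ENNReal.sum_lt_top.2 fun p _ => hfin p))
  refine ⟨hSfin, fun a ha => ?_⟩
  have : IsFiniteMeasure (μ.restrict S) := ⟨by rwa [Measure.restrict_apply_univ]⟩
  obtain ⟨f, hf⟩ := SmoothPartitionOfUnity.exists_isSubordinate 𝓘(ℝ, V) hS.isClosed
    (fun p : t => O p ∩ Metric.ball (p : V) 1) (fun p => (hO p).inter Metric.isOpen_ball)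
    (fun q hq => by
      obtain ⟨p, hp, hqp⟩ := mem_iUnion₂.1 (ht hq)
      exact mem_iUnion.2 ⟨⟨p, hp⟩, hqp⟩)
  have hfs : ∀ i, ContDiff ℝ ∞ (f i : V → ℝ) := fun i => (f i).contMDiff.contDiff
  set b : t → V → ℂ := fun i q => ((f i q : ℝ) : ℂ) * a q with hb
  have hbs : ∀ i, ContDiff ℝ ∞ (b i) := fun i => (Complex.ofRealCLM.contDiff.comp (hfs i)).mul ha
  have hbt : ∀ i, tsupport (b i) ⊆ tsupport (f i) := fun i =>
    closure_mono fun q hq => by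
      rw [Function.mem_support] at hq ⊢
      intro h0
      exact hq (by simp [hb, h0])
  have hint : ∀ i ξ, Integrable (fun q => waveChar ξ q * b i q) (μ.restrict S) := by
    intro i ξ
    have hc := (continuous_waveChar ξ).mul (hbs i).continuous
    obtain ⟨M, hM⟩ := hS.exists_bound_of_continuousOn hc.continuousOn
    exact Integrable.of_bound hc.aestronglyMeasurable M
      ((ae_restrict_iff' hS.isClosed.measurableSet).2 (Eventually.of_forall hM))
  have hbound : ∀ i, ∃ C, 0 ≤ C ∧ ∀ ξ,
      ‖∫ q in S, waveChar ξ q * b i q ∂μ‖ ≤ C * (1 + ‖ξ‖) ^ (-(k : ℝ) / 2) := by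
    intro i
    have hcs : HasCompactSupport (b i) := by
      refine Metric.isCompact_of_isClosed_isBounded (isClosed_tsupport _) ?_
      exact (Metric.isBounded_ball (x := ((i : S) : V)) (r := 1)).subset
        ((hbt i).trans ((hf i).trans inter_subset_right))
    obtain ⟨C, hC, hCb⟩ := hdec i (b i) (hbs i) hcs ((hbt i).trans ((hf i).trans inter_subset_left))
    set M := ∫ q in S, ‖b i q‖ ∂μ with hM
    have hM0 : 0 ≤ M := integral_nonneg fun _ => norm_nonneg _
    refine ⟨Real.sqrt (2 ^ k * (C + M ^ 2)), Real.sqrt_nonneg _, fun ξ => ?_⟩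
    set I := ‖∫ q in S, waveChar ξ q * b i q ∂μ‖ with hI
    have hIM : I ≤ M := by
      refine (norm_integral_le_integral_norm _).trans (le_of_eq ?_)
      simp_rw [norm_mul, norm_waveChar, one_mul]
      rfl
    have hI0 : 0 ≤ I := norm_nonneg _
    have h1 : (1 + ‖ξ‖) ^ k * I ^ 2 ≤ 2 ^ k * (C + M ^ 2) := by
      rcases le_or_gt 1 ‖ξ‖ with h | h
      · calc (1 + ‖ξ‖) ^ k * I ^ 2 ≤ (2 * ‖ξ‖) ^ k * I ^ 2 := by gcongr; linarith
          _ = 2 ^ k * (‖ξ‖ ^ k * I ^ 2) := by rw [mul_pow, mul_assoc]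
          _ ≤ 2 ^ k * (C + M ^ 2) := by
            have := hCb ξ h
            gcongr
            nlinarith [sq_nonneg M]
      · calc (1 + ‖ξ‖) ^ k * I ^ 2 ≤ 2 ^ k * M ^ 2 := by gcongr; linarith
          _ ≤ 2 ^ k * (C + M ^ 2) := by gcongr; linarith
    have hpos : 0 < 1 + ‖ξ‖ := by positivity
    have h2 : (1 + ‖ξ‖) ^ (-(k : ℝ) / 2) = (Real.sqrt ((1 + ‖ξ‖) ^ k))⁻¹ := by
      rw [Real.sqrt_eq_rpow, ← Real.rpow_natCast, ← Real.rpow_mul hpos.le, ← Real.rpow_neg hpos.le]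
      congr 1
      ring
    rw [h2, ← div_eq_mul_inv, le_div_iff₀ (Real.sqrt_pos.2 (pow_pos hpos k))]
    apply Real.le_sqrt_of_sq_le
    rw [mul_pow, Real.sq_sqrt (by positivity), mul_comm]
    exact h1
  choose C hC hCb using hbound
  refine ⟨∑ i, C i, Finset.sum_nonneg fun i _ => hC i, fun ξ => ?_⟩
  have hsum : ∫ q in S, waveChar ξ q * a q ∂μ = ∑ i, ∫ q in S, waveChar ξ q * b i q ∂μ := by
    rw [← integral_finsetSum _ fun i _ => hint i ξ]
    refine setIntegral_congr_fun hS.isClosed.measurableSet fun q hq => ?_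
    have h1 := f.sum_eq_one hq
    rw [finsum_eq_sum_of_fintype] at h1
    have h2 : (∑ i, ((f i q : ℝ) : ℂ)) = 1 := by
      rw [← Complex.ofReal_sum, h1, Complex.ofReal_one]
    simp only [hb]
    rw [← Finset.mul_sum, ← Finset.sum_mul, h2, one_mul]
  rw [hsum, Finset.sum_mul]
  exact (norm_sum_le _ _).trans (Finset.sum_le_sum fun i _ => hCb i ξ)

end SurfaceDecay

/-! ### Bilinear Fourier multipliers -/

section BilinearMultiplier

/-- Cauchy–Schwarz for the Lebesgue integral on a set. -/
theorem lintegral_sq_le_measure_mul {α : Type*} [MeasurableSpace α] (μ : Measure α)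
    {f : α → ℝ≥0∞} (hf : AEMeasurable f μ) :
    (∫⁻ x, f x ∂μ) ^ 2 ≤ μ univ * ∫⁻ x, f x ^ 2 ∂μ := by
  have h := ENNReal.lintegral_mul_le_Lp_mul_Lq μ Real.HolderConjugate.two_two
    (f := fun _ => 1) (g := f) aemeasurable_const hf
  simp only [Pi.mul_apply, one_mul, one_pow, lintegral_one, ENNReal.rpow_two] at h
  calc (∫⁻ x, f x ∂μ) ^ 2 ≤ (μ univ ^ (1 / 2 : ℝ) * (∫⁻ x, f x ^ 2 ∂μ) ^ (1 / 2 : ℝ)) ^ 2 := by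
        gcongr
    _ = μ univ * ∫⁻ x, f x ^ 2 ∂μ := by
        rw [mul_pow, ← ENNReal.rpow_natCast, ← ENNReal.rpow_natCast, ← ENNReal.rpow_mul,
          ← ENNReal.rpow_mul]
        norm_num

/-- Countable Minkowski inequality in `L²`. -/
theorem lintegral_tsum_sq_rpow_le {α : Type*} [MeasurableSpace α] (μ : Measure α)
    {f : ℕ → α → ℝ≥0∞} (hf : ∀ n, Measurable (f n)) :
    (∫⁻ x, (∑' n, f n x) ^ 2 ∂μ) ^ (1 / 2 : ℝ) ≤ ∑' n, (∫⁻ x, f n x ^ 2 ∂μ) ^ (1 / 2 : ℝ) := by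
  have hfin : ∀ N, (∫⁻ x, (∑ n ∈ Finset.range N, f n x) ^ 2 ∂μ) ^ (1 / 2 : ℝ) ≤
      ∑ n ∈ Finset.range N, (∫⁻ x, f n x ^ 2 ∂μ) ^ (1 / 2 : ℝ) := by
    intro N
    induction N with
    | zero => simp
    | succ N ih =>
      simp_rw [Finset.sum_range_succ]
      have h := ENNReal.lintegral_Lp_add_le (μ := μ) (p := 2)
        (f := fun x => ∑ n ∈ Finset.range N, f n x) (g := f N)
        (Finset.measurable_sum _ fun n _ => hf n).aemeasurable (hf N).aemeasurable one_le_two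
      simp only [Pi.add_apply, ENNReal.rpow_two] at h
      exact h.trans (add_le_add ih le_rfl)
  have hmono : Monotone fun N x => (∑ n ∈ Finset.range N, f n x) ^ 2 := fun N M h x => by
    dsimp only
    gcongr
  have hsup : ∀ x, (∑' n, f n x) ^ 2 = ⨆ N, (∑ n ∈ Finset.range N, f n x) ^ 2 := fun x => by
    refine tendsto_nhds_unique ?_ (tendsto_atTop_iSup fun N M h => hmono h x)
    exact ((ENNReal.continuous_pow 2).tendsto _).comp ENNReal.summable.hasSum.tendsto_sum_nat
  simp_rw [hsup]
  rw [lintegral_iSup (fun N => (Finset.measurable_sum _ fun n _ => hf n).pow_const 2) hmono]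
  have h2 : Tendsto (fun N => ∫⁻ x, (∑ n ∈ Finset.range N, f n x) ^ 2 ∂μ) atTop
      (𝓝 (⨆ N, ∫⁻ x, (∑ n ∈ Finset.range N, f n x) ^ 2 ∂μ)) :=
    tendsto_atTop_iSup fun N M h => lintegral_mono (hmono h)
  refine le_of_tendsto' ((ENNReal.continuous_rpow_const (y := 1 / 2)).tendsto _ |>.comp h2)
    fun N => ?_
  exact (hfin N).trans (ENNReal.sum_le_tsum _)

variable {V : Type*} [NormedAddCommGroup V] [InnerProductSpace ℝ V] [FiniteDimensional ℝ V]
  [MeasurableSpace V] [BorelSpace V]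

/-- Plancherel's theorem for integrable functions in `L²`. -/
theorem eLpNorm_fourier_eq {H : V → ℂ} (h1 : Integrable H) (h2 : MemLp H 2) :
    eLpNorm (𝓕 H) 2 volume = eLpNorm H 2 volume := by
  set u : Lp (α := V) ℂ 2 volume := h2.toLp H with hu
  have hcont : Continuous (𝓕 H) :=
    VectorFourier.fourierIntegral_continuous Real.continuous_fourierChar
      (by exact continuous_inner) h1
  -- The Fourier integral and the `L²` Fourier transform agree almost everywhere, since both satisfy
  -- `∫ g Ĥ = ∫ ĝ H` for every test function `g`. Plancherel for the latter then applies.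
  have hae : ∀ᵐ x, 𝓕 H x = (𝓕 u : Lp (α := V) ℂ 2 volume) x := by
    refine ae_eq_of_integral_contDiff_smul_eq hcont.locallyIntegrable
      ((Lp.memLp _).locallyIntegrable one_le_two) fun g hg hgs => ?_
    set φ : 𝓢(V, ℂ) := HasCompactSupport.toSchwartzMap (f := fun x => (g x : ℂ))
      (hgs.comp_left (g := fun r : ℝ => (r : ℂ)) Complex.ofReal_zero)
      (Complex.ofRealCLM.contDiff.comp hg) with hφ
    have hφg : ∀ x, φ x = g x := fun x => rfl
    have h3 := congrArg (fun T : 𝓢'(V, ℂ) => T φ) (Lp.fourier_toTemperedDistribution_eq u)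
    simp only [TemperedDistribution.fourier_apply, Lp.toTemperedDistribution_apply] at h3
    have h4 : ∫ x, g x • (𝓕 u : Lp (α := V) ℂ 2 volume) x = ∫ x, (𝓕 φ) x • u x := by
      rw [h3]
      refine integral_congr_ae (Eventually.of_forall fun x => ?_)
      simp [hφg]
    rw [h4]
    have h5 : ∫ x, (𝓕 φ) x • u x = ∫ x, (𝓕 φ) x • H x :=
      integral_congr_ae (h2.coeFn_toLp.mono fun x hx => by simp only [hu, hx])
    rw [h5]
    have h6 := VectorFourier.integral_fourierIntegral_smul_eq_flip (L := innerₗ V)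
      (μ := (volume : Measure V)) (ν := (volume : Measure V)) Real.continuous_fourierChar (by exact continuous_inner) φ.integrable h1
    rw [flip_innerₗ] at h6
    rw [SchwartzMap.fourier_coe]
    refine Eq.trans ?_ h6.symm
    refine integral_congr_ae (Eventually.of_forall fun x => ?_)
    simp [hφg, Real.fourier_eq, VectorFourier.fourierIntegral]
  rw [eLpNorm_congr_ae hae]
  have h7 := Lp.norm_fourier_eq u
  rw [Lp.norm_def, Lp.norm_def, ENNReal.toReal_eq_toReal_iff' (Lp.eLpNorm_ne_top _)
    (Lp.eLpNorm_ne_top _)] at h7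
  rw [h7]
  exact eLpNorm_congr_ae h2.coeFn_toLp

theorem lintegral_fourierInv_sq {H : V → ℂ} (h1 : Integrable H) (h2 : ∫⁻ x, ‖H x‖ₑ ^ 2 < ⊤) :
    ∫⁻ x, ‖𝓕⁻ H x‖ₑ ^ 2 = ∫⁻ x, ‖H x‖ₑ ^ 2 := by
  have key : ∀ G : V → ℂ, eLpNorm G 2 volume = (∫⁻ x, ‖G x‖ₑ ^ 2) ^ (1 / 2 : ℝ) := fun G => by
    rw [eLpNorm_eq_lintegral_rpow_enorm_toReal two_ne_zero ENNReal.ofNat_ne_top]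
    simp
  have hm : MemLp H 2 := ⟨h1.aestronglyMeasurable, by
    rw [key]
    exact ENNReal.rpow_lt_top_of_nonneg (by norm_num) h2.ne⟩
  have h3 := eLpNorm_fourier_eq h1 hm
  rw [key, key] at h3
  have h4 := ENNReal.rpow_left_injective (x := 1 / 2) (by norm_num) h3
  rw [← h4, ← lintegral_neg_eq_self (fun x => ‖𝓕 H x‖ₑ ^ 2)]
  simp_rw [Real.fourierInv_eq_fourier_neg]

/-- The operator with kernel `K` on the frequency side. -/
def extension (K : V × V → ℂ) (x : V) : ℂ :=
  ∫ p : V × V, Complex.exp ((2 * Real.pi * inner ℝ (p.1 + p.2) x : ℝ) * Complex.I) * K p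

theorem norm_extension_exp (p : V × V) (x : V) :
    ‖Complex.exp ((2 * Real.pi * inner ℝ (p.1 + p.2) x : ℝ) * Complex.I)‖ = 1 :=
  Complex.norm_exp_ofReal_mul_I _

/-- The shear `(ξ, ζ) ↦ (ξ, ζ - ξ)` preserves Lebesgue measure, and the exponential depends only on
`ζ`. Plancherel thereby becomes available in the single variable `ζ`. -/
theorem extension_eq_fourierInv {K : V × V → ℂ} (hK : Integrable K) (x : V) :
    extension K x = 𝓕⁻ (fun ζ => ∫ ξ, K (ξ, ζ - ξ)) x := by
  have hmp : MeasurePreserving (fun z : V × V => (z.1, z.2 - z.1)) (volume.prod volume)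
      (volume.prod volume) :=
    (MeasurePreserving.id volume).skew_product (g := fun a b : V => b - a)
      (measurable_snd.sub measurable_fst)
      (Eventually.of_forall fun a => map_sub_right_eq_self volume a)
  have hint : Integrable (fun p : V × V =>
      Complex.exp ((2 * Real.pi * inner ℝ (p.1 + p.2) x : ℝ) * Complex.I) * K p) :=
    hK.bdd_mul (c := 1) (by fun_prop) (Eventually.of_forall fun p => (norm_extension_exp p x).le)
  have hint' := (hmp.integrable_comp hint.aestronglyMeasurable).2 hint
  have hmap := integral_map hmp.measurable.aemeasurable
    (f := fun p : V × V =>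
      Complex.exp ((2 * Real.pi * inner ℝ (p.1 + p.2) x : ℝ) * Complex.I) * K p)
    (by rw [hmp.map_eq]; exact hint.aestronglyMeasurable)
  rw [hmp.map_eq] at hmap
  refine hmap.trans ?_
  refine (integral_prod_symm _ hint').trans ?_
  rw [Real.fourierInv_eq']
  refine integral_congr_ae (Eventually.of_forall fun ζ => ?_)
  simp only [Function.comp_apply, add_sub_cancel, smul_eq_mul]
  rw [integral_const_mul]

/-- A bilinear multiplier whose first frequency is confined to a ball. -/
theorem lintegral_extension_sq_le {K : V × V → ℂ} (hK : Integrable K) {a b : V → ℝ≥0∞}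
    (ha : Measurable a) (hb : Measurable b) (ha2 : ∫⁻ ξ, a ξ ^ 2 < ⊤) (hb2 : ∫⁻ ξ, b ξ ^ 2 < ⊤)
    {R : ℝ} (hab : ∀ ξ η, ‖K (ξ, η)‖ₑ ≤ a ξ * b η) (hR : ∀ ξ η, R < ‖ξ‖ → K (ξ, η) = 0) :
    ∫⁻ x, ‖extension K x‖ₑ ^ 2 ≤
      volume (Metric.closedBall (0 : V) R) * ((∫⁻ ξ, a ξ ^ 2) * ∫⁻ ξ, b ξ ^ 2) := by
  have hmp : MeasurePreserving (fun z : V × V => (z.1, z.2 - z.1)) (volume.prod volume)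
      (volume.prod volume) :=
    (MeasurePreserving.id volume).skew_product (g := fun a b : V => b - a)
      (measurable_snd.sub measurable_fst)
      (Eventually.of_forall fun a => map_sub_right_eq_self volume a)
  have hHint : Integrable fun ζ => ∫ ξ, K (ξ, ζ - ξ) :=
    ((hmp.integrable_comp hK.aestronglyMeasurable).2 hK).integral_prod_right
  -- Cauchy–Schwarz in `ξ` over the ball; its volume is the only loss. Integration in `ζ` then
  -- separates `a` and `b` by translation invariance.
  have hpt : ∀ ζ, ‖∫ ξ, K (ξ, ζ - ξ)‖ₑ ^ 2 ≤
      volume (Metric.closedBall (0 : V) R) * ∫⁻ ξ, (a ξ * b (ζ - ξ)) ^ 2 := by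
    intro ζ
    have hm : Measurable fun ξ => a ξ * b (ζ - ξ) := ha.mul (hb.comp (measurable_const.sub
      measurable_id))
    calc ‖∫ ξ, K (ξ, ζ - ξ)‖ₑ ^ 2 ≤ (∫⁻ ξ, ‖K (ξ, ζ - ξ)‖ₑ) ^ 2 := by
          gcongr
          exact enorm_integral_le_lintegral_enorm _
      _ ≤ (∫⁻ ξ in Metric.closedBall 0 R, a ξ * b (ζ - ξ)) ^ 2 := by
          refine pow_le_pow_left' ?_ 2
          rw [← lintegral_indicator Metric.isClosed_closedBall.measurableSet]
          refine lintegral_mono fun ξ => ?_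
          by_cases h : ξ ∈ Metric.closedBall (0 : V) R
          · rw [indicator_of_mem h]
            exact hab _ _
          · rw [hR _ _ (by simpa using h)]
            simp
      _ ≤ volume (Metric.closedBall (0 : V) R) *
          ∫⁻ ξ in Metric.closedBall 0 R, (a ξ * b (ζ - ξ)) ^ 2 := by
          refine (lintegral_sq_le_measure_mul _ hm.aemeasurable).trans_eq ?_
          rw [Measure.restrict_apply_univ]
      _ ≤ _ := mul_le_mul_right (setLIntegral_le_lintegral _ _) _
  have htot : ∫⁻ ζ, ‖∫ ξ, K (ξ, ζ - ξ)‖ₑ ^ 2 ≤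
      volume (Metric.closedBall (0 : V) R) * ((∫⁻ ξ, a ξ ^ 2) * ∫⁻ ξ, b ξ ^ 2) := by
    have hm : Measurable fun z : V × V => (a z.2 * b (z.1 - z.2)) ^ 2 :=
      ((ha.comp measurable_snd).mul (hb.comp (measurable_fst.sub measurable_snd))).pow_const 2
    refine (lintegral_mono hpt).trans ?_
    rw [lintegral_const_mul _ hm.lintegral_prod_right]
    gcongr
    rw [lintegral_lintegral_swap hm.aemeasurable]
    have : ∀ ξ, ∫⁻ ζ, (a ξ * b (ζ - ξ)) ^ 2 = a ξ ^ 2 * ∫⁻ ζ, b ζ ^ 2 := fun ξ => by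
      simp_rw [mul_pow]
      have hmb : Measurable fun ζ => b (ζ - ξ) ^ 2 :=
        (hb.comp (measurable_id.sub measurable_const)).pow_const 2
      rw [lintegral_const_mul _ hmb,
        lintegral_sub_right_eq_self (fun ζ => b ζ ^ 2) ξ]
    simp_rw [this]
    rw [lintegral_mul_const _ (ha.pow_const 2)]
  simp_rw [extension_eq_fourierInv hK]
  rw [lintegral_fourierInv_sq hHint]
  · exact htot
  · exact htot.trans_lt (ENNReal.mul_lt_top measure_closedBall_lt_top
      (ENNReal.mul_lt_top ha2 hb2))

end BilinearMultiplier

/-! ### The bilinear average on the frequency side -/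

section AverageFormula

variable {d : ℕ}

/-- The multiplier of the bilinear average. -/
def multiplier (μ : Measure (Sp2 d)) (t : ℝ) (p : Sp d × Sp d) : ℂ :=
  ∫ q, waveChar (t • WithLp.toLp 2 p) q ∂μ

theorem fourierInv_schwartz (f : 𝓢(Sp d, ℂ)) (x : Sp d) :
    f x = ∫ ξ, Complex.exp ((2 * Real.pi * inner ℝ ξ x : ℝ) * Complex.I) * 𝓕 (f : Sp d → ℂ) ξ := by
  have h : f x = 𝓕⁻ (𝓕 f) x := by rw [FourierTransform.fourierInv_fourier_eq]
  rw [h, SchwartzMap.fourierInv_coe, SchwartzMap.fourier_coe, Real.fourierInv_eq']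
  simp

theorem integrable_fourier_schwartz (f : 𝓢(Sp d, ℂ)) : Integrable (𝓕 (f : Sp d → ℂ)) := by
  rw [← SchwartzMap.fourier_coe]
  exact (𝓕 f).integrable

theorem continuous_fourier_schwartz (f : 𝓢(Sp d, ℂ)) : Continuous (𝓕 (f : Sp d → ℂ)) := by
  rw [← SchwartzMap.fourier_coe]
  exact (𝓕 f).continuous

/-- Insert Fourier inversion for `f` and `g` and apply Fubini: the integral over `μ` falls on a
single character of `ℝ^{2d}` at frequency `t(ξ, η)`. -/
theorem average_eq_extension (μ : Measure (Sp2 d)) [IsFiniteMeasure μ] (t : ℝ)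
    (f g : 𝓢(Sp d, ℂ)) (x : Sp d) :
    average μ t f g x =
      extension (fun p => 𝓕 (f : Sp d → ℂ) p.1 * 𝓕 (g : Sp d → ℂ) p.2 * multiplier μ t p) x := by
  set F := 𝓕 (f : Sp d → ℂ) with hF
  set G := 𝓕 (g : Sp d → ℂ) with hG
  have hFG : Integrable fun p : Sp d × Sp d => F p.1 * G p.2 :=
    (integrable_fourier_schwartz f).mul_prod (integrable_fourier_schwartz g)
  have hchar : ∀ (q : Sp2 d) (p : Sp d × Sp d),
      Complex.exp ((2 * Real.pi * inner ℝ p.1 (x - t • q.fst) : ℝ) * Complex.I) *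
        Complex.exp ((2 * Real.pi * inner ℝ p.2 (x - t • q.snd) : ℝ) * Complex.I) =
      Complex.exp ((2 * Real.pi * inner ℝ (p.1 + p.2) x : ℝ) * Complex.I) *
        waveChar (t • WithLp.toLp 2 p) q := by
    intro q p
    rw [waveChar, ← Complex.exp_add, ← Complex.exp_add]
    congr 1
    rw [inner_smul_right, WithLp.prod_inner_apply, inner_sub_right, inner_sub_right,
      inner_smul_right, inner_smul_right, inner_add_left, real_inner_comm q.fst p.1,
      real_inner_comm q.snd p.2]
    change (((2 * Real.pi * (_ - t * inner ℝ q.ofLp.1 p.1) : ℝ) : ℂ) * Complex.I + ((2 * Real.pi * (_ - t * inner ℝ q.ofLp.2 p.2) : ℝ) : ℂ) * Complex.I) = _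
    push_cast
    ring
  have h1 : ∀ q : Sp2 d, f (x - t • q.fst) * g (x - t • q.snd) = ∫ p : Sp d × Sp d,
      (Complex.exp ((2 * Real.pi * inner ℝ (p.1 + p.2) x : ℝ) * Complex.I) *
        waveChar (t • WithLp.toLp 2 p) q) * (F p.1 * G p.2) := by
    intro q
    rw [fourierInv_schwartz f, fourierInv_schwartz g, ← integral_prod_mul]
    refine integral_congr_ae (Eventually.of_forall fun p => ?_)
    simp only
    rw [← hchar]
    ring
  rw [average]
  simp_rw [h1]
  rw [integral_integral_swap, extension]
  · refine integral_congr_ae (Eventually.of_forall fun p => ?_)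
    simp only
    rw [integral_mul_const, integral_const_mul, multiplier]
    ring
  · refine Integrable.bdd_mul (c := 1) (hFG.comp_snd μ) ?_ (Eventually.of_forall fun z => ?_)
    · apply Continuous.aestronglyMeasurable
      simp only [waveChar]
      fun_prop
    · rw [norm_mul, norm_extension_exp, norm_waveChar, one_mul]

end AverageFormula

/-! ### Maximal bilinear multipliers -/

section MaximalMultiplier

variable {V : Type*} [NormedAddCommGroup V] [InnerProductSpace ℝ V] [FiniteDimensional ℝ V]
  [MeasurableSpace V] [BorelSpace V]

theorem lintegral_mul_prod_lt_top {a b : V → ℝ≥0∞} (ha : Measurable a) (hb : Measurable b)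
    (ha1 : ∫⁻ ξ, a ξ < ⊤) (hb1 : ∫⁻ ξ, b ξ < ⊤) (A : ℝ≥0) :
    ∫⁻ p : V × V, A * (a p.1 * b p.2) < ⊤ := by
  have hm : Measurable fun p : V × V => a p.1 * b p.2 :=
    (ha.comp measurable_fst).mul (hb.comp measurable_snd)
  rw [lintegral_const_mul _ hm, Measure.volume_eq_prod, lintegral_prod_mul ha.aemeasurable hb.aemeasurable]
  exact ENNReal.mul_lt_top ENNReal.coe_lt_top (ENNReal.mul_lt_top ha1 hb1)

theorem integrable_of_enorm_le_mul {K : V × V → ℂ} (hK : Measurable K) {a b : V → ℝ≥0∞}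
    (ha : Measurable a) (hb : Measurable b) (ha1 : ∫⁻ ξ, a ξ < ⊤) (hb1 : ∫⁻ ξ, b ξ < ⊤) {A : ℝ≥0}
    (hab : ∀ ξ η, ‖K (ξ, η)‖ₑ ≤ A * (a ξ * b η)) : Integrable K :=
  ⟨hK.aestronglyMeasurable,
    (lintegral_mono fun p : V × V => hab p.1 p.2).trans_lt (lintegral_mul_prod_lt_top ha hb ha1 hb1 A)⟩

theorem lintegral_extension_sq_le_const {K : V × V → ℂ} (hK : Measurable K) {a b : V → ℝ≥0∞}
    (ha : Measurable a) (hb : Measurable b) (ha1 : ∫⁻ ξ, a ξ < ⊤) (hb1 : ∫⁻ ξ, b ξ < ⊤)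
    (ha2 : ∫⁻ ξ, a ξ ^ 2 < ⊤) (hb2 : ∫⁻ ξ, b ξ ^ 2 < ⊤) {A : ℝ≥0}
    (hab : ∀ ξ η, ‖K (ξ, η)‖ₑ ≤ A * (a ξ * b η)) {R : ℝ}
    (hR : ∀ ξ η, R < ‖ξ‖ → K (ξ, η) = 0) :
    ∫⁻ x, ‖extension K x‖ₑ ^ 2 ≤ A ^ 2 *
      (volume (Metric.closedBall (0 : V) R) * ((∫⁻ ξ, a ξ ^ 2) * ∫⁻ ξ, b ξ ^ 2)) := by
  have hA2 : ∫⁻ ξ, (A * a ξ) ^ 2 = A ^ 2 * ∫⁻ ξ, a ξ ^ 2 := by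
    simp_rw [mul_pow]
    exact lintegral_const_mul _ (ha.pow_const 2)
  refine (lintegral_extension_sq_le (integrable_of_enorm_le_mul hK ha hb ha1 hb1 hab)
    (a := fun ξ => A * a ξ) (ha.const_mul _) hb ?_ hb2 (fun ξ η => ?_) hR).trans_eq ?_
  · rw [hA2]
    exact ENNReal.mul_lt_top (ENNReal.pow_lt_top ENNReal.coe_lt_top) ha2
  · rw [mul_assoc]
    exact hab ξ η
  · rw [hA2]
    ring

theorem measurable_extension {P : Type*} [MeasurableSpace P] {K : P → V × V → ℂ}
    (hK : Measurable (Function.uncurry K)) : Measurable fun z : P × V => extension (K z.1) z.2 := by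
  have h : Measurable fun w : (P × V) × (V × V) =>
      Complex.exp ((2 * Real.pi * inner ℝ (w.2.1 + w.2.2) w.1.2 : ℝ) * Complex.I) *
        K w.1.1 w.2 := by
    refine Measurable.mul ?_ (hK.comp ((measurable_fst.comp measurable_fst).prodMk measurable_snd))
    have h2 : Continuous fun u : V × (V × V) =>
        Complex.exp ((2 * Real.pi * inner ℝ (u.2.1 + u.2.2) u.1 : ℝ) * Complex.I) := by fun_prop
    exact h2.measurable.comp ((measurable_snd.comp measurable_fst).prodMk measurable_snd)
  exact h.stronglyMeasurable.integral_prod_right'.measurable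

/-- A measurable majorant of the square of a smooth family of bilinear multipliers on a short
interval. -/
theorem exists_interval_majorant {K K' : ℝ → V × V → ℂ} (hKm : ∀ t, Measurable (K t))
    (hK'm : Measurable (Function.uncurry K')) {a b : V → ℝ≥0∞}
    (ha : Measurable a) (hb : Measurable b) (ha1 : ∫⁻ ξ, a ξ < ⊤) (hb1 : ∫⁻ ξ, b ξ < ⊤)
    (ha2 : ∫⁻ ξ, a ξ ^ 2 < ⊤) (hb2 : ∫⁻ ξ, b ξ ^ 2 < ⊤) {A A' : ℝ≥0}
    (hA : ∀ t ∈ Icc (1 : ℝ) 2, ∀ ξ η, ‖K t (ξ, η)‖ₑ ≤ A * (a ξ * b η))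
    (hA' : ∀ t ∈ Icc (1 : ℝ) 2, ∀ ξ η, ‖K' t (ξ, η)‖ₑ ≤ A' * (a ξ * b η)) {R : ℝ}
    (hR : ∀ t ξ η, R < ‖ξ‖ → K t (ξ, η) = 0) (hR' : ∀ t ξ η, R < ‖ξ‖ → K' t (ξ, η) = 0)
    (hdiff : ∀ t₀ t p, K t p - K t₀ p = ∫ s in t₀..t, K' s p)
    {t₀ : ℝ} (ht₀ : t₀ ∈ Icc (1 : ℝ) 2) (δ : ℝ≥0) :
    ∃ M : V → ℝ≥0∞, Measurable M ∧
      (∀ x, ∀ t ∈ Icc (1 : ℝ) 2, |t - t₀| ≤ δ → ‖extension (K t) x‖ₑ ^ 2 ≤ M x) ∧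
      ∫⁻ x, M x ≤ (2 * A ^ 2 + 2 * ((2 * δ) ^ 2 * A' ^ 2)) *
        (volume (Metric.closedBall (0 : V) R) * ((∫⁻ ξ, a ξ ^ 2) * ∫⁻ ξ, b ξ ^ 2)) := by
  -- The integral over `s` runs over this fixed set instead of the segment from `t₀` to `t`, which
  -- makes the majorant independent of `t`.
  set J : Set ℝ := Icc 1 2 ∩ Icc (t₀ - δ) (t₀ + δ) with hJ
  have hJm : MeasurableSet J := measurableSet_Icc.inter measurableSet_Icc
  have hJv : volume J ≤ 2 * δ := by
    refine (measure_mono inter_subset_right).trans ?_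
    rw [Real.volume_Icc, show t₀ + δ - (t₀ - δ) = ((2 * δ : ℝ≥0) : ℝ) by push_cast; ring,
      ENNReal.ofReal_coe_nnreal]
    simp
  have hint : ∀ t ∈ Icc (1 : ℝ) 2, Integrable (K t) := fun t ht =>
    integrable_of_enorm_le_mul (hKm t) ha hb ha1 hb1 (hA t ht)
  have hK't : ∀ t, Measurable (K' t) := fun t => hK'm.comp measurable_prodMk_left
  have hTm := measurable_extension hK'm
  have hT0m : Measurable (extension (K t₀)) :=
    (measurable_extension (P := Unit) (K := fun _ => K t₀) ((hKm t₀).comp measurable_snd)).comp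
      (measurable_const (a := ()).prodMk measurable_id)
  set Q := volume (Metric.closedBall (0 : V) R) * ((∫⁻ ξ, a ξ ^ 2) * ∫⁻ ξ, b ξ ^ 2) with hQ
  have hu : Measurable fun z : V × ℝ => ‖extension (K' z.2) z.1‖ₑ ^ 2 :=
    ((hTm.comp measurable_swap).enorm).pow_const 2
  refine ⟨fun x => 2 * ‖extension (K t₀) x‖ₑ ^ 2 +
    2 * (2 * δ * ∫⁻ s in J, ‖extension (K' s) x‖ₑ ^ 2), ?_, fun x t ht htδ => ?_, ?_⟩
  · exact ((hT0m.enorm.pow_const 2).const_mul _).add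
      (((hu.lintegral_prod_right').const_mul _).const_mul _)
  · have hsub : uIoc t₀ t ⊆ J := by
      intro s hs
      have h1 := uIoc_subset_uIcc hs
      refine ⟨(convex_Icc (1 : ℝ) 2).ordConnected.uIcc_subset ht₀ ht h1, ?_⟩
      have h2 : |s - t₀| ≤ |t - t₀| := abs_sub_left_of_mem_uIcc h1
      have h3 := abs_le.1 (h2.trans htδ)
      exact ⟨by linarith [h3.1], by linarith [h3.2]⟩
    have hFub : Integrable (Function.uncurry fun (s : ℝ) (p : V × V) =>
        Complex.exp ((2 * Real.pi * inner ℝ (p.1 + p.2) x : ℝ) * Complex.I) * K' s p)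
        ((volume.restrict (uIoc t₀ t)).prod volume) := by
      refine ⟨(Measurable.mul ?_ hK'm).aestronglyMeasurable, ?_⟩
      · have : Continuous fun z : ℝ × (V × V) =>
          Complex.exp ((2 * Real.pi * inner ℝ (z.2.1 + z.2.2) x : ℝ) * Complex.I) := by fun_prop
        exact this.measurable
      · refine (lintegral_prod_le _).trans_lt ?_
        have hle : ∫⁻ s in uIoc t₀ t, ∫⁻ p : V × V, ‖Function.uncurry (fun (s : ℝ) (p : V × V) =>
            Complex.exp ((2 * Real.pi * inner ℝ (p.1 + p.2) x : ℝ) * Complex.I) * K' s p)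
              (s, p)‖ₑ ≤ ∫⁻ s in uIoc t₀ t, ∫⁻ p : V × V, A' * (a p.1 * b p.2) := by
          refine setLIntegral_mono' measurableSet_uIoc fun s hs => lintegral_mono fun p => ?_
          rw [Function.uncurry_apply_pair, enorm_mul, ← ofReal_norm, norm_extension_exp,
            ENNReal.ofReal_one, one_mul]
          exact hA' s (hsub hs).1 p.1 p.2
        refine hle.trans_lt ?_
        rw [setLIntegral_const]
        exact ENNReal.mul_lt_top (lintegral_mul_prod_lt_top ha hb ha1 hb1 A')
          ((measure_mono hsub).trans_lt (hJv.trans_lt (ENNReal.mul_lt_top (by simp) (by simp))))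
    have hexp : ∀ K : V × V → ℂ, Integrable K → Integrable fun p : V × V =>
        Complex.exp ((2 * Real.pi * inner ℝ (p.1 + p.2) x : ℝ) * Complex.I) * K p := fun K hK =>
      hK.bdd_mul (c := 1) (by fun_prop) (Eventually.of_forall fun p => (norm_extension_exp p x).le)
    -- The fundamental theorem of calculus under the frequency integral; Cauchy–Schwarz in `s` then
    -- gains `|J| ≤ 2δ`, and integrating over `J` gains it again.
    have hT : extension (K t) x = extension (K t₀) x + ∫ s in t₀..t, extension (K' s) x := by
      rw [← sub_eq_iff_eq_add']
      simp only [extension]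
      rw [← integral_sub (hexp _ (hint t ht)) (hexp _ (hint t₀ ht₀)),
        intervalIntegral_integral_swap hFub]
      refine integral_congr_ae (Eventually.of_forall fun p => ?_)
      simp only
      rw [← mul_sub, hdiff, intervalIntegral.integral_const_mul]
    have hI : ‖∫ s in t₀..t, extension (K' s) x‖ₑ ^ 2 ≤
        2 * δ * ∫⁻ s in J, ‖extension (K' s) x‖ₑ ^ 2 := by
      calc ‖∫ s in t₀..t, extension (K' s) x‖ₑ ^ 2
          ≤ (∫⁻ s in J, ‖extension (K' s) x‖ₑ) ^ 2 := by
            refine pow_le_pow_left' ?_ 2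
            rw [← ofReal_norm, intervalIntegral.norm_intervalIntegral_eq, ofReal_norm]
            exact (enorm_integral_le_lintegral_enorm _).trans (lintegral_mono_set hsub)
        _ ≤ volume J * ∫⁻ s in J, ‖extension (K' s) x‖ₑ ^ 2 := by
            refine (lintegral_sq_le_measure_mul _ ?_).trans_eq ?_
            · exact ((hTm.comp (measurable_id.prodMk measurable_const)).enorm).aemeasurable
            · rw [Measure.restrict_apply_univ]
        _ ≤ _ := mul_le_mul_left hJv _
    rw [hT]
    calc ‖extension (K t₀) x + ∫ s in t₀..t, extension (K' s) x‖ₑ ^ 2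
        ≤ (‖extension (K t₀) x‖ₑ + ‖∫ s in t₀..t, extension (K' s) x‖ₑ) ^ 2 :=
          pow_le_pow_left' (enorm_add_le _ _) 2
      _ ≤ 2 * ‖extension (K t₀) x‖ₑ ^ 2 + 2 * ‖∫ s in t₀..t, extension (K' s) x‖ₑ ^ 2 := by
          have h := ENNReal.rpow_add_le_mul_rpow_add_rpow ‖extension (K t₀) x‖ₑ
            ‖∫ s in t₀..t, extension (K' s) x‖ₑ (p := 2) one_le_two
          rw [← mul_add]
          norm_num at h
          exact h
      _ ≤ _ := add_le_add le_rfl (mul_le_mul_right hI _)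
  · rw [lintegral_add_left ((hT0m.enorm.pow_const 2).const_mul _),
      lintegral_const_mul _ (hT0m.enorm.pow_const 2),
      lintegral_const_mul _ ((hu.lintegral_prod_right').const_mul _),
      lintegral_const_mul _ hu.lintegral_prod_right',
      lintegral_lintegral_swap hu.aemeasurable, add_mul]
    have h0 := lintegral_extension_sq_le_const (hKm t₀) ha hb ha1 hb1 ha2 hb2 (hA t₀ ht₀) (hR t₀)
    have h1 : ∫⁻ s in J, ∫⁻ x, ‖extension (K' s) x‖ₑ ^ 2 ≤ 2 * δ * (A' ^ 2 * Q) := by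
      calc ∫⁻ s in J, ∫⁻ x, ‖extension (K' s) x‖ₑ ^ 2 ≤ ∫⁻ s in J, A' ^ 2 * Q :=
            setLIntegral_mono' hJm fun s hs => lintegral_extension_sq_le_const (hK't s) ha hb ha1
              hb1 ha2 hb2 (hA' s hs.1) (hR' s)
        _ = A' ^ 2 * Q * volume J := setLIntegral_const _ _
        _ ≤ A' ^ 2 * Q * (2 * δ) := mul_le_mul_right hJv _
        _ = _ := mul_comm _ _
    calc (2 * ∫⁻ x, ‖extension (K t₀) x‖ₑ ^ 2) +
          2 * (2 * δ * ∫⁻ s in J, ∫⁻ x, ‖extension (K' s) x‖ₑ ^ 2)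
        ≤ 2 * (A ^ 2 * Q) + 2 * (2 * δ * (2 * δ * (A' ^ 2 * Q))) :=
          add_le_add (mul_le_mul_right h0 _) (mul_le_mul_right (mul_le_mul_right h1 _) _)
      _ = _ := by ring

/-- A measurable majorant over a set of dilations covered by `N` short intervals. -/
theorem exists_covering_majorant {K K' : ℝ → V × V → ℂ} (hKm : ∀ t, Measurable (K t))
    (hK'm : Measurable (Function.uncurry K')) {a b : V → ℝ≥0∞}
    (ha : Measurable a) (hb : Measurable b) (ha1 : ∫⁻ ξ, a ξ < ⊤) (hb1 : ∫⁻ ξ, b ξ < ⊤)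
    (ha2 : ∫⁻ ξ, a ξ ^ 2 < ⊤) (hb2 : ∫⁻ ξ, b ξ ^ 2 < ⊤) {A A' : ℝ≥0}
    (hA : ∀ t ∈ Icc (1 : ℝ) 2, ∀ ξ η, ‖K t (ξ, η)‖ₑ ≤ A * (a ξ * b η))
    (hA' : ∀ t ∈ Icc (1 : ℝ) 2, ∀ ξ η, ‖K' t (ξ, η)‖ₑ ≤ A' * (a ξ * b η)) {R : ℝ}
    (hR : ∀ t ξ η, R < ‖ξ‖ → K t (ξ, η) = 0) (hR' : ∀ t ξ η, R < ‖ξ‖ → K' t (ξ, η) = 0)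
    (hdiff : ∀ t₀ t p, K t p - K t₀ p = ∫ s in t₀..t, K' s p)
    {E : Set ℝ} (hE : E ⊆ Icc 1 2) {δ : ℝ≥0} {N : ℕ}
    (hN : ∃ c : Fin N → ℝ, E ⊆ ⋃ i, Icc (c i) (c i + δ)) :
    ∃ M : V → ℝ≥0∞, Measurable M ∧ (∀ x, ∀ t ∈ E, ‖extension (K t) x‖ₑ ^ 2 ≤ M x) ∧
      ∫⁻ x, M x ≤ N * ((2 * A ^ 2 + 2 * ((2 * δ) ^ 2 * A' ^ 2)) *
        (volume (Metric.closedBall (0 : V) R) * ((∫⁻ ξ, a ξ ^ 2) * ∫⁻ ξ, b ξ ^ 2))) := by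
  obtain ⟨c, hc⟩ := hN
  -- The base point is taken in `E` itself, since a covering interval may leave `[1, 2]`. Intervals
  -- missing `E` receive the arbitrary base point 1.
  have hch : ∀ i, ∃ t₀ ∈ Icc (1 : ℝ) 2, ∀ t ∈ E ∩ Icc (c i) (c i + δ), |t - t₀| ≤ δ := by
    intro i
    rcases (E ∩ Icc (c i) (c i + δ)).eq_empty_or_nonempty with h | ⟨t₀, h₀⟩
    · exact ⟨1, ⟨le_rfl, one_le_two⟩, by simp [h]⟩
    · exact ⟨t₀, hE h₀.1, fun t ht => by
        rw [abs_le]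
        constructor <;> linarith [ht.2.1, ht.2.2, h₀.2.1, h₀.2.2]⟩
  choose t₀ ht₀ hclose using hch
  choose M hMm hMb hMi using fun i => exists_interval_majorant hKm hK'm ha hb ha1 hb1 ha2 hb2 hA hA'
    hR hR' hdiff (ht₀ i) δ
  refine ⟨fun x => ∑ i, M i x, Finset.measurable_sum _ fun i _ => hMm i, fun x t ht => ?_, ?_⟩
  · obtain ⟨i, hi⟩ := mem_iUnion.1 (hc ht)
    exact (hMb i x t (hE ht) (hclose i t ⟨ht, hi⟩)).trans
      (Finset.single_le_sum (f := fun i => M i x) (fun _ _ => zero_le) (Finset.mem_univ i))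
  · rw [lintegral_finsetSum _ fun i _ => hMm i]
    refine (Finset.sum_le_sum fun i _ => hMi i).trans_eq ?_
    rw [Finset.sum_const, Finset.card_univ, Fintype.card_fin, nsmul_eq_mul]

end MaximalMultiplier

/-! ### Sobolev smoothing from Fourier decay -/

section SobolevSmoothingOfDecay

variable {d : ℕ}

/-- The pointwise form of the frequency decomposition, valid for every `x` because `K` is
integrable; a supremum over `t` can therefore be taken inside the sum. -/
theorem enorm_extension_le_tsum {K : Sp d × Sp d → ℂ} (hK : Integrable K)
    {s : ℕ → Set (Sp d × Sp d)} (hs : ∀ j, MeasurableSet (s j)) (hd : Pairwise (Function.onFun Disjoint s))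
    (hU : ⋃ j, s j = univ) (x : Sp d) :
    ‖extension K x‖ₑ ≤ ∑' j, ‖extension ((s j).indicator K) x‖ₑ := by
  have hint : Integrable (fun p : Sp d × Sp d =>
      Complex.exp ((2 * Real.pi * inner ℝ (p.1 + p.2) x : ℝ) * Complex.I) * K p) :=
    hK.bdd_mul (c := 1) (by fun_prop) (Eventually.of_forall fun p => (norm_extension_exp p x).le)
  have h := hasSum_integral_iUnion (μ := (volume : Measure (Sp d × Sp d))) hs hd hint.integrableOn
  rw [hU, setIntegral_univ] at h
  rw [extension, ← h.tsum_eq]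
  refine enorm_tsum_le_tsum_enorm.trans_eq (tsum_congr fun j => ?_)
  rw [extension, ← integral_indicator (hs j)]
  congr 2
  funext p
  by_cases hp : p ∈ s j <;> simp [hp]

/-- The dyadic frequency shells. -/
def shell (d : ℕ) (j : ℕ) : Set (Sp d × Sp d) :=
  {p | (2 : ℝ) ^ j ≤ 1 + ‖WithLp.toLp 2 p‖ ∧ 1 + ‖WithLp.toLp 2 p‖ < 2 ^ (j + 1)}

theorem measurableSet_shell (j : ℕ) : MeasurableSet (shell d j) := by
  have h : Continuous fun p : Sp d × Sp d => 1 + ‖WithLp.toLp 2 p‖ := by fun_prop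
  exact (measurableSet_le measurable_const h.measurable).inter
    (measurableSet_lt h.measurable measurable_const)

theorem pairwise_disjoint_shell : Pairwise (Function.onFun Disjoint (shell d)) := by
  intro i j hij
  rw [Function.onFun, Set.disjoint_left]
  rintro p ⟨h1, h2⟩ ⟨h3, h4⟩
  have h5 := (pow_lt_pow_iff_right₀ (one_lt_two (α := ℝ))).1 (h1.trans_lt h4)
  have h6 := (pow_lt_pow_iff_right₀ (one_lt_two (α := ℝ))).1 (h3.trans_lt h2)
  omega

theorem iUnion_shell : ⋃ j, shell d j = univ :=
  eq_univ_of_forall fun p => by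
    obtain ⟨j, h1, h2⟩ := exists_nat_pow_near (x := 1 + ‖WithLp.toLp 2 p‖)
      (le_add_of_nonneg_right (norm_nonneg _)) (one_lt_two (α := ℝ))
    exact mem_iUnion.2 ⟨j, h1, h2⟩

theorem norm_fst_le_of_mem_shell {j : ℕ} {p : Sp d × Sp d} (hp : p ∈ shell d j) :
    1 + ‖p.1‖ ≤ 2 ^ (j + 1) := by
  have : ‖p.1‖ ≤ ‖WithLp.toLp 2 p‖ := WithLp.norm_fst_le _ (WithLp.toLp 2 p)
  linarith [hp.2]

theorem norm_snd_le_of_mem_shell {j : ℕ} {p : Sp d × Sp d} (hp : p ∈ shell d j) :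
    1 + ‖p.2‖ ≤ 2 ^ (j + 1) := by
  have : ‖p.2‖ ≤ ‖WithLp.toLp 2 p‖ := WithLp.norm_snd_le _ (WithLp.toLp 2 p)
  linarith [hp.2]

/-- The derivative in `t` of the multiplier. -/
def multiplierDeriv (μ : Measure (Sp2 d)) (t : ℝ) (p : Sp d × Sp d) : ℂ :=
  ∫ q, waveChar (t • WithLp.toLp 2 p) q *
    (Complex.I * (-(2 * Real.pi) * inner ℝ q (WithLp.toLp 2 p) : ℝ)) ∂μ

theorem continuous_multiplier_integrand :
    Continuous fun z : (ℝ × (Sp d × Sp d)) × Sp2 d => waveChar (z.1.1 • WithLp.toLp 2 z.1.2) z.2 := by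
  unfold waveChar
  fun_prop

theorem continuous_multiplierDeriv_integrand :
    Continuous fun z : (ℝ × (Sp d × Sp d)) × Sp2 d => waveChar (z.1.1 • WithLp.toLp 2 z.1.2) z.2 *
      (Complex.I * (-(2 * Real.pi) * inner ℝ z.2 (WithLp.toLp 2 z.1.2) : ℝ)) :=
  continuous_multiplier_integrand.mul (by fun_prop)

theorem measurable_multiplier (μ : Measure (Sp2 d)) [SFinite μ] :
    Measurable (Function.uncurry (multiplier μ)) :=
  (continuous_multiplier_integrand.measurable.stronglyMeasurable.integral_prod_right'
    (ν := μ)).measurable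

theorem measurable_multiplierDeriv (μ : Measure (Sp2 d)) [SFinite μ] :
    Measurable (Function.uncurry (multiplierDeriv μ)) :=
  (continuous_multiplierDeriv_integrand.measurable.stronglyMeasurable.integral_prod_right'
    (ν := μ)).measurable

/-- Differentiation in `t` under the integral, in integrated form: Fubini and the fundamental
theorem for each character. The first moment of `μ` dominates the derivative. -/
theorem multiplier_sub {μ : Measure (Sp2 d)} [IsFiniteMeasure μ]
    (hμ : Integrable (fun q : Sp2 d => ‖q‖) μ) (t₀ t : ℝ) (p : Sp d × Sp d) :
    multiplier μ t p - multiplier μ t₀ p = ∫ s in t₀..t, multiplierDeriv μ s p := by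
  set ζ : Sp2 d := WithLp.toLp 2 p with hζ
  have hwave : ∀ t : ℝ, Integrable (fun q => waveChar (t • ζ) q) μ := fun t =>
    Integrable.of_bound (continuous_waveChar _).aestronglyMeasurable 1
      (Eventually.of_forall fun q => (norm_waveChar _ q).le)
  have hderiv : ∀ (q : Sp2 d) (s : ℝ), HasDerivAt (fun s : ℝ => waveChar (s • ζ) q)
      (waveChar (s • ζ) q * (Complex.I * (-(2 * Real.pi) * inner ℝ q ζ : ℝ))) s := by
    intro q s
    have h1 : HasDerivAt (fun s : ℝ => ((-(2 * Real.pi) * inner ℝ q (s • ζ) : ℝ) : ℂ))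
        ((-(2 * Real.pi) * inner ℝ q ζ : ℝ) : ℂ) s := by
      apply HasDerivAt.ofReal_comp
      simp_rw [inner_smul_right]
      exact (((hasDerivAt_id s).mul_const (inner ℝ q ζ)).const_mul (-(2 * Real.pi))).congr_deriv
        (by simp)
    exact (h1.const_mul Complex.I).cexp
  have hcont : Continuous fun z : ℝ × Sp2 d => waveChar (z.1 • ζ) z.2 *
      (Complex.I * (-(2 * Real.pi) * inner ℝ z.2 ζ : ℝ)) := by
    have := (continuous_multiplierDeriv_integrand (d := d)).comp
      (f := fun z : ℝ × Sp2 d => ((z.1, p), z.2)) (by fun_prop)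
    exact this
  have hFub : Integrable (Function.uncurry fun (s : ℝ) (q : Sp2 d) => waveChar (s • ζ) q *
      (Complex.I * (-(2 * Real.pi) * inner ℝ q ζ : ℝ))) ((volume.restrict (uIoc t₀ t)).prod μ) := by
    have hfin : IsFiniteMeasure ((volume : Measure ℝ).restrict (uIoc t₀ t)) :=
      ⟨by rw [Measure.restrict_apply_univ, uIoc]; exact measure_Ioc_lt_top⟩
    refine ((hμ.comp_snd (volume.restrict (uIoc t₀ t))).const_mul (2 * Real.pi * ‖ζ‖)).mono'
      hcont.aestronglyMeasurable (Eventually.of_forall fun z => ?_)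
    rw [Function.uncurry, norm_mul, norm_waveChar, one_mul, norm_mul, Complex.norm_I, one_mul,
      Complex.norm_real, norm_mul, norm_neg, Real.norm_of_nonneg Real.two_pi_pos.le,
      mul_assoc _ ‖ζ‖, mul_comm ‖ζ‖]
    exact mul_le_mul_of_nonneg_left (norm_inner_le_norm z.2 ζ) Real.two_pi_pos.le
  simp only [multiplierDeriv, multiplier]
  rw [← integral_sub (hwave t) (hwave t₀), intervalIntegral_integral_swap hFub]
  refine integral_congr_ae (Eventually.of_forall fun q => ?_)
  simp only
  rw [intervalIntegral.integral_eq_sub_of_hasDerivAt (fun s _ => hderiv q s)]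
  exact (hcont.comp (Continuous.prodMk_left q)).intervalIntegrable _ _

/-- Size of the multiplier for dilations in `[1, 2]`. -/
theorem norm_multiplier_le {μ : Measure (Sp2 d)} {κ C : ℝ} (hκ : 0 ≤ κ) (hC : 0 ≤ C)
    (h : ∀ ζ : Sp2 d, ‖∫ q : Sp2 d, waveChar ζ q ∂μ‖ ≤ C * (1 + ‖ζ‖) ^ (-κ)) {t : ℝ} (ht : 1 ≤ t) {j : ℕ}
    {p : Sp d × Sp d} (hp : p ∈ shell d j) : ‖multiplier μ t p‖ ≤ C * ((2 : ℝ) ^ (-κ)) ^ j := by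
  refine (h _).trans ?_
  gcongr
  rw [Real.rpow_pow_comm two_pos.le]
  refine Real.rpow_le_rpow_of_nonpos (by positivity) (hp.1.trans ?_) (by linarith)
  rw [norm_smul, Real.norm_of_nonneg (by linarith)]
  nlinarith [norm_nonneg (WithLp.toLp 2 p)]

/-- The derivative inserts the amplitude `⟪q, ζ⟫`, linear in `ζ`, so it keeps the decay of the
symbol and loses only `|ζ| ≤ 2^(j+1)`. -/
theorem norm_multiplierDeriv_le {μ : Measure (Sp2 d)} {κ C : ℝ} (hκ : 0 ≤ κ) (hC : 0 ≤ C)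
    (h : ∀ ζ w : Sp2 d, ‖∫ q, waveChar ζ q * (inner ℝ q w : ℝ) ∂μ‖ ≤
      C * ‖w‖ * (1 + ‖ζ‖) ^ (-κ)) {t : ℝ} (ht : 1 ≤ t) {j : ℕ}
    {p : Sp d × Sp d} (hp : p ∈ shell d j) :
    ‖multiplierDeriv μ t p‖ ≤ 2 * Real.pi * 2 ^ (j + 1) * (C * ((2 : ℝ) ^ (-κ)) ^ j) := by
  set ζ : Sp2 d := WithLp.toLp 2 p with hζ
  have h1 : multiplierDeriv μ t p = (Complex.I * (-(2 * Real.pi) : ℝ)) *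
      ∫ q, waveChar (t • ζ) q * (inner ℝ q ζ : ℝ) ∂μ := by
    rw [multiplierDeriv, ← integral_const_mul]
    refine integral_congr_ae (Eventually.of_forall fun q => ?_)
    simp only [← hζ]
    push_cast
    ring
  have h2 : (1 + ‖t • ζ‖) ^ (-κ) ≤ ((2 : ℝ) ^ (-κ)) ^ j := by
    rw [Real.rpow_pow_comm two_pos.le]
    refine Real.rpow_le_rpow_of_nonpos (by positivity) (hp.1.trans ?_) (by linarith)
    rw [norm_smul, Real.norm_of_nonneg (by linarith)]
    nlinarith [norm_nonneg ζ]
  have h3 : ‖ζ‖ ≤ 2 ^ (j + 1) := by linarith [hp.2]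
  rw [h1, norm_mul, norm_mul, Complex.norm_I, one_mul, Complex.norm_real, norm_neg,
    Real.norm_of_nonneg Real.two_pi_pos.le]
  have h4 : C * ‖ζ‖ * (1 + ‖t • ζ‖) ^ (-κ) ≤ C * 2 ^ (j + 1) * ((2 : ℝ) ^ (-κ)) ^ j := by gcongr
  have h5 := (h (t • ζ) ζ).trans h4
  calc 2 * Real.pi * ‖∫ q, waveChar (t • ζ) q * (inner ℝ q ζ : ℝ) ∂μ‖
      ≤ 2 * Real.pi * (C * 2 ^ (j + 1) * ((2 : ℝ) ^ (-κ)) ^ j) := by gcongr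
    _ = _ := by ring

/-- The Bessel weight applied to a function on the frequency side. -/
def weighted (s : ℝ) (F : Sp d → ℂ) (ξ : Sp d) : ℂ := (((1 + ‖ξ‖ ^ 2) ^ (-s / 2) : ℝ) : ℂ) * F ξ

theorem norm_le_rpow_mul_norm_weighted {s L : ℝ} (hs : 0 ≤ s) (F : Sp d → ℂ) {ξ : Sp d}
    (hξ : 1 + ‖ξ‖ ≤ L) : ‖F ξ‖ ≤ L ^ s * ‖weighted s F ξ‖ := by
  have h0 : 0 < 1 + ‖ξ‖ ^ 2 := by positivity
  have h1 : (1 + ‖ξ‖ ^ 2) ^ (s / 2) ≤ L ^ s := by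
    calc (1 + ‖ξ‖ ^ 2) ^ (s / 2) ≤ (L ^ 2) ^ (s / 2) := by
          refine Real.rpow_le_rpow h0.le ?_ (by positivity)
          nlinarith [norm_nonneg ξ]
      _ = L ^ s := by
          rw [← Real.rpow_natCast, ← Real.rpow_mul (by linarith [norm_nonneg ξ])]
          congr 1
          push_cast
          ring
  rw [weighted, norm_mul, Complex.norm_real, Real.norm_of_nonneg (Real.rpow_nonneg h0.le _),
    ← mul_assoc]
  have h2 : 1 ≤ L ^ s * (1 + ‖ξ‖ ^ 2) ^ (-s / 2) := by
    calc (1 : ℝ) = (1 + ‖ξ‖ ^ 2) ^ (s / 2) * (1 + ‖ξ‖ ^ 2) ^ (-s / 2) := by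
          rw [← Real.rpow_add h0]
          simp [neg_div]
      _ ≤ _ := by gcongr
  nlinarith [norm_nonneg (F ξ)]

theorem norm_weighted_le {s : ℝ} (hs : 0 ≤ s) (F : Sp d → ℂ) (ξ : Sp d) :
    ‖weighted s F ξ‖ ≤ ‖F ξ‖ := by
  have h0 : 1 ≤ 1 + ‖ξ‖ ^ 2 := le_add_of_nonneg_right (by positivity)
  rw [weighted, norm_mul, Complex.norm_real, Real.norm_of_nonneg (by positivity)]
  exact mul_le_of_le_one_left (norm_nonneg _)
    (Real.rpow_le_one_of_one_le_of_nonpos h0 (by linarith))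

theorem measurable_weighted (s : ℝ) (f : 𝓢(Sp d, ℂ)) :
    Measurable (weighted s (𝓕 (f : Sp d → ℂ))) := by
  refine (Complex.measurable_ofReal.comp ?_).mul (continuous_fourier_schwartz f).measurable
  exact (measurable_const.add (measurable_norm.pow_const 2)).pow_const _

theorem eLpNorm_two_eq {α : Type*} [MeasurableSpace α] (ν : Measure α) (G : α → ℂ) :
    eLpNorm G 2 ν = (∫⁻ x, ‖G x‖ₑ ^ 2 ∂ν) ^ (1 / 2 : ℝ) := by
  rw [eLpNorm_eq_lintegral_rpow_enorm_toReal two_ne_zero ENNReal.ofNat_ne_top]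
  simp

theorem eLpNorm_two_sq {α : Type*} [MeasurableSpace α] (ν : Measure α) (G : α → ℂ) :
    ∫⁻ x, ‖G x‖ₑ ^ 2 ∂ν = eLpNorm G 2 ν ^ 2 := by
  rw [eLpNorm_two_eq, ← ENNReal.rpow_natCast, ← ENNReal.rpow_mul]
  norm_num

theorem enorm_le_enorm_of_norm_le {x y : ℂ} (h : ‖x‖ ≤ ‖y‖) : ‖x‖ₑ ≤ ‖y‖ₑ := by
  rw [← ofReal_norm, ← ofReal_norm]
  exact ENNReal.ofReal_le_ofReal h

theorem lintegral_weighted_lt_top {s : ℝ} (hs : 0 ≤ s) (f : 𝓢(Sp d, ℂ)) :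
    ∫⁻ ξ, ‖weighted s (𝓕 (f : Sp d → ℂ)) ξ‖ₑ < ⊤ :=
  (lintegral_mono fun ξ => enorm_le_enorm_of_norm_le (norm_weighted_le hs _ ξ)).trans_lt
    (integrable_fourier_schwartz f).hasFiniteIntegral

theorem lintegral_weighted_sq_lt_top {s : ℝ} (hs : 0 ≤ s) (f : 𝓢(Sp d, ℂ)) :
    ∫⁻ ξ, ‖weighted s (𝓕 (f : Sp d → ℂ)) ξ‖ₑ ^ 2 < ⊤ := by
  refine (lintegral_mono fun ξ => pow_le_pow_left' (enorm_le_enorm_of_norm_le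
    (norm_weighted_le hs _ ξ)) 2).trans_lt ?_
  have h := ((𝓕 f).memLp 2 (volume : Measure (Sp d))).eLpNorm_lt_top
  rw [SchwartzMap.fourier_coe] at h
  rw [eLpNorm_two_sq]
  exact ENNReal.pow_lt_top h

end SobolevSmoothingOfDecay

/-! ### Summation over the dyadic shells -/

section SobolevSmoothingTheorem

variable {d : ℕ}

theorem measurable_multiplier_apply (μ : Measure (Sp2 d)) [SFinite μ] (t : ℝ) :
    Measurable (multiplier μ t) :=
  (measurable_multiplier μ).of_uncurry_left

theorem measurable_fourier_mul_fourier (f g : 𝓢(Sp d, ℂ)) :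
    Measurable fun p : Sp d × Sp d => 𝓕 (f : Sp d → ℂ) p.1 * 𝓕 (g : Sp d → ℂ) p.2 :=
  ((continuous_fourier_schwartz f).measurable.comp measurable_fst).mul
    ((continuous_fourier_schwartz g).measurable.comp measurable_snd)

theorem lintegral_weighted_sq (s : ℝ) (f : Sp d → ℂ) :
    ∫⁻ ξ, ‖weighted s (𝓕 f) ξ‖ₑ ^ 2 = sobolevNegNorm s f ^ 2 := by
  rw [eLpNorm_two_sq]
  rfl

/-- Sobolev smoothing for measures with Fourier decay of order `κ` and a set of dilations of
covering exponent `γ`, when `γ + d + 2 (s₁ + s₂) < 2 κ`. -/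
theorem sobolevSmoothing_of_decay {μ : Measure (Sp2 d)} [IsFiniteMeasure μ]
    (hμ : Integrable (fun q : Sp2 d => ‖q‖) μ) {κ C : ℝ} (hκ : 0 ≤ κ) (hC : 0 ≤ C)
    (h0 : ∀ ζ : Sp2 d, ‖∫ q : Sp2 d, waveChar ζ q ∂μ‖ ≤ C * (1 + ‖ζ‖) ^ (-κ))
    (h1 : ∀ ζ w : Sp2 d, ‖∫ q, waveChar ζ q * (inner ℝ q w : ℝ) ∂μ‖ ≤
      C * ‖w‖ * (1 + ‖ζ‖) ^ (-κ))
    {E : Set ℝ} (hE : E ⊆ Icc 1 2) {N : ℕ → ℕ}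
    (hN : ∀ j, ∃ c : Fin (N j) → ℝ, E ⊆ ⋃ i, Icc (c i) (c i + (1 / 2) ^ j))
    {B γ : ℝ} (hB : 0 ≤ B) (hNB : ∀ j, (N j : ℝ) ≤ B * ((2 : ℝ) ^ γ) ^ j)
    {s₁ s₂ : ℝ} (hs₁ : 0 ≤ s₁) (hs₂ : 0 ≤ s₂) (hlt : γ + d + 2 * (s₁ + s₂) < 2 * κ) :
    SobolevSmoothing μ E s₁ s₂ := by
  set v : ℝ := (volume (Metric.ball (0 : Sp d) 1)).toReal with hv
  set u : ℝ := (2 : ℝ) ^ (s₁ + s₂) with hu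
  set w : ℝ := (2 : ℝ) ^ (-κ) with hw
  set g : ℝ := (2 : ℝ) ^ γ with hg
  have hv0 : 0 ≤ v := ENNReal.toReal_nonneg
  have hu0 : 0 < u := Real.rpow_pos_of_pos two_pos _
  have hw0 : 0 < w := Real.rpow_pos_of_pos two_pos _
  have hg0 : 0 < g := Real.rpow_pos_of_pos two_pos _
  have hπ := Real.two_pi_pos
  -- The growth per shell of the squared `L²` norm: covering number, Sobolev weights and decay
  -- squared, volume of the ball. It equals `2^(γ + d + 2(s₁ + s₂) - 2κ)`.
  set θ : ℝ := g * (u ^ 2 * w ^ 2) * 2 ^ d with hθ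
  have hθ0 : 0 ≤ θ := by positivity
  have hθ1 : θ < 1 := by
    have : θ = 2 ^ (γ + d + 2 * (s₁ + s₂) - 2 * κ) := by
      rw [hθ, hg, hu, hw, ← Real.rpow_natCast 2 d, ← Real.rpow_natCast (_ ^ _) 2,
        ← Real.rpow_natCast (_ ^ _) 2, ← Real.rpow_mul two_pos.le, ← Real.rpow_mul two_pos.le,
        ← Real.rpow_add two_pos, ← Real.rpow_add two_pos, ← Real.rpow_add two_pos]
      congr 1
      push_cast
      ring
    rw [this]
    exact Real.rpow_lt_one_of_one_lt_of_neg one_lt_two (by linarith)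
  -- The factors independent of `j`; the second summand, from the derivative, has `2 · 2^(-j) · 2π ·
  -- 2^(j+1) = 4 · 2π`.
  set D : ℝ := B * ((2 + 2 * (4 * (2 * Real.pi)) ^ 2) * (C * u) ^ 2) * (2 ^ d * v) with hD
  have hD0 : 0 ≤ D := by positivity
  set c : ℝ≥0∞ := ∑' j : ℕ, ENNReal.ofReal (Real.sqrt D * Real.sqrt θ ^ j) with hc
  have hctop : c ≠ ⊤ := by
    have hs : Summable fun j : ℕ => Real.sqrt D * Real.sqrt θ ^ j :=
      (summable_geometric_of_lt_one (Real.sqrt_nonneg _)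
        ((Real.sqrt_lt' one_pos).2 (by simpa using hθ1))).mul_left _
    exact hs.tsum_ofReal_ne_top
  refine ⟨c.toNNReal, fun f₁ f₂ => ?_⟩
  rw [ENNReal.coe_toNNReal hctop]
  set F := 𝓕 (f₁ : Sp d → ℂ) with hF
  set G := 𝓕 (f₂ : Sp d → ℂ) with hG
  set a : Sp d → ℝ≥0∞ := fun ξ => ‖weighted s₁ F ξ‖ₑ with ha
  set b : Sp d → ℝ≥0∞ := fun ξ => ‖weighted s₂ G ξ‖ₑ with hb
  have ham : Measurable a := (measurable_weighted s₁ f₁).enorm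
  have hbm : Measurable b := (measurable_weighted s₂ f₂).enorm
  have ha1 : ∫⁻ ξ, a ξ < ⊤ := lintegral_weighted_lt_top hs₁ f₁
  have hb1 : ∫⁻ ξ, b ξ < ⊤ := lintegral_weighted_lt_top hs₂ f₂
  have ha2 : ∫⁻ ξ, a ξ ^ 2 < ⊤ := lintegral_weighted_sq_lt_top hs₁ f₁
  have hb2 : ∫⁻ ξ, b ξ ^ 2 < ⊤ := lintegral_weighted_sq_lt_top hs₂ f₂
  have hX : ∫⁻ ξ, a ξ ^ 2 = sobolevNegNorm s₁ f₁ ^ 2 := lintegral_weighted_sq s₁ f₁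
  have hY : ∫⁻ ξ, b ξ ^ 2 = sobolevNegNorm s₂ f₂ ^ 2 := lintegral_weighted_sq s₂ f₂
  generalize sobolevNegNorm s₁ f₁ = X at hX ⊢
  generalize sobolevNegNorm s₂ f₂ = Y at hY ⊢
  set K₀ : ℝ → Sp d × Sp d → ℂ := fun t p => F p.1 * G p.2 * multiplier μ t p with hK₀
  set K : ℕ → ℝ → Sp d × Sp d → ℂ := fun j t => (shell d j).indicator (K₀ t) with hK
  set K' : ℕ → ℝ → Sp d × Sp d → ℂ := fun j t =>
    (shell d j).indicator fun p => F p.1 * G p.2 * multiplierDeriv μ t p with hK'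
  have hFG : Measurable fun p : Sp d × Sp d => F p.1 * G p.2 :=
    measurable_fourier_mul_fourier f₁ f₂
  have hK₀m : ∀ t, Measurable (K₀ t) := fun t => hFG.mul (measurable_multiplier_apply μ t)
  have hKm : ∀ j t, Measurable (K j t) := fun j t => (hK₀m t).indicator (measurableSet_shell j)
  have hK'm : ∀ j, Measurable (Function.uncurry (K' j)) := fun j => by
    have h2 : Measurable fun z : ℝ × (Sp d × Sp d) =>
        F z.2.1 * G z.2.2 * multiplierDeriv μ z.1 z.2 :=
      (hFG.comp measurable_snd).mul (measurable_multiplierDeriv μ)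
    exact h2.indicator (measurable_snd (measurableSet_shell j))
  have hAr : ∀ j, 0 ≤ C * u ^ (j + 1) * w ^ j := fun j => by positivity
  set A : ℕ → ℝ≥0 := fun j => ⟨C * u ^ (j + 1) * w ^ j, hAr j⟩ with hA
  set A' : ℕ → ℝ≥0 := fun j => ⟨2 * Real.pi * 2 ^ (j + 1) * (C * u ^ (j + 1) * w ^ j),
    mul_nonneg (by positivity) (hAr j)⟩ with hA'
  -- On the shell both `1 + |ξ|` and `1 + |η|` are at most `2^(j+1)`, so removing the Bessel weights
  -- costs `2^((j+1)(s₁ + s₂)) = u^(j+1)`.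
  have hbase : ∀ (j : ℕ) (m : ℂ) (c : ℝ≥0) (p : Sp d × Sp d), p ∈ shell d j →
      ‖m‖ * u ^ (j + 1) ≤ c → ‖F p.1 * G p.2 * m‖ₑ ≤ c * (a p.1 * b p.2) := by
    intro j m c p hp hm
    have h2 := norm_le_rpow_mul_norm_weighted hs₁ F (norm_fst_le_of_mem_shell hp)
    have h3 := norm_le_rpow_mul_norm_weighted hs₂ G (norm_snd_le_of_mem_shell hp)
    have h4 : ‖F p.1 * G p.2 * m‖ ≤ c * (‖weighted s₁ F p.1‖ * ‖weighted s₂ G p.2‖) := by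
      have h5 : u ^ (j + 1) = ((2 : ℝ) ^ (j + 1)) ^ s₁ * ((2 : ℝ) ^ (j + 1)) ^ s₂ := by
        rw [hu, Real.rpow_pow_comm two_pos.le, Real.rpow_add (by positivity)]
      calc ‖F p.1 * G p.2 * m‖ = ‖F p.1‖ * ‖G p.2‖ * ‖m‖ := by rw [norm_mul, norm_mul]
        _ ≤ (((2 : ℝ) ^ (j + 1)) ^ s₁ * ‖weighted s₁ F p.1‖) *
            (((2 : ℝ) ^ (j + 1)) ^ s₂ * ‖weighted s₂ G p.2‖) * ‖m‖ := by gcongr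
        _ = (‖m‖ * u ^ (j + 1)) * (‖weighted s₁ F p.1‖ * ‖weighted s₂ G p.2‖) := by
            rw [h5]
            ring
        _ ≤ _ := by gcongr
    rw [ha, hb]
    simp only
    rw [← ofReal_norm, ← ofReal_norm, ← ofReal_norm, ← ENNReal.ofReal_coe_nnreal,
      ← ENNReal.ofReal_mul (norm_nonneg _), ← ENNReal.ofReal_mul c.coe_nonneg]
    exact ENNReal.ofReal_le_ofReal h4
  have hKb : ∀ j, ∀ t ∈ Icc (1 : ℝ) 2, ∀ ξ η, ‖K j t (ξ, η)‖ₑ ≤ A j * (a ξ * b η) := by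
    intro j t ht ξ η
    by_cases hp : (ξ, η) ∈ shell d j
    · simp only [hK, indicator_of_mem hp, hK₀]
      refine hbase j _ (A j) (ξ, η) hp ?_
      have := norm_multiplier_le hκ hC h0 ht.1 hp
      calc ‖multiplier μ t (ξ, η)‖ * u ^ (j + 1) ≤ C * w ^ j * u ^ (j + 1) := by gcongr
        _ = C * u ^ (j + 1) * w ^ j := by ring
    · simp [hK, indicator_of_notMem hp]
  have hKb' : ∀ j, ∀ t ∈ Icc (1 : ℝ) 2, ∀ ξ η, ‖K' j t (ξ, η)‖ₑ ≤ A' j * (a ξ * b η) := by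
    intro j t ht ξ η
    by_cases hp : (ξ, η) ∈ shell d j
    · simp only [hK', indicator_of_mem hp]
      refine hbase j _ (A' j) (ξ, η) hp ?_
      have := norm_multiplierDeriv_le hκ hC h1 ht.1 hp
      calc ‖multiplierDeriv μ t (ξ, η)‖ * u ^ (j + 1)
          ≤ 2 * Real.pi * 2 ^ (j + 1) * (C * w ^ j) * u ^ (j + 1) := by gcongr
        _ = 2 * Real.pi * 2 ^ (j + 1) * (C * u ^ (j + 1) * w ^ j) := by ring
    · simp [hK', indicator_of_notMem hp]
  have hout : ∀ (j : ℕ) (ξ η : Sp d), (2 : ℝ) ^ (j + 1) < ‖ξ‖ → (ξ, η) ∉ shell d j := by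
    intro j ξ η h hp
    have : 1 + ‖ξ‖ ≤ 2 ^ (j + 1) := norm_fst_le_of_mem_shell (p := (ξ, η)) hp
    linarith
  have hmaj : ∀ j, ∃ M : Sp d → ℝ≥0∞, Measurable M ∧
      (∀ x, ∀ t ∈ E, ‖extension (K j t) x‖ₑ ^ 2 ≤ M x) ∧
      ∫⁻ x, M x ≤ ENNReal.ofReal (D * θ ^ j) * (X ^ 2 * Y ^ 2) := by
    intro j
    have hR : ∀ t ξ η, (2 : ℝ) ^ (j + 1) < ‖ξ‖ → K j t (ξ, η) = 0 := fun t ξ η h =>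
      indicator_of_notMem (hout j ξ η h) _
    have hR' : ∀ t ξ η, (2 : ℝ) ^ (j + 1) < ‖ξ‖ → K' j t (ξ, η) = 0 := fun t ξ η h =>
      indicator_of_notMem (hout j ξ η h) _
    have hdiff : ∀ t₀ t p, K j t p - K j t₀ p = ∫ s in t₀..t, K' j s p := fun t₀ t p => by
      by_cases hp : p ∈ shell d j
      · simp only [hK, hK', indicator_of_mem hp, hK₀]
        rw [← mul_sub, multiplier_sub hμ, intervalIntegral.integral_const_mul]
      · simp [hK, hK', indicator_of_notMem hp]
    have hcov : ∃ c : Fin (N j) → ℝ, E ⊆ ⋃ i, Icc (c i) (c i + ((1 / 2) ^ j : ℝ≥0)) := by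
      simpa using hN j
    obtain ⟨M, hMm, hMb, hMi⟩ := exists_covering_majorant (K := K j) (K' := K' j) (a := a) (b := b)
      (A := A j) (A' := A' j) (hKm j) (hK'm j) ham hbm ha1 hb1 ha2 hb2 (hKb j) (hKb' j) hR hR'
      hdiff hE hcov
    refine ⟨M, hMm, hMb, hMi.trans ?_⟩
    rw [hX, hY, Measure.addHaar_closedBall _ _ (by positivity), finrank_euclideanSpace,
      Fintype.card_fin, ← ENNReal.ofReal_toReal (measure_ball_lt_top (μ := volume)
        (x := (0 : Sp d)) (r := 1)).ne, ← hv, ← ENNReal.ofReal_mul (by positivity)]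
    have hcoef : (N j : ℝ≥0∞) * (2 * (A j : ℝ≥0∞) ^ 2 + 2 * ((2 * (((1 / 2) ^ j : ℝ≥0) : ℝ≥0∞)) ^ 2 *
        (A' j : ℝ≥0∞) ^ 2)) = ENNReal.ofReal (N j * (2 * (A j : ℝ) ^ 2 +
          2 * ((2 * (1 / 2) ^ j) ^ 2 * (A' j : ℝ) ^ 2))) := by
      have : (N j * (2 * (A j : ℝ) ^ 2 + 2 * ((2 * (1 / 2) ^ j) ^ 2 * (A' j : ℝ) ^ 2)) : ℝ) =
          ((N j * (2 * (A j) ^ 2 + 2 * ((2 * (1 / 2) ^ j) ^ 2 * (A' j) ^ 2)) : ℝ≥0) : ℝ) := by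
        push_cast
        rfl
      rw [this, ENNReal.ofReal_coe_nnreal]
      push_cast
      rfl
    rw [← mul_assoc, ← mul_assoc, hcoef, ← ENNReal.ofReal_mul (by positivity)]
    refine mul_le_mul_left (ENNReal.ofReal_le_ofReal ?_) _
    -- The length `2^(-j)` of the intervals cancels the factor `2^(j+1)` of the derivative.
    have hδ : ((2 : ℝ) * (1 / 2) ^ j) ^ 2 * (A' j : ℝ) ^ 2 =
        (4 * (2 * Real.pi)) ^ 2 * (C * u ^ (j + 1) * w ^ j) ^ 2 := by
      change ((2 : ℝ) * (1 / 2) ^ j) ^ 2 *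
        (2 * Real.pi * 2 ^ (j + 1) * (C * u ^ (j + 1) * w ^ j)) ^ 2 = _
      have : ((1 : ℝ) / 2) ^ j * 2 ^ (j + 1) = 2 := by
        rw [pow_succ, ← mul_assoc, ← mul_pow]
        norm_num
      calc _ = (2 * (((1 : ℝ) / 2) ^ j * 2 ^ (j + 1)) * (2 * Real.pi)) ^ 2 *
            (C * u ^ (j + 1) * w ^ j) ^ 2 := by ring
        _ = _ := by
            rw [this]
            norm_num
    rw [hδ]
    change (N j : ℝ) * (2 * (C * u ^ (j + 1) * w ^ j) ^ 2 + _) * _ ≤ _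
    calc (N j : ℝ) * (2 * (C * u ^ (j + 1) * w ^ j) ^ 2 +
          2 * ((4 * (2 * Real.pi)) ^ 2 * (C * u ^ (j + 1) * w ^ j) ^ 2)) *
          (((2 : ℝ) ^ (j + 1)) ^ d * v)
        ≤ (B * g ^ j) * (2 * (C * u ^ (j + 1) * w ^ j) ^ 2 +
          2 * ((4 * (2 * Real.pi)) ^ 2 * (C * u ^ (j + 1) * w ^ j) ^ 2)) *
          (((2 : ℝ) ^ (j + 1)) ^ d * v) := by
          have := hNB j
          gcongr
      _ = D * θ ^ j := by
          rw [hD, hθ, ← pow_mul, mul_comm (j + 1) d, pow_mul, pow_succ _ j]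
          simp only [mul_pow]
          ring
  choose M hMm hMb hMi using hmaj
  -- The measurable majorants of the shells replace the supremum over `E`, whose measurability is
  -- thus never needed; Minkowski is applied to them.
  have hpoint : ∀ x, maximal μ E f₁ f₂ x ≤ ∑' j, M j x ^ (1 / 2 : ℝ) := by
    intro x
    refine iSup₂_le fun t ht => ?_
    have hint : Integrable (K₀ t) := by
      have hFGi : Integrable fun p : Sp d × Sp d => F p.1 * G p.2 :=
        (integrable_fourier_schwartz f₁).mul_prod (integrable_fourier_schwartz f₂)
      refine hFGi.mul_bdd (c := C) (measurable_multiplier_apply μ t).aestronglyMeasurable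
        (Eventually.of_forall fun p => ?_)
      refine (h0 _).trans (mul_le_of_le_one_right hC ?_)
      exact Real.rpow_le_one_of_one_le_of_nonpos (le_add_of_nonneg_right (norm_nonneg _))
        (by linarith)
    rw [average_eq_extension]
    refine (enorm_extension_le_tsum hint measurableSet_shell pairwise_disjoint_shell
      iUnion_shell x).trans (ENNReal.tsum_le_tsum fun j => ?_)
    have h2 := ENNReal.rpow_le_rpow (hMb j x t ht) (z := 1 / 2) (by norm_num)
    rwa [← ENNReal.rpow_natCast, ← ENNReal.rpow_mul, Nat.cast_ofNat, mul_one_div_cancel two_ne_zero,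
      ENNReal.rpow_one] at h2
  calc maximalL2 μ E f₁ f₂ ≤ (∫⁻ x, (∑' j, M j x ^ (1 / 2 : ℝ)) ^ 2) ^ (1 / 2 : ℝ) := by
        refine ENNReal.rpow_le_rpow (lintegral_mono fun x => ?_) (by norm_num)
        exact pow_le_pow_left' (hpoint x) 2
    _ ≤ ∑' j, (∫⁻ x, (M j x ^ (1 / 2 : ℝ)) ^ 2) ^ (1 / 2 : ℝ) :=
        lintegral_tsum_sq_rpow_le _ fun j => (hMm j).pow_const _
    _ ≤ ∑' j, ENNReal.ofReal (Real.sqrt D * Real.sqrt θ ^ j) * (X * Y) := by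
        refine ENNReal.tsum_le_tsum fun j => ?_
        have h2 : ∀ x, (M j x ^ (1 / 2 : ℝ)) ^ 2 = M j x := fun x => by
          rw [← ENNReal.rpow_natCast, ← ENNReal.rpow_mul]
          norm_num
        simp_rw [h2]
        refine (ENNReal.rpow_le_rpow (hMi j) (by norm_num)).trans_eq ?_
        have h3 : D * θ ^ j = (Real.sqrt D * Real.sqrt θ ^ j) ^ 2 := by
          rw [mul_pow (Real.sqrt D), Real.sq_sqrt hD0, ← pow_mul, mul_comm j 2, pow_mul, Real.sq_sqrt hθ0]
        rw [h3, ENNReal.ofReal_pow (by positivity), ← mul_pow, ← mul_pow, ← ENNReal.rpow_natCast,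
          ← ENNReal.rpow_mul]
        norm_num
    _ = c * X * Y := by rw [ENNReal.tsum_mul_right, mul_assoc]

end SobolevSmoothingTheorem

/-! ### Covering numbers and Minkowski dimension -/

section Covering

variable {E : Set ℝ}

theorem exists_cover_of_subset_Icc (hE : E ⊆ Icc 1 2) {δ : ℝ} (hδ : 0 < δ) :
    ∃ a : Fin (⌊1 / δ⌋₊ + 1) → ℝ, E ⊆ ⋃ i, Icc (a i) (a i + δ) := by
  refine ⟨fun i => 1 + i * δ, fun t ht => mem_iUnion.2 ?_⟩
  obtain ⟨h1, h2⟩ := hE ht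
  have h0 : 0 ≤ (t - 1) / δ := div_nonneg (by linarith) hδ.le
  have hle : ⌊(t - 1) / δ⌋₊ ≤ ⌊1 / δ⌋₊ := Nat.floor_mono (by gcongr; linarith)
  refine ⟨⟨⌊(t - 1) / δ⌋₊, by omega⟩, ?_, ?_⟩
  · have := (le_div_iff₀ hδ).1 (Nat.floor_le h0)
    dsimp only
    linarith
  · have := (div_lt_iff₀ hδ).1 (Nat.lt_floor_add_one ((t - 1) / δ))
    dsimp only
    linarith

theorem exists_cover_coveringCount (hE : E ⊆ Icc 1 2) {δ : ℝ} (hδ : 0 < δ) :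
    ∃ a : Fin (coveringCount E δ) → ℝ, E ⊆ ⋃ i, Icc (a i) (a i + δ) :=
  Nat.sInf_mem (s := {n : ℕ | ∃ a : Fin n → ℝ, E ⊆ ⋃ i, Icc (a i) (a i + δ)})
    ⟨_, exists_cover_of_subset_Icc hE hδ⟩

theorem coveringCount_le (hE : E ⊆ Icc 1 2) {δ : ℝ} (hδ : 0 < δ) :
    (coveringCount E δ : ℝ) ≤ 1 / δ + 1 := by
  have h : coveringCount E δ ≤ ⌊1 / δ⌋₊ + 1 := Nat.sInf_le (exists_cover_of_subset_Icc hE hδ)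
  have h2 : (⌊1 / δ⌋₊ : ℝ) ≤ 1 / δ := Nat.floor_le (by positivity)
  have h3 : (coveringCount E δ : ℝ) ≤ (⌊1 / δ⌋₊ : ℝ) + 1 := by exact_mod_cast h
  linarith

/-- An arithmetic progression of step `δ` gives `N(E, δ) ≤ 1/δ + 1 ≤ 2/δ`, and `log 2` is negligible
against `log (1/δ)`. -/
theorem upperMinkowskiDim_le_one (hE : E ⊆ Icc 1 2) {β : ℝ}
    (hβ : upperMinkowskiDim E = (β : EReal)) : β ≤ 1 := by
  refine le_of_forall_pos_le_add fun ε hε => ?_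
  rw [← EReal.coe_le_coe_iff, ← hβ]
  refine limsup_le_of_le (by isBoundedDefault) ?_
  have hlog : Tendsto (fun δ : ℝ => Real.log (1 / δ)) (𝓝[>] 0) atTop := by
    simp_rw [one_div]
    exact Real.tendsto_log_atTop.comp tendsto_inv_nhdsGT_zero
  filter_upwards [hlog.eventually_ge_atTop (Real.log 2 / ε), hlog.eventually_gt_atTop 0,
    self_mem_nhdsWithin, Ioo_mem_nhdsGT one_pos] with δ h1 h2 h3 h4
  rw [EReal.coe_le_coe_iff, div_le_iff₀ h2]
  have hδ : (0 : ℝ) < δ := h3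
  have h5 : (1 : ℝ) ≤ 1 / δ := (one_le_div hδ).2 h4.2.le
  have h6 : (coveringCount E δ : ℝ) ≤ 2 * (1 / δ) := (coveringCount_le hE hδ).trans (by linarith)
  have h7 : Real.log (coveringCount E δ) ≤ Real.log 2 + Real.log (1 / δ) := by
    rw [← Real.log_mul two_ne_zero (by positivity)]
    rcases Nat.eq_zero_or_pos (coveringCount E δ) with h | h
    · rw [h, Nat.cast_zero, Real.log_zero]
      exact Real.log_nonneg (by linarith)
    · exact Real.log_le_log (by exact_mod_cast h) h6
  have h8 := (div_le_iff₀ hε).1 h1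
  linarith

/-- The limsup gives the power bound for all small dyadic scales; the finitely many remaining ones
go into the constant `B`. -/
theorem exists_coveringCount_le {β γ : ℝ} (hβ : upperMinkowskiDim E = (β : EReal)) (hγ : β < γ) :
    ∃ B, 0 ≤ B ∧ ∀ j : ℕ, (coveringCount E ((1 / 2) ^ j) : ℝ) ≤ B * ((2 : ℝ) ^ γ) ^ j := by
  have hlim : limsup (fun δ : ℝ => ((Real.log (coveringCount E δ) / Real.log (1 / δ) : ℝ) : EReal))
      (𝓝[>] 0) < (γ : EReal) := by
    refine lt_of_eq_of_lt ?_ (EReal.coe_lt_coe_iff.2 hγ)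
    exact hβ
  have hev := eventually_lt_of_limsup_lt hlim
  have hpow : Tendsto (fun j : ℕ => ((1 : ℝ) / 2) ^ j) atTop (𝓝[>] 0) :=
    tendsto_nhdsWithin_iff.2 ⟨tendsto_pow_atTop_nhds_zero_of_lt_one (by norm_num) (by norm_num),
      Eventually.of_forall fun j => by simp⟩
  obtain ⟨J, hJ⟩ := eventually_atTop.1 (hpow.eventually hev)
  set g : ℝ := (2 : ℝ) ^ γ with hg
  have hg0 : 0 < g := Real.rpow_pos_of_pos two_pos _
  have hsum : ∀ j, 0 ≤ (coveringCount E ((1 / 2) ^ j) : ℝ) / g ^ j := fun j => by positivity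
  refine ⟨1 + ∑ j ∈ Finset.range (J + 1), (coveringCount E ((1 / 2) ^ j) : ℝ) / g ^ j,
    add_nonneg zero_le_one (Finset.sum_nonneg fun j _ => hsum j), fun j => ?_⟩
  rw [← div_le_iff₀ (by positivity)]
  -- Splitting at `J + 1` rather than `J` ensures `j > 0`, hence a positive `log (1/δ)`, in the
  -- second case.
  rcases lt_or_ge j (J + 1) with h | h
  · have := Finset.single_le_sum (f := fun j : ℕ => (coveringCount E ((1 / 2) ^ j) : ℝ) / g ^ j)
      (fun j _ => hsum j) (Finset.mem_range.2 h)
    linarith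
  · have h1 := hJ j (by omega)
    have h2 : (coveringCount E ((1 / 2) ^ j) : ℝ) ≤ g ^ j := by
      rcases Nat.eq_zero_or_pos (coveringCount E ((1 / 2) ^ j)) with h0 | h0
      · rw [h0, Nat.cast_zero]
        positivity
      · have hj : (0 : ℝ) < j := by exact_mod_cast (by omega : 0 < j)
        have hl : Real.log (1 / (1 / 2) ^ j) = j * Real.log 2 := by
          rw [one_div, ← inv_pow, Real.log_pow]
          norm_num
        rw [EReal.coe_lt_coe_iff, hl, div_lt_iff₀ (by have := Real.log_pos one_lt_two; positivity)]
          at h1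
        rw [← Real.log_le_log_iff (by exact_mod_cast h0) (by positivity), Real.log_pow,
          Real.log_rpow two_pos]
        linarith
    have h3 : (coveringCount E ((1 / 2) ^ j) : ℝ) / g ^ j ≤ 1 := div_le_one_of_le₀ h2 (by positivity)
    have h4 : 0 ≤ ∑ j ∈ Finset.range (J + 1), (coveringCount E ((1 / 2) ^ j) : ℝ) / g ^ j :=
      Finset.sum_nonneg fun j _ => hsum j
    linarith

end Covering

/-! ### Sobolev smoothing implies the continuity estimates -/

section Continuity

variable {d : ℕ} {μ : Measure (Sp2 d)} {E : Set ℝ}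

/-- The difference `f - τ_h f` as a Schwartz function. -/
def translateDiff (h : Sp d) (f : 𝓢(Sp d, ℂ)) : 𝓢(Sp d, ℂ) := f - SchwartzMap.compSubConstCLM ℂ h f

theorem coe_translateDiff (h : Sp d) (f : 𝓢(Sp d, ℂ)) :
    (translateDiff h f : Sp d → ℂ) = f - translate h f := rfl

theorem fourier_sub_translate (h : Sp d) (f : 𝓢(Sp d, ℂ)) (ξ : Sp d) :
    𝓕 ((f : Sp d → ℂ) - translate h f) ξ =
      (1 - Complex.exp (((-(2 * Real.pi * inner ℝ h ξ) : ℝ) : ℂ) * Complex.I)) *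
        𝓕 (f : Sp d → ℂ) ξ := by
  have hint : ∀ g : 𝓢(Sp d, ℂ), Integrable fun v : Sp d =>
      Complex.exp (((-2 * Real.pi * inner ℝ v ξ : ℝ) : ℂ) * Complex.I) * g v := fun g =>
    g.integrable.bdd_mul (c := 1) (by fun_prop)
      (Eventually.of_forall fun v => (Complex.norm_exp_ofReal_mul_I _).le)
  have hint' : Integrable fun v : Sp d => Complex.exp (((-2 * Real.pi * inner ℝ v ξ : ℝ) : ℂ) *
      Complex.I) * translate h f v := hint (SchwartzMap.compSubConstCLM ℂ h f)
  have htr : ∫ v : Sp d, Complex.exp (((-2 * Real.pi * inner ℝ v ξ : ℝ) : ℂ) * Complex.I) *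
      translate h f v = Complex.exp (((-(2 * Real.pi * inner ℝ h ξ) : ℝ) : ℂ) * Complex.I) *
        ∫ v : Sp d, Complex.exp (((-2 * Real.pi * inner ℝ v ξ : ℝ) : ℂ) * Complex.I) * f v := by
    rw [← integral_add_right_eq_self _ h, ← integral_const_mul]
    refine integral_congr_ae (Eventually.of_forall fun v => ?_)
    simp only [translate, add_sub_cancel_right]
    rw [← mul_assoc, ← Complex.exp_add, inner_add_left]
    congr 2
    push_cast
    ring
  rw [Real.fourier_eq', Real.fourier_eq', sub_mul, one_mul]
  simp only [smul_eq_mul, Pi.sub_apply, mul_sub]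
  rw [integral_sub (hint f) hint', htr]

/-- Interpolates between the bound `|θ|`, used for `|θ| ≤ 1`, and the trivial bound 2. -/
theorem norm_one_sub_exp_le {s : ℝ} (hs : 0 ≤ s) (hs1 : s ≤ 1) (θ : ℝ) :
    ‖1 - Complex.exp ((θ : ℂ) * Complex.I)‖ ≤ 2 * |θ| ^ s := by
  rcases le_or_gt |θ| 1 with h | h
  · have h1 : ‖1 - Complex.exp ((θ : ℂ) * Complex.I)‖ ≤ |θ| := by
      rw [norm_sub_rev, mul_comm]
      exact Real.norm_exp_I_mul_ofReal_sub_one_le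
    have h2 : |θ| ≤ |θ| ^ s := by
      rcases (abs_nonneg θ).eq_or_lt with h0 | h0
      · rw [← h0]
        exact Real.rpow_nonneg le_rfl _
      · simpa using Real.rpow_le_rpow_of_exponent_ge h0 h hs1
    linarith [Real.rpow_nonneg (abs_nonneg θ) s]
  · have h1 : ‖1 - Complex.exp ((θ : ℂ) * Complex.I)‖ ≤ 1 + 1 := by
      refine (norm_sub_le _ _).trans ?_
      rw [Complex.norm_exp_ofReal_mul_I, norm_one]
    have h2 : 1 ≤ |θ| ^ s := Real.one_le_rpow h.le hs
    linarith

theorem sobolevNegNorm_zero (f : 𝓢(Sp d, ℂ)) : sobolevNegNorm 0 f = eLpNorm f 2 volume := by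
  have h : (fun ξ : Sp d => (((1 + ‖ξ‖ ^ 2) ^ (-(0 : ℝ) / 2) : ℝ) : ℂ) * 𝓕 (f : Sp d → ℂ) ξ) =
      𝓕 (f : Sp d → ℂ) := by
    funext ξ
    simp
  rw [sobolevNegNorm, h]
  exact eLpNorm_fourier_eq f.integrable (f.memLp 2)

/-- The difference has Fourier multiplier of size at most `2 (2π |h| |ξ|)^s`, and the Bessel weight
absorbs `|ξ|^s`. -/
theorem sobolevNegNorm_sub_translate_le {s : ℝ} (hs : 0 ≤ s) (hs1 : s ≤ 1) (h : Sp d)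
    (f : 𝓢(Sp d, ℂ)) :
    sobolevNegNorm s ((f : Sp d → ℂ) - translate h f) ≤
      ENNReal.ofReal (2 * (2 * Real.pi) ^ s) * ENNReal.ofReal (‖h‖ ^ s) * eLpNorm f 2 volume := by
  have hpt : ∀ ξ : Sp d, ‖(((1 + ‖ξ‖ ^ 2) ^ (-s / 2) : ℝ) : ℂ) *
      𝓕 ((f : Sp d → ℂ) - translate h f) ξ‖ ≤
      (2 * (2 * Real.pi) ^ s * ‖h‖ ^ s) * ‖𝓕 (f : Sp d → ℂ) ξ‖ := by
    intro ξ
    have hw : (0 : ℝ) < 1 + ‖ξ‖ ^ 2 := by positivity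
    rw [fourier_sub_translate, norm_mul, norm_mul, Complex.norm_real,
      Real.norm_of_nonneg (by positivity), ← mul_assoc]
    refine mul_le_mul_of_nonneg_right ?_ (norm_nonneg _)
    have h1 := norm_one_sub_exp_le hs hs1 (-(2 * Real.pi * inner ℝ h ξ))
    have h2 : |-(2 * Real.pi * inner ℝ h ξ)| ≤ 2 * Real.pi * ‖h‖ * ‖ξ‖ := by
      rw [abs_neg, abs_mul, abs_of_pos Real.two_pi_pos, mul_assoc (2 * Real.pi)]
      exact mul_le_mul_of_nonneg_left (abs_real_inner_le_norm h ξ) Real.two_pi_pos.le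
    have h3 : ‖ξ‖ ^ s ≤ (1 + ‖ξ‖ ^ 2) ^ (s / 2) := by
      calc ‖ξ‖ ^ s = (‖ξ‖ ^ 2) ^ (s / 2) := by
            rw [← Real.rpow_natCast, ← Real.rpow_mul (norm_nonneg _)]
            congr 1
            push_cast
            ring
        _ ≤ _ := Real.rpow_le_rpow (by positivity) (by linarith) (by positivity)
    have h4 : (1 + ‖ξ‖ ^ 2) ^ (-s / 2) * (1 + ‖ξ‖ ^ 2) ^ (s / 2) = 1 := by
      rw [← Real.rpow_add hw]
      simp [neg_div]
    calc (1 + ‖ξ‖ ^ 2) ^ (-s / 2) *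
          ‖1 - Complex.exp (((-(2 * Real.pi * inner ℝ h ξ) : ℝ) : ℂ) * Complex.I)‖
        ≤ (1 + ‖ξ‖ ^ 2) ^ (-s / 2) * (2 * (2 * Real.pi * ‖h‖ * ‖ξ‖) ^ s) := by
          refine mul_le_mul_of_nonneg_left (h1.trans ?_) (by positivity)
          gcongr
      _ = 2 * (2 * Real.pi) ^ s * ‖h‖ ^ s * ((1 + ‖ξ‖ ^ 2) ^ (-s / 2) * ‖ξ‖ ^ s) := by
          rw [Real.mul_rpow (by positivity) (norm_nonneg _),
            Real.mul_rpow Real.two_pi_pos.le (norm_nonneg _)]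
          ring
      _ ≤ 2 * (2 * Real.pi) ^ s * ‖h‖ ^ s *
          ((1 + ‖ξ‖ ^ 2) ^ (-s / 2) * (1 + ‖ξ‖ ^ 2) ^ (s / 2)) := by gcongr
      _ = _ := by rw [h4, mul_one]
  have h5 := eLpNorm_le_mul_eLpNorm_of_ae_le_mul
    (Eventually.of_forall hpt : ∀ᵐ ξ ∂(volume : Measure (Sp d)), _) 2
  rw [sobolevNegNorm]
  refine h5.trans_eq ?_
  rw [eLpNorm_fourier_eq f.integrable (f.memLp 2), ENNReal.ofReal_mul (by positivity)]

/-- All `s` derivatives of smoothing are spent on the differenced input; the other is measured in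
`L²` by Plancherel. -/
theorem SobolevSmoothing.continuityOneInput {s : ℝ} (hs : 0 < s) (hs1 : s ≤ 1)
    (h₁ : SobolevSmoothing μ E s 0) (h₂ : SobolevSmoothing μ E 0 s) : ContinuityOneInput μ E := by
  obtain ⟨C₁, hC₁⟩ := h₁
  obtain ⟨C₂, hC₂⟩ := h₂
  set c : ℝ≥0 := Real.toNNReal (2 * (2 * Real.pi) ^ s) with hc
  refine ⟨s, hs, C₁ * c + C₂ * c, fun h _ f g => ?_⟩
  have e1 := hC₁ (translateDiff h f) g
  have e2 := hC₂ f (translateDiff h g)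
  rw [coe_translateDiff, sobolevNegNorm_zero] at e1 e2
  have e3 := sobolevNegNorm_sub_translate_le hs.le hs1 h f
  have e4 := sobolevNegNorm_sub_translate_le hs.le hs1 h g
  change _ ≤ (c : ℝ≥0∞) * _ * _ at e3 e4
  calc _ ≤ C₁ * (c * ENNReal.ofReal (‖h‖ ^ s) * eLpNorm f 2 volume) * eLpNorm g 2 volume +
        C₂ * eLpNorm f 2 volume * (c * ENNReal.ofReal (‖h‖ ^ s) * eLpNorm g 2 volume) :=
        add_le_add (e1.trans (by gcongr)) (e2.trans (by gcongr))
    _ = _ := by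
        push_cast
        ring

theorem SobolevSmoothing.continuityBothInputs {s : ℝ} (hs : 0 < s) (hs1 : s ≤ 1)
    (h : SobolevSmoothing μ E s s) : ContinuityBothInputs μ E := by
  obtain ⟨C, hC⟩ := h
  set c : ℝ≥0 := Real.toNNReal (2 * (2 * Real.pi) ^ s) with hc
  refine ⟨s, s, hs, hs, C * c * c, fun h₁ h₂ _ _ f g => ?_⟩
  have e1 := hC (translateDiff h₁ f) (translateDiff h₂ g)
  rw [coe_translateDiff, coe_translateDiff] at e1
  have e3 := sobolevNegNorm_sub_translate_le hs.le hs1 h₁ f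
  have e4 := sobolevNegNorm_sub_translate_le hs.le hs1 h₂ g
  change _ ≤ (c : ℝ≥0∞) * _ * _ at e3 e4
  calc _ ≤ C * (c * ENNReal.ofReal (‖h₁‖ ^ s) * eLpNorm f 2 volume) *
        (c * ENNReal.ofReal (‖h₂‖ ^ s) * eLpNorm g 2 volume) := e1.trans (by gcongr)
    _ = _ := by
        rw [ENNReal.ofReal_mul (by positivity)]
        push_cast
        ring

end Continuity

/-! ### Surface measures -/

section SurfaceMeasure

variable {d : ℕ} {S : Set (Sp2 d)} {E : Set ℝ}

/-- The total mass `m⁻¹ m` is at most 1 also for `m = 0` and `m = ∞`, by the conventions in `[0,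
∞]`. -/
theorem isFiniteMeasure_surfaceMeasure (S : Set (Sp2 d)) : IsFiniteMeasure (surfaceMeasure S) :=
  ⟨by
    rw [surfaceMeasure, Measure.smul_apply, Measure.restrict_apply_univ, smul_eq_mul]
    exact (ENNReal.inv_mul_le_one _).trans_lt ENNReal.one_lt_top⟩

theorem integrable_surfaceMeasure_of_continuous (hS : IsCompact S) {F : Type*}
    [NormedAddCommGroup F] [SecondCountableTopology F] {a : Sp2 d → F} (ha : Continuous a) :
    Integrable a (surfaceMeasure S) := by
  have := isFiniteMeasure_surfaceMeasure S
  obtain ⟨M, hM⟩ := hS.exists_bound_of_continuousOn ha.continuousOn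
  exact Integrable.of_bound ha.aestronglyMeasurable M (Measure.ae_smul_measure
    ((ae_restrict_iff' hS.isClosed.measurableSet).2 (Eventually.of_forall hM)) _)

theorem exists_surfaceMeasure_decay (hS : IsCompact S) {k : ℕ} (hk : HasNonvanishingCurvatures S k)
    {a : Sp2 d → ℂ} (ha : ContDiff ℝ ∞ a) :
    ∃ C, 0 ≤ C ∧ ∀ ξ, ‖∫ q, waveChar ξ q * a q ∂surfaceMeasure S‖ ≤
      C * (1 + ‖ξ‖) ^ (-((k : ℝ) / 2)) := by
  obtain ⟨C, hC, h⟩ := (surface_decay hS hk).2 a ha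
  refine ⟨(μH[(Module.finrank ℝ (Sp2 d) : ℝ) - 1] S)⁻¹.toReal * C,
    mul_nonneg ENNReal.toReal_nonneg hC, fun ξ => ?_⟩
  rw [surfaceMeasure, integral_smul_measure, norm_smul, Real.norm_of_nonneg ENNReal.toReal_nonneg,
    mul_assoc, ← neg_div]
  exact mul_le_mul_of_nonneg_left (h ξ) ENNReal.toReal_nonneg

/-- Expanding `w` in an orthonormal basis reduces to finitely many fixed amplitudes, so one constant
serves all `w`. -/
theorem exists_surfaceMeasure_decay_inner (hS : IsCompact S) {k : ℕ}
    (hk : HasNonvanishingCurvatures S k) :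
    ∃ C, 0 ≤ C ∧ ∀ ξ w : Sp2 d, ‖∫ q, waveChar ξ q * (inner ℝ q w : ℝ) ∂surfaceMeasure S‖ ≤
      C * ‖w‖ * (1 + ‖ξ‖) ^ (-((k : ℝ) / 2)) := by
  set e := stdOrthonormalBasis ℝ (Sp2 d) with he
  have hs : ∀ i, ContDiff ℝ ∞ fun q : Sp2 d => ((inner ℝ q (e i) : ℝ) : ℂ) := fun i =>
    Complex.ofRealCLM.contDiff.comp (contDiff_id.inner ℝ contDiff_const)
  choose C hC hCb using fun i => exists_surfaceMeasure_decay hS hk (hs i)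
  refine ⟨∑ i, C i, Finset.sum_nonneg fun i _ => hC i, fun ξ w => ?_⟩
  have hsum : ∫ q, waveChar ξ q * (inner ℝ q w : ℝ) ∂surfaceMeasure S =
      ∑ i, ((inner ℝ (e i) w : ℝ) : ℂ) *
        ∫ q, waveChar ξ q * (inner ℝ q (e i) : ℝ) ∂surfaceMeasure S := by
    simp_rw [← integral_const_mul]
    rw [← integral_finsetSum]
    · refine integral_congr_ae (Eventually.of_forall fun q => ?_)
      simp only
      rw [← e.sum_inner_mul_inner q w, Complex.ofReal_sum, Finset.mul_sum]
      refine Finset.sum_congr rfl fun i _ => ?_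
      push_cast
      ring
    · intro i _
      exact (integrable_surfaceMeasure_of_continuous hS
        ((continuous_waveChar ξ).mul (hs i).continuous)).const_mul _
  rw [hsum, Finset.sum_mul, Finset.sum_mul]
  refine (norm_sum_le _ _).trans (Finset.sum_le_sum fun i _ => ?_)
  rw [norm_mul, Complex.norm_real]
  calc ‖inner ℝ (e i) w‖ * ‖∫ q, waveChar ξ q * (inner ℝ q (e i) : ℝ) ∂surfaceMeasure S‖
      ≤ ‖w‖ * (C i * (1 + ‖ξ‖) ^ (-((k : ℝ) / 2))) := by
        refine mul_le_mul ?_ (hCb i ξ) (norm_nonneg _) (norm_nonneg _)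
        simpa using norm_inner_le_norm (𝕜 := ℝ) (e i) w
    _ = _ := by ring

theorem sobolevSmoothing_surfaceMeasure (hS : IsCompact S) {k : ℕ}
    (hk : HasNonvanishingCurvatures S k) (hE : E ⊆ Icc 1 2) {β : ℝ}
    (hβ : upperMinkowskiDim E = (β : EReal)) {s₁ s₂ : ℝ} (hs₁ : 0 ≤ s₁) (hs₂ : 0 ≤ s₂)
    (hlt : s₁ + s₂ < (k - d - β) / 2) : SobolevSmoothing (surfaceMeasure S) E s₁ s₂ := by
  have := isFiniteMeasure_surfaceMeasure S
  obtain ⟨C₀, hC₀, h₀⟩ := exists_surfaceMeasure_decay hS hk (a := fun _ => 1) contDiff_const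
  obtain ⟨C₁, hC₁, h₁⟩ := exists_surfaceMeasure_decay_inner hS hk
  simp only [mul_one] at h₀
  -- The strict inequality on `s₁ + s₂` leaves room for a covering exponent above `β`, since the
  -- covering bound at `β` itself may fail.
  obtain ⟨γ, hβγ, hγ⟩ : ∃ γ, β < γ ∧ γ < k - d - 2 * (s₁ + s₂) := exists_between (by linarith)
  obtain ⟨B, hB, hNB⟩ := exists_coveringCount_le hβ hβγ
  refine sobolevSmoothing_of_decay (κ := (k : ℝ) / 2) (C := C₀ + C₁)
    (N := fun j => coveringCount E ((1 / 2) ^ j))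
    (integrable_surfaceMeasure_of_continuous hS continuous_norm) (by positivity) (by positivity)
    (fun ζ => (h₀ ζ).trans ?_) (fun ζ w => (h₁ ζ w).trans ?_) hE
    (fun j => exists_cover_coveringCount hE (by positivity)) hB hNB hs₁ hs₂ (by linarith)
  · gcongr
    linarith
  · gcongr
    linarith

theorem continuity_surfaceMeasure (hS : IsCompact S) {k : ℕ}
    (hk : HasNonvanishingCurvatures S k) (hE : E ⊆ Icc 1 2) {β : ℝ}
    (hβ : upperMinkowskiDim E = (β : EReal)) (hlt : d + β < k) :
    ContinuityOneInput (surfaceMeasure S) E ∧ ContinuityBothInputs (surfaceMeasure S) E := by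
  -- Even with `s` derivatives on both inputs, `2s ≤ (k - d - β)/4` is below the threshold; the cap
  -- 1 is required for `|1 - e^(iθ)| ≤ 2|θ|^s`.
  set s : ℝ := min 1 ((k - d - β) / 8) with hs
  have hs0 : 0 < s := lt_min one_pos (by linarith)
  have hs1 : s ≤ 1 := min_le_left _ _
  have hs2 : s ≤ (k - d - β) / 8 := min_le_right _ _
  have h : ∀ s₁ s₂ : ℝ, 0 ≤ s₁ → 0 ≤ s₂ → s₁ ≤ s → s₂ ≤ s →
      SobolevSmoothing (surfaceMeasure S) E s₁ s₂ := fun s₁ s₂ h1 h2 h3 h4 =>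
    sobolevSmoothing_surfaceMeasure hS hk hE hβ h1 h2 (by linarith)
  exact ⟨SobolevSmoothing.continuityOneInput hs0 hs1 (h s 0 hs0.le le_rfl le_rfl hs0.le)
    (h 0 s le_rfl hs0.le hs0.le le_rfl),
    SobolevSmoothing.continuityBothInputs hs0 hs1 (h s s hs0.le hs0.le le_rfl le_rfl)⟩

end SurfaceMeasure

/-! ### The unit sphere -/

section Sphere

variable {V : Type*} [NormedAddCommGroup V] [InnerProductSpace ℝ V] [FiniteDimensional ℝ V]

/-- The defining function of the unit sphere. -/
def sphereFunction (q : V) : ℝ := ‖q‖ ^ 2 - 1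

theorem hasFDerivAt_sphereFunction (q : V) :
    HasFDerivAt sphereFunction (2 • innerSL ℝ q) q :=
  (hasStrictFDerivAt_norm_sq q).hasFDerivAt.sub_const 1

theorem gradient_sphereFunction (q : V) : gradient sphereFunction q = (2 : ℝ) • q := by
  rw [gradient, (hasFDerivAt_sphereFunction q).fderiv, LinearIsometryEquiv.symm_apply_eq]
  ext v
  simp [two_smul]

theorem unitNormal_sphereFunction (q : V) : unitNormal sphereFunction q = ‖q‖⁻¹ • q := by
  rw [unitNormal, gradient_sphereFunction, norm_smul, smul_smul]
  congr 1
  simp only [Real.norm_ofNat]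
  rw [mul_inv_rev, inv_mul_cancel_right₀ two_ne_zero]

theorem isDefiningFunction_sphere {p : V} (hp : p ∈ Metric.sphere (0 : V) 1) :
    IsDefiningFunction (Metric.sphere (0 : V) 1) p {0}ᶜ sphereFunction where
  isOpen := isOpen_compl_singleton
  mem := by
    rintro rfl
    simp at hp
  smooth := ((contDiff_norm_sq ℝ).sub contDiff_const).contDiffOn
  regular q hq h := by
    rw [(hasFDerivAt_sphereFunction q).fderiv] at h
    have h1 := congrArg (fun L : V →L[ℝ] ℝ => L q) h
    simp only [smul_apply, innerSL_apply_apply, zero_apply, smul_eq_zero,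
      inner_self_eq_zero] at h1
    exact hq (by simpa using h1)
  zeros := by
    ext q
    simp only [mem_inter_iff, mem_sphere_zero_iff_norm, mem_sep_iff, sphereFunction,
      sub_eq_zero]
    rw [pow_eq_one_iff_of_nonneg (norm_nonneg q) two_ne_zero, and_comm]

/-- The normal field is `q / |q|`, and `|q|` has zero derivative at `p` in directions orthogonal to
`p`; this is read off from the derivative of `|q|²`. -/
theorem fderiv_unitNormal_sphereFunction {p u : V} (hp : ‖p‖ = 1) (hu : inner ℝ p u = 0) :
    fderiv ℝ (unitNormal sphereFunction) p u = u := by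
  have hp0 : p ≠ 0 := by
    rintro rfl
    simp at hp
  have h1 : HasFDerivAt (fun q : V => ‖q‖) (fderiv ℝ (fun q : V => ‖q‖) p) p :=
    (differentiableAt_id.norm ℝ hp0).hasFDerivAt
  set L := fderiv ℝ (fun q : V => ‖q‖) p with hL
  have h2 := (h1.pow 2).unique (hasStrictFDerivAt_norm_sq p).hasFDerivAt
  have h3 : L u = 0 := by
    have := congrArg (fun T : V →L[ℝ] ℝ => T u) h2
    simpa [hp, hu] using this
  have h4 := ((hasDerivAt_inv (norm_ne_zero_iff.2 hp0)).comp_hasFDerivAt p h1).smul (hasFDerivAt_id p)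
  have h5 := h4.congr_of_eventuallyEq (Eventually.of_forall unitNormal_sphereFunction)
  rw [h5.fderiv]
  simp [hp, h3]

theorem shapeOperator_sphereFunction {p : V} (hp : ‖p‖ = 1) :
    shapeOperator sphereFunction p = -LinearMap.id := by
  ext u
  have hu : inner ℝ p (u : V) = 0 := by
    have := Submodule.mem_orthogonal_singleton_iff_inner_right.1 u.2
    rwa [unitNormal_sphereFunction, hp, inv_one, one_smul] at this
  simp only [shapeOperator, ContinuousLinearMap.coe_coe, ContinuousLinearMap.comp_apply,
    Submodule.subtypeL_apply, neg_apply, fderiv_unitNormal_sphereFunction hp hu, map_neg,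
    LinearMap.neg_apply, LinearMap.id_apply]
  simp

/-- The shape operator is `-1` on a tangent space of dimension `n`, so all `n` principal curvatures
equal `-1`. -/
theorem hasNonvanishingCurvatures_sphere {n : ℕ} (hn : Module.finrank ℝ V = n + 1) :
    HasNonvanishingCurvatures (Metric.sphere (0 : V) 1) n := by
  intro p hp
  have hp1 : ‖p‖ = 1 := mem_sphere_zero_iff_norm.1 hp
  refine ⟨_, _, isDefiningFunction_sphere hp, le_of_eq ?_⟩
  have hfact : Fact (Module.finrank ℝ V = n + 1) := ⟨hn⟩
  have hν : unitNormal sphereFunction p ≠ 0 := by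
    rw [unitNormal_sphereFunction, hp1, inv_one, one_smul]
    rintro rfl
    simp at hp1
  have hT : Module.finrank ℝ (tangent sphereFunction p) = n :=
    Submodule.finrank_orthogonal_span_singleton hν
  have hchar : (shapeOperator sphereFunction p).charpoly =
      (Polynomial.X - Polynomial.C (-1 : ℝ)) ^ n := by
    have b := Module.finBasisOfFinrankEq ℝ (tangent sphereFunction p) hT
    rw [shapeOperator_sphereFunction hp1, ← LinearMap.charpoly_toMatrix _ b, map_neg,
      LinearMap.toMatrix_id, ← Matrix.diagonal_one, Matrix.diagonal_neg, Matrix.charpoly_diagonal]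
    simp
  rw [principalCurvatures, hchar, Polynomial.roots_pow, Polynomial.roots_X_sub_C,
    Multiset.filter_eq_self.2]
  · simp
  · intro a ha
    rw [Multiset.mem_nsmul, Multiset.mem_singleton] at ha
    rw [ha.2]
    norm_num

theorem finrank_Sp2 (d : ℕ) : Module.finrank ℝ (Sp2 d) = d + d := by
  rw [(WithLp.linearEquiv 2 ℝ (Sp d × Sp d)).finrank_eq, Module.finrank_prod,
    finrank_euclideanSpace, Fintype.card_fin]

end Sphere

end BilinearSurface

end

/-! ### The sphere and general hypersurfaces -/

open BilinearSurface in
theorem corollary1p5 (d : ℕ) (hd : 2 ≤ d) (E : Set ℝ) (hE : E ⊆ Set.Icc 1 2) (hne : E.Nonempty)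
    (β : ℝ) (hβ : upperMinkowskiDim E = (β : EReal)) :
    -- the sphere
    ((1 + β < d → ∀ s₁ s₂ : ℝ, 0 ≤ s₁ → 0 ≤ s₂ → s₁ + s₂ < (d - 1 - β) / 2 →
        SobolevSmoothing (sphereMeasure d) E s₁ s₂) ∧
      (3 ≤ d → 1 + β < d) ∧
      (¬ (d = 2 ∧ β = 1) →
        ContinuityOneInput (sphereMeasure d) E ∧ ContinuityBothInputs (sphereMeasure d) E)) ∧
    -- hypersurfaces with at least `k` nonvanishing principal curvatures
    (∀ (k : ℕ) (S : Set (Sp2 d)), IsCompact S → S.Nonempty → IsSmoothHypersurface S →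
      HasNonvanishingCurvatures S k → d + β < k →
        (∀ s₁ s₂ : ℝ, 0 ≤ s₁ → 0 ≤ s₂ → s₁ + s₂ < (k - d - β) / 2 →
          SobolevSmoothing (surfaceMeasure S) E s₁ s₂) ∧
        ContinuityOneInput (surfaceMeasure S) E ∧ ContinuityBothInputs (surfaceMeasure S) E) := by
  have hβ1 := upperMinkowskiDim_le_one hE hβ
  have hsphere : HasNonvanishingCurvatures (Metric.sphere (0 : Sp2 d) 1) (2 * d - 1) :=
    hasNonvanishingCurvatures_sphere (by rw [finrank_Sp2]; omega)
  have hcompact : IsCompact (Metric.sphere (0 : Sp2 d) 1) := isCompact_sphere _ _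
  -- With `k = 2d - 1` the quantity `k - d - β` becomes `d - 1 - β`.
  have hcast : ((2 * d - 1 : ℕ) : ℝ) = 2 * d - 1 := by
    rw [Nat.cast_sub (by omega)]
    push_cast
    ring
  refine ⟨⟨fun _ s₁ s₂ hs₁ hs₂ hlt => ?_, fun h => ?_, fun h => ?_⟩,
    fun k S hS _ _ hk hlt => ⟨fun s₁ s₂ hs₁ hs₂ h => ?_, ?_⟩⟩
  · exact sobolevSmoothing_surfaceMeasure hcompact hsphere hE hβ hs₁ hs₂ (by rw [hcast]; linarith)
  · have : (3 : ℝ) ≤ d := by exact_mod_cast h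
    linarith
  · refine continuity_surfaceMeasure hcompact hsphere hE hβ ?_
    rw [hcast]
    -- The condition `d + β < k` reads `1 + β < d`. As `β ≤ 1`, it can fail only for `d = 2` and `β
    -- = 1`.
    rcases hd.eq_or_lt with h2 | h2
    · have hβ2 : β < 1 := lt_of_le_of_ne hβ1 fun h3 => h ⟨h2.symm, h3⟩
      have : (d : ℝ) = 2 := by exact_mod_cast h2.symm
      linarith
    · have : (3 : ℝ) ≤ d := by exact_mod_cast h2
      linarith
  · exact sobolevSmoothing_surfaceMeasure hS hk hE hβ hs₁ hs₂ h
  · exact continuity_surfaceMeasure hS hk hE hβ hlt
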